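/- Let $\Bbbk$ be a field of characteristic $0$ and let $G$ be a finitely generated group. Let $I$ be the augmentation ideal of the group algebra $\Bbbk G$, let $\operatorname{gr}(\Bbbk G)=\bigoplus_{n\ge 0} I^n/I^{n+1}$, and let $\widehat{\operatorname{gr}}(\Bbbk G)=\prod_{n\ge 0} I^n/I^{n+1}$ be its degree completion, filtered by $\widehat{\mathcal F}_n=\prod_{j\ge n} I^j/I^{j+1}$ and with the comultiplication $\bar\Delta\colon \widehat{\operatorname{gr}}(\Bbbk G)\to \widehat{\operatorname{gr}}(\Bbbk G)\,\hat\otimes\,\widehat{\operatorname{gr}}(\Bbbk G)=\prod_{i,j} I^i/I^{i+1}\otimes I^j/I^{j+1}$ induced by $\Delta(g)=g\otimes g$ on $\Bbbk G$. A *Taylor expansion* of $G$ over $\Bbbk$ is a map $E\colon G\to\widehat{\operatorname{gr}}(\Bbbk G)$ such that (i) its linear extension $\bar E\colon \Bbbk G\to\widehat{\operatorname{gr}}(\Bbbk G)$ is a morphism of algebras; (ii) for all $n\ge 0$ and $f\in I^n$, $\bar E(f)\in\widehat{\mathcal F}_n$ and the degree $n$ component of $\bar E(f)$ is the class of $f$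 in $I^n/I^{n+1}$; (iii) $\bar\Delta(E(g))=E(g)\,\hat\otimes\, E(g)$ for all $g\in G$. It is *faithful* if $E$ is injective. The *Malcev Lie algebra* $\mathfrak m(G;\Bbbk)$ is the Lie algebra of primitive elements of the complete Hopf algebra $\widehat{\Bbbk G}=\varprojlim_n \Bbbk G/I^n$, filtered by its intersections with the ideals $\widehat{I^n}=\ker(\widehat{\Bbbk G}\to\Bbbk G/I^n)$. Let $\Gamma_1G=G$, $\Gamma_{n+1}G=[\Gamma_nG,G]$, and let $\widehat{\operatorname{gr}}(G;\Bbbk)=\prod_{n\ge 1}(\Gamma_nG/\Gamma_{n+1}G)\otimes_{\mathbb Z}\Bbbk$ be the degree completion of the associated graded Lie algebra of $G$, whose bracket is induced by the group commutator, with its degree filtration. The group $G$ is *filtered-formal* over $\Bbbk$ if there is an isomorphism of filtered Lie algebras $\mathfrak m(G;\Bbbk)\to\widehat{\operatorname{gr}}(G;\Bbbk)$ which induces the identity on associated graded Lie algebras, where $\operatorname{gr}(\mathfrak m(G;\Bbbk))$ and $\operatorname{gr}(G;\Bbbk)$ are compared inside $\operatorname{gr}(\Bbbk G)$ through the canonical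 maps $\operatorname{gr}_n(\mathfrak m(G;\Bbbk))\subset \widehat{I^n}/\widehat{I^{n+1}}=I^n/I^{n+1}$ and $\operatorname{gr}_n(G;\Bbbk)\to I^n/I^{n+1}$, $[g]\otimes t\mapsto t\,[g-1]$. The group $G$ is *residually torsion-free nilpotent* if for every $g\ne 1$ in $G$ there are a torsion-free nilpotent group $Q$ and an epimorphism $\psi\colon G\to Q$ with $\psi(g)\ne 1$. **Proposition.** $G$ has a faithful Taylor expansion over $\Bbbk$ if and only if $G$ is residually torsion-free nilpotent and filtered-formal over $\Bbbk$. -/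

import Mathlib

open scoped TensorProduct

namespace GroupExpansion

noncomputable section

/-! ## The group algebra and its augmentation filtration -/

section GroupAlgebra

variable (k : Type*) [Field k] (G : Type*) [Group G]

/-- The group algebra `kG`, with Mathlib's bialgebra structure, in which every `g` in `G` is
group-like with counit `1`. -/
abbrev GroupAlg := MonoidAlgebra k G

/-- The augmentation ideal `I` of `kG`, the kernel of the counit `ε(g) = 1`. -/
def augIdeal : Ideal (GroupAlg k G) :=
  RingHom.ker (Bialgebra.counitAlgHom k (GroupAlg k G))

instance augIdeal_isTwoSided : (augIdeal k G).IsTwoSided :=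
  inferInstanceAs (RingHom.ker (Bialgebra.counitAlgHom k (GroupAlg k G))).IsTwoSided

variable {k G} in
lemma augIdeal_pow_le {m n : ℕ} (h : m ≤ n) : augIdeal k G ^ n ≤ augIdeal k G ^ m :=
  Ideal.pow_le_pow_right h

variable {k G} in
lemma mul_mem_augIdeal_pow {i j n : ℕ} (h : i + j = n) {a b : GroupAlg k G}
    (ha : a ∈ augIdeal k G ^ i) (hb : b ∈ augIdeal k G ^ j) : a * b ∈ augIdeal k G ^ n := by
  rw [← h, Ideal.IsTwoSided.pow_add]
  exact Ideal.mul_mem_mul ha hb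

variable {k G} in
lemma mem_augIdeal_pow_zero (a : GroupAlg k G) : a ∈ augIdeal k G ^ 0 := by
  rw [Submodule.pow_zero, Ideal.one_eq_top]
  exact Submodule.mem_top

/-- The power `I ^ n` as a `k`-subspace of `kG`. -/
def augPow (n : ℕ) : Submodule k (GroupAlg k G) :=
  (augIdeal k G ^ n).restrictScalars k

lemma augPow_succ_le (n : ℕ) : augPow k G (n + 1) ≤ augPow k G n :=
  fun _ h => augIdeal_pow_le (Nat.le_succ n) h

variable {k G} in
lemma of_sub_one_mem (g : G) : MonoidAlgebra.of k G g - 1 ∈ augIdeal k G := by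
  rw [augIdeal, RingHom.mem_ker]
  simp

/-! ## The comultiplication of `kG` and the augmentation filtration -/

/-- The `n`-th term `∑_{p+q=n} I ^ p ⊗ I ^ q` of the tensor product filtration on `kG ⊗ kG`. -/
def tensorFil (n : ℕ) : Submodule k (GroupAlg k G ⊗[k] GroupAlg k G) :=
  Submodule.span k {t | ∃ p q a b, p + q = n ∧ a ∈ augIdeal k G ^ p ∧ b ∈ augIdeal k G ^ q ∧
    t = a ⊗ₜ[k] b}

variable {k G}

lemma tmul_mem_tensorFil {p q n : ℕ} (h : p + q = n) {a b : GroupAlg k G}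
    (ha : a ∈ augIdeal k G ^ p) (hb : b ∈ augIdeal k G ^ q) : a ⊗ₜ[k] b ∈ tensorFil k G n :=
  Submodule.subset_span ⟨p, q, a, b, h, ha, hb, rfl⟩

lemma mul_mem_tensorFil {m n : ℕ} {s t : GroupAlg k G ⊗[k] GroupAlg k G}
    (hs : s ∈ tensorFil k G m) (ht : t ∈ tensorFil k G n) : s * t ∈ tensorFil k G (m + n) := by
  induction hs using Submodule.span_induction with
  | zero => simp
  | add x y _ _ hx hy => rw [add_mul]; exact add_mem hx hy
  | smul c x _ hx => rw [smul_mul_assoc]; exact Submodule.smul_mem _ _ hx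
  | mem x hx =>
    obtain ⟨p, q, a, b, h, ha, hb, rfl⟩ := hx
    induction ht using Submodule.span_induction with
    | zero => simp
    | add x y _ _ hx hy => rw [mul_add]; exact add_mem hx hy
    | smul c x _ hx => rw [mul_smul_comm]; exact Submodule.smul_mem _ _ hx
    | mem y hy =>
      obtain ⟨p', q', a', b', h', ha', hb', rfl⟩ := hy
      rw [Algebra.TensorProduct.tmul_mul_tmul]
      exact tmul_mem_tensorFil (p := p + p') (q := q + q') (by omega)
        (mul_mem_augIdeal_pow rfl ha ha') (mul_mem_augIdeal_pow rfl hb hb')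

lemma comul_sub_counit_mem (f : GroupAlg k G) :
    Coalgebra.comul (R := k) f - Coalgebra.counit (R := k) f • (1 : GroupAlg k G ⊗[k] GroupAlg k G)
      ∈ tensorFil k G 1 := by
  induction f using MonoidAlgebra.induction_linear with
  | zero => simp
  | add x y hx hy =>
    have := add_mem hx hy
    rw [map_add, map_add, add_smul]
    convert this using 1
    abel
  | single g c =>
    have h1 : MonoidAlgebra.single g c = c • MonoidAlgebra.of k G g := by simp
    rw [h1, map_smul, map_smul, smul_assoc,
      ← smul_sub c (Coalgebra.comul (R := k) (MonoidAlgebra.of k G g))]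
    refine Submodule.smul_mem _ _ ?_
    have h2 : Coalgebra.comul (R := k) (MonoidAlgebra.of k G g) =
        MonoidAlgebra.of k G g ⊗ₜ[k] MonoidAlgebra.of k G g := by simp
    have h3 : Coalgebra.counit (R := k) (MonoidAlgebra.of k G g) = 1 := by simp
    have h4 : MonoidAlgebra.of k G g ⊗ₜ[k] MonoidAlgebra.of k G g -
        (1 : k) • (1 : GroupAlg k G ⊗[k] GroupAlg k G) =
        (MonoidAlgebra.of k G g - 1) ⊗ₜ[k] MonoidAlgebra.of k G g +
        (1 : GroupAlg k G) ⊗ₜ[k] (MonoidAlgebra.of k G g - 1) := by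
      rw [Algebra.TensorProduct.one_def, TensorProduct.sub_tmul, TensorProduct.tmul_sub, one_smul]
      abel
    rw [h2, h3, h4]
    exact add_mem
      (tmul_mem_tensorFil (p := 1) (q := 0) rfl (by simpa only [Submodule.pow_one] using of_sub_one_mem g) (mem_augIdeal_pow_zero _))
      (tmul_mem_tensorFil (p := 0) (q := 1) rfl (mem_augIdeal_pow_zero _)
        (by simpa only [Submodule.pow_one] using of_sub_one_mem g))

/-- The comultiplication of `kG` preserves the augmentation filtrations. -/
lemma comul_mem_tensorFil {n : ℕ} {f : GroupAlg k G} (hf : f ∈ augIdeal k G ^ n) :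
    Bialgebra.comulAlgHom k (GroupAlg k G) f ∈ tensorFil k G n := by
  induction n generalizing f with
  | zero =>
    generalize Bialgebra.comulAlgHom k (GroupAlg k G) f = t
    induction t using TensorProduct.induction_on with
    | zero => exact zero_mem _
    | tmul a b =>
      exact tmul_mem_tensorFil (p := 0) (q := 0) rfl (mem_augIdeal_pow_zero a)
        (mem_augIdeal_pow_zero b)
    | add x y hx hy => exact add_mem hx hy
  | succ n ih =>
    rw [Submodule.pow_succ] at hf
    induction hf using Submodule.mul_induction_on' with
    | mem_mul_mem a ha b hb =>
      rw [map_mul]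
      refine mul_mem_tensorFil (ih ha) ?_
      have hb' : Coalgebra.counit (R := k) b = 0 := hb
      simpa [hb'] using comul_sub_counit_mem b
    | add x _ y _ hx hy => rw [map_add]; exact add_mem hx hy

end GroupAlgebra

/-! ## The completed group algebra -/

section Completion

variable (k : Type*) [Field k] (G : Type*) [Group G]

/-- The truncation `kG / I ^ n`. -/
def Trunc (n : ℕ) : Type _ := GroupAlg k G ⧸ augIdeal k G ^ n

instance (n : ℕ) : Ring (Trunc k G n) := inferInstanceAs (Ring (GroupAlg k G ⧸ augIdeal k G ^ n))

instance (n : ℕ) : Algebra k (Trunc k G n) :=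
  inferInstanceAs (Algebra k (GroupAlg k G ⧸ augIdeal k G ^ n))

/-- The projection `kG → kG / I ^ n`. -/
def truncMk (n : ℕ) : GroupAlg k G →ₐ[k] Trunc k G n :=
  Ideal.Quotient.mkₐ k (augIdeal k G ^ n)

variable {k G} in
lemma truncMk_surjective (n : ℕ) : Function.Surjective (truncMk k G n) :=
  Ideal.Quotient.mk_surjective

variable {k G} in
lemma truncMk_eq_zero {n : ℕ} {f : GroupAlg k G} :
    truncMk k G n f = 0 ↔ f ∈ augIdeal k G ^ n :=
  Ideal.Quotient.eq_zero_iff_mem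

variable {k G} in
/-- The projection `kG / I ^ n → kG / I ^ m`, for `m ≤ n`. -/
def truncMap {m n : ℕ} (h : m ≤ n) : Trunc k G n →ₐ[k] Trunc k G m :=
  Ideal.Quotient.factorₐ k (augIdeal_pow_le h)

variable {k G} in
lemma truncMap_comp {m n : ℕ} (h : m ≤ n) :
    (truncMap h).comp (truncMk k G n) = truncMk k G m :=
  rfl

/-- The compatible families in `∏ kG / I ^ n`. -/
def completionSubalgebra : Subalgebra k (∀ n, Trunc k G n) where
  carrier := {x | ∀ ⦃m n : ℕ⦄ (h : m ≤ n), truncMap h (x n) = x m}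
  mul_mem' hx hy m n h := by simp only [Pi.mul_apply, map_mul, hx h, hy h]
  add_mem' hx hy m n h := by simp only [Pi.add_apply, map_add, hx h, hy h]
  algebraMap_mem' c m n h := by simp only [Pi.algebraMap_apply, AlgHom.commutes]

/-- The `I`-adic completion `lim kG / I ^ n` of the group algebra. -/
def CompletedAlg : Type _ := ↥(completionSubalgebra k G)

instance : Ring (CompletedAlg k G) := inferInstanceAs (Ring (completionSubalgebra k G))

instance : Algebra k (CompletedAlg k G) := inferInstanceAs (Algebra k (completionSubalgebra k G))

variable {k G} in
/-- The projection of the completed group algebra to `kG / I ^ n`. -/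
def proj (n : ℕ) : CompletedAlg k G →ₐ[k] Trunc k G n :=
  (Pi.evalAlgHom k (fun n => Trunc k G n) n).comp (completionSubalgebra k G).val

/-- The projection `kG ⊗ kG → kG / I ^ m ⊗ kG / I ^ n`. -/
def truncTensor (m n : ℕ) :
    GroupAlg k G ⊗[k] GroupAlg k G →ₐ[k] Trunc k G m ⊗[k] Trunc k G n :=
  Algebra.TensorProduct.map (truncMk k G m) (truncMk k G n)

variable {k G} in
lemma truncTensor_eq_zero {m n N : ℕ} (h : m + n ≤ N + 1)
    {t : GroupAlg k G ⊗[k] GroupAlg k G} (ht : t ∈ tensorFil k G N) :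
    truncTensor k G m n t = 0 := by
  induction ht using Submodule.span_induction with
  | zero => simp
  | add x y _ _ hx hy => rw [map_add, hx, hy, add_zero]
  | smul c x _ hx => rw [map_smul, hx, smul_zero]
  | mem x hx =>
    obtain ⟨p, q, a, b, hpq, ha, hb, rfl⟩ := hx
    rw [truncTensor, Algebra.TensorProduct.map_tmul]
    rcases le_or_gt m p with hp | hp
    · rw [truncMk_eq_zero.2 (augIdeal_pow_le hp ha), TensorProduct.zero_tmul]
    · rw [truncMk_eq_zero.2 (augIdeal_pow_le (show n ≤ q by omega) hb), TensorProduct.tmul_zero]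

/-- The map `kG / I ^ (2 n) → kG / I ^ n ⊗ kG / I ^ n` induced by the comultiplication of `kG`. -/
def comulTrunc (n : ℕ) : Trunc k G (2 * n) →ₐ[k] Trunc k G n ⊗[k] Trunc k G n :=
  Ideal.Quotient.liftₐ _ ((truncTensor k G n n).comp (Bialgebra.comulAlgHom k (GroupAlg k G)))
    fun _ ha => truncTensor_eq_zero (by omega) (comul_mem_tensorFil ha)

/-- The compatible families in `∏ kG / I ^ n ⊗ kG / I ^ n`. -/
def completedTensorSubalgebra : Subalgebra k (∀ n, Trunc k G n ⊗[k] Trunc k G n) where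
  carrier := {x | ∀ ⦃m n : ℕ⦄ (h : m ≤ n),
    Algebra.TensorProduct.map (truncMap h) (truncMap h) (x n) = x m}
  mul_mem' hx hy m n h := by simp only [Pi.mul_apply, map_mul, hx h, hy h]
  add_mem' hx hy m n h := by simp only [Pi.add_apply, map_add, hx h, hy h]
  algebraMap_mem' c m n h := by simp only [Pi.algebraMap_apply, AlgHom.commutes]

/-- The completed tensor product `lim kG / I ^ n ⊗ kG / I ^ n` of the completed group algebra
with itself. -/
def CompletedTensor : Type _ := ↥(completedTensorSubalgebra k G)

instance : Ring (CompletedTensor k G) := 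
  inferInstanceAs (Ring (completedTensorSubalgebra k G))

instance : Algebra k (CompletedTensor k G) :=
  inferInstanceAs (Algebra k (completedTensorSubalgebra k G))

variable {k G}

/-- The projection of the completed tensor product to `kG / I ^ n ⊗ kG / I ^ n`. -/
def tensorProj (n : ℕ) : CompletedTensor k G →ₐ[k] Trunc k G n ⊗[k] Trunc k G n :=
  (Pi.evalAlgHom k (fun n => Trunc k G n ⊗[k] Trunc k G n) n).comp
    (completedTensorSubalgebra k G).val

lemma completedAlg_ext {x y : CompletedAlg k G} (h : ∀ n, proj n x = proj n y) : x = y :=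
  Subtype.ext (funext h)

lemma completedTensor_ext {x y : CompletedTensor k G} (h : ∀ n, tensorProj n x = tensorProj n y) :
    x = y :=
  Subtype.ext (funext h)

lemma truncMap_proj {m n : ℕ} (h : m ≤ n) (x : CompletedAlg k G) :
    truncMap h (proj n x) = proj m x :=
  x.2 h

/-- The element `x ⊗̂ y` of the completed tensor product. -/
def completedTmul (x y : CompletedAlg k G) : CompletedTensor k G :=
  ⟨fun n => proj n x ⊗ₜ[k] proj n y, fun m n h => by
    rw [Algebra.TensorProduct.map_tmul, truncMap_proj, truncMap_proj]⟩

@[simp] lemma tensorProj_completedTmul (n : ℕ) (x y : CompletedAlg k G) :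
    tensorProj n (completedTmul x y) = proj n x ⊗ₜ[k] proj n y :=
  rfl

lemma comulTrunc_compat {m n : ℕ} (h : m ≤ n) (x : Trunc k G (2 * n)) :
    Algebra.TensorProduct.map (truncMap h) (truncMap h) (comulTrunc k G n x) =
      comulTrunc k G m (truncMap (Nat.mul_le_mul_left 2 h) x) := by
  obtain ⟨f, rfl⟩ := truncMk_surjective _ x
  change Algebra.TensorProduct.map (truncMap h) (truncMap h) (truncTensor k G n n _) =
    truncTensor k G m m _
  rw [← AlgHom.comp_apply, truncTensor, ← Algebra.TensorProduct.map_comp]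
  rfl

/-- The comultiplication `Δ̂` of the completed group algebra. -/
def completedComul : CompletedAlg k G →ₐ[k] CompletedTensor k G where
  toFun x := ⟨fun n => comulTrunc k G n (proj (2 * n) x), fun m n h => by
    rw [comulTrunc_compat, truncMap_proj]⟩
  map_one' := completedTensor_ext fun n => map_one (comulTrunc k G n)
  map_mul' x y := completedTensor_ext fun n => map_mul (comulTrunc k G n) _ _
  map_zero' := completedTensor_ext fun n => map_zero (comulTrunc k G n)
  map_add' x y := completedTensor_ext fun n => map_add (comulTrunc k G n) _ _
  commutes' c := completedTensor_ext fun n => AlgHom.commutes (comulTrunc k G n) c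

@[simp] lemma tensorProj_completedComul (n : ℕ) (x : CompletedAlg k G) :
    tensorProj n (completedComul x) = comulTrunc k G n (proj (2 * n) x) :=
  rfl

/-- Primitivity, `Δ̂ x = x ⊗̂ 1 + 1 ⊗̂ x`, in the completed group algebra. -/
def IsPrimitive (x : CompletedAlg k G) : Prop :=
  completedComul x = completedTmul x 1 + completedTmul 1 x

lemma isPrimitive_iff (x : CompletedAlg k G) : IsPrimitive x ↔
    ∀ n, comulTrunc k G n (proj (2 * n) x) = proj n x ⊗ₜ[k] 1 + 1 ⊗ₜ[k] proj n x := by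
  refine ⟨fun h n => ?_, fun h => completedTensor_ext fun n => ?_⟩
  · simpa using congrArg (tensorProj n) h
  · simpa using h n

instance : LieRing (CompletedAlg k G) := LieRing.ofAssociativeRing

instance : LieAlgebra k (CompletedAlg k G) := LieAlgebra.ofAssociativeAlgebra

variable (k G) in
/-- The Malcev Lie algebra `𝔪(G; k)`: the primitive elements of the completed group algebra,
with bracket `[x, y] = x y - y x`. -/
def malcev : LieSubalgebra k (CompletedAlg k G) where
  carrier := {x | IsPrimitive x}
  zero_mem' := (isPrimitive_iff _).2 fun n => by simp
  add_mem' {x y} hx hy := (isPrimitive_iff _).2 fun n => by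
    have hx' := (isPrimitive_iff x).1 hx n
    have hy' := (isPrimitive_iff y).1 hy n
    rw [map_add, map_add, map_add, hx', hy', TensorProduct.add_tmul, TensorProduct.tmul_add]
    abel
  smul_mem' c x hx := (isPrimitive_iff _).2 fun n => by
    have hx' := (isPrimitive_iff x).1 hx n
    rw [map_smul, map_smul, map_smul, hx', smul_add, TensorProduct.smul_tmul',
      TensorProduct.tmul_smul]
  lie_mem' {x y} hx hy := (isPrimitive_iff _).2 fun n => by
    have hx' := (isPrimitive_iff x).1 hx n
    have hy' := (isPrimitive_iff y).1 hy n
    rw [Ring.lie_def, map_sub, map_sub, map_sub, map_mul, map_mul, map_mul, map_mul, map_mul,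
      map_mul, hx', hy']
    simp only [mul_add, add_mul, Algebra.TensorProduct.tmul_mul_tmul, one_mul, mul_one,
      TensorProduct.sub_tmul, TensorProduct.tmul_sub]
    abel

variable (k G) in
/-- The filtration of `𝔪(G; k)` induced by the inverse limit filtration of the completed group
algebra, whose `n`-th term is the kernel of the projection to `kG / I ^ n`. -/
def malcevFil (n : ℕ) : Submodule k (malcev k G) :=
  LinearMap.ker ((proj (k := k) (G := G) n).toLinearMap ∘ₗ (malcev k G).toSubmodule.subtype)

end Completion

/-! ## The associated graded algebra of the group algebra and its degree completion -/

section Graded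

variable (k : Type*) [Field k] (G : Type*) [Group G]

/-- The degree `n` piece `I ^ n / I ^ (n + 1)` of the associated graded algebra `gr(kG)`. -/
abbrev GrAlg (n : ℕ) := augPow k G n ⧸ (augPow k G (n + 1)).submoduleOf (augPow k G n)

variable {k G} in
/-- The class in `I ^ n / I ^ (n + 1)` of an element of `I ^ n`. -/
def grMk (n : ℕ) : augPow k G n →ₗ[k] GrAlg k G n :=
  Submodule.mkQ _

variable {k G} in
lemma grMk_surjective (n : ℕ) : Function.Surjective (grMk (k := k) (G := G) n) :=
  Submodule.mkQ_surjective _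

variable {k G} in
lemma grMk_eq_zero {n : ℕ} (f : augPow k G n) :
    grMk n f = 0 ↔ (f : GroupAlg k G) ∈ augIdeal k G ^ (n + 1) :=
  Submodule.Quotient.mk_eq_zero _

variable {k G} in
lemma grMk_eq {n : ℕ} {a b : augPow k G n}
    (h : (a : GroupAlg k G) - (b : GroupAlg k G) ∈ augIdeal k G ^ (n + 1)) :
    grMk n a = grMk n b := by
  rw [← sub_eq_zero, ← map_sub]
  exact (grMk_eq_zero (a - b)).2 h

variable {k G}

/-- The product `I ^ i × I ^ j → I ^ n / I ^ (n + 1)`, for `i + j = n`. -/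
def preMul {i j n : ℕ} (h : i + j = n) : augPow k G i →ₗ[k] augPow k G j →ₗ[k] GrAlg k G n :=
  LinearMap.mk₂ k (fun a b => grMk n ⟨a.1 * b.1, mul_mem_augIdeal_pow h a.2 b.2⟩)
    (fun a a' b => by
      rw [← map_add]; exact congrArg _ (Subtype.ext (add_mul a.1 a'.1 b.1)))
    (fun c a b => by
      rw [← map_smul]; exact congrArg _ (Subtype.ext (smul_mul_assoc c a.1 b.1)))
    (fun a b b' => by
      rw [← map_add]; exact congrArg _ (Subtype.ext (mul_add a.1 b.1 b'.1)))
    (fun c a b => by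
      rw [← map_smul]; exact congrArg _ (Subtype.ext (mul_smul_comm c a.1 b.1)))

/-- The product `I ^ i / I ^ (i + 1) × I ^ j / I ^ (j + 1) → I ^ n / I ^ (n + 1)`, for `i + j = n`,
induced by the product of `kG`. -/
def grMul {i j n : ℕ} (h : i + j = n) : GrAlg k G i →ₗ[k] GrAlg k G j →ₗ[k] GrAlg k G n :=
  Submodule.liftQ _
    (LinearMap.flip (Submodule.liftQ _ (preMul h).flip (fun b hb => by
      rw [LinearMap.mem_ker]
      refine LinearMap.ext fun a => (grMk_eq_zero _).2 ?_
      exact mul_mem_augIdeal_pow (show i + (j + 1) = n + 1 by omega) a.2 hb)))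
    (fun a ha => by
      rw [LinearMap.mem_ker]
      refine LinearMap.ext fun b => ?_
      obtain ⟨b, rfl⟩ := grMk_surjective j b
      refine (grMk_eq_zero _).2 ?_
      exact mul_mem_augIdeal_pow (show (i + 1) + j = n + 1 by omega) ha b.2)

lemma grMul_mk {i j n : ℕ} (h : i + j = n) (a : augPow k G i) (b : augPow k G j) :
    grMul h (grMk i a) (grMk j b) = grMk n ⟨a.1 * b.1, mul_mem_augIdeal_pow h a.2 b.2⟩ :=
  rfl

variable (k G) in
/-- The degree completion `∏ I ^ n / I ^ (n + 1)` of `gr(kG)`. -/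
def GrHat : Type _ := ∀ n, GrAlg k G n

namespace GrHat

instance : AddCommGroup (GrHat k G) := inferInstanceAs (AddCommGroup (∀ n, GrAlg k G n))

instance : Module k (GrHat k G) := inferInstanceAs (Module k (∀ n, GrAlg k G n))

/-- The homogeneous component of degree `n`. -/
def component (n : ℕ) : GrHat k G →ₗ[k] GrAlg k G n :=
  LinearMap.proj (R := k) (φ := fun n => GrAlg k G n) n

lemma ext {x y : GrHat k G} (h : ∀ n, component n x = component n y) : x = y :=
  funext h

/-- The unit, of degree `0`, is the class of `1` in `kG / I`. -/
instance : One (GrHat k G) :=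
  ⟨fun n => if h : n = 0 then grMk n ⟨1, h ▸ mem_augIdeal_pow_zero 1⟩ else 0⟩

/-- The convolution product of the degree completion. -/
instance : Mul (GrHat k G) :=
  ⟨fun x y n => ∑ p : Finset.HasAntidiagonal.antidiagonal n,
    grMul (Finset.HasAntidiagonal.mem_antidiagonal.1 p.2) (component p.1.1 x) (component p.1.2 y)⟩

lemma component_mul (n : ℕ) (x y : GrHat k G) : component n (x * y) =
    ∑ p : Finset.HasAntidiagonal.antidiagonal n,
      grMul (Finset.HasAntidiagonal.mem_antidiagonal.1 p.2) (component p.1.1 x) (component p.1.2 y) :=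
  rfl

/-- The element with components the classes of the coefficients of a power series over `kG` whose
`n`-th coefficient lies in `I ^ n`. -/
def ofSeries (a : PowerSeries (GroupAlg k G))
    (ha : ∀ n, PowerSeries.coeff n a ∈ augIdeal k G ^ n) : GrHat k G :=
  fun n => grMk n ⟨PowerSeries.coeff n a, ha n⟩

lemma exists_ofSeries (x : GrHat k G) : ∃ a ha, ofSeries a ha = x := by
  choose a ha using fun n => grMk_surjective n (component n x)
  refine ⟨PowerSeries.mk fun n => (a n).1, fun n => ?_, ext fun n => ?_⟩
  · rw [PowerSeries.coeff_mk]; exact (a n).2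
  · rw [← ha n]
    exact congrArg (grMk n) (Subtype.ext (PowerSeries.coeff_mk _ _))

lemma coeff_mul_mem {a b : PowerSeries (GroupAlg k G)}
    (ha : ∀ n, PowerSeries.coeff n a ∈ augIdeal k G ^ n)
    (hb : ∀ n, PowerSeries.coeff n b ∈ augIdeal k G ^ n) (n : ℕ) :
    PowerSeries.coeff n (a * b) ∈ augIdeal k G ^ n := by
  rw [PowerSeries.coeff_mul]
  exact sum_mem fun p hp => mul_mem_augIdeal_pow (Finset.HasAntidiagonal.mem_antidiagonal.1 hp) (ha _) (hb _)

lemma coeff_one_mem (n : ℕ) :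
    PowerSeries.coeff n (1 : PowerSeries (GroupAlg k G)) ∈ augIdeal k G ^ n := by
  rw [PowerSeries.coeff_one]
  split_ifs with h
  · rw [h]; exact mem_augIdeal_pow_zero 1
  · exact zero_mem _

lemma ofSeries_mul {a b : PowerSeries (GroupAlg k G)}
    (ha : ∀ n, PowerSeries.coeff n a ∈ augIdeal k G ^ n)
    (hb : ∀ n, PowerSeries.coeff n b ∈ augIdeal k G ^ n) :
    ofSeries a ha * ofSeries b hb = ofSeries (a * b) (coeff_mul_mem ha hb) := by
  refine ext fun n => ?_
  rw [component_mul]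
  change ∑ p : Finset.HasAntidiagonal.antidiagonal n, grMk n ⟨PowerSeries.coeff p.1.1 a * PowerSeries.coeff p.1.2 b,
    mul_mem_augIdeal_pow (Finset.HasAntidiagonal.mem_antidiagonal.1 p.2) (ha _) (hb _)⟩ = grMk n ⟨_, _⟩
  rw [← map_sum]
  refine congrArg _ (Subtype.ext ?_)
  refine Eq.trans ?_ (PowerSeries.coeff_mul n a b).symm
  rw [AddSubmonoidClass.coe_finsetSum]
  exact Finset.sum_coe_sort (Finset.HasAntidiagonal.antidiagonal n)
    (fun p => PowerSeries.coeff p.1 a * PowerSeries.coeff p.2 b)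

lemma ofSeries_one : ofSeries (1 : PowerSeries (GroupAlg k G)) coeff_one_mem = 1 := by
  refine funext fun n => ?_
  change grMk n ⟨_, _⟩ = dite _ _ _
  split_ifs with h
  · exact congrArg _ (Subtype.ext ((PowerSeries.coeff_one n).trans (if_pos h)))
  · rw [← map_zero (grMk n)]
    exact congrArg _ (Subtype.ext ((PowerSeries.coeff_one n).trans (if_neg h)))

lemma ofSeries_congr {a b : PowerSeries (GroupAlg k G)} (h : a = b)
    (ha : ∀ n, PowerSeries.coeff n a ∈ augIdeal k G ^ n)
    (hb : ∀ n, PowerSeries.coeff n b ∈ augIdeal k G ^ n) : ofSeries a ha = ofSeries b hb := by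
  subst h; rfl

instance : Ring (GrHat k G) :=
  { (inferInstance : AddCommGroup (GrHat k G)),
    (inferInstance : Mul (GrHat k G)),
    (inferInstance : One (GrHat k G)) with
    left_distrib := fun x y z => ext fun n => by
      simp only [component_mul, map_add, Finset.sum_add_distrib]
    right_distrib := fun x y z => ext fun n => by
      simp only [component_mul, map_add, LinearMap.add_apply, Finset.sum_add_distrib]
    zero_mul := fun x => ext fun n => by
      simp only [component_mul, map_zero, LinearMap.zero_apply, Finset.sum_const_zero]
    mul_zero := fun x => ext fun n => by
      simp only [component_mul, map_zero, Finset.sum_const_zero]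
    mul_assoc := fun x y z => by
      obtain ⟨a, ha, rfl⟩ := exists_ofSeries x
      obtain ⟨b, hb, rfl⟩ := exists_ofSeries y
      obtain ⟨c, hc, rfl⟩ := exists_ofSeries z
      simp only [ofSeries_mul]
      exact ofSeries_congr (mul_assoc a b c) _ _
    one_mul := fun x => by
      obtain ⟨a, ha, rfl⟩ := exists_ofSeries x
      rw [← ofSeries_one, ofSeries_mul]
      exact ofSeries_congr (one_mul a) _ _
    mul_one := fun x => by
      obtain ⟨a, ha, rfl⟩ := exists_ofSeries x
      rw [← ofSeries_one, ofSeries_mul]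
      exact ofSeries_congr (mul_one a) _ _ }

instance : Algebra k (GrHat k G) :=
  Algebra.ofModule
    (fun c x y => ext fun n => by
      simp only [component_mul, map_smul, LinearMap.smul_apply, Finset.smul_sum])
    (fun c x y => ext fun n => by
      simp only [component_mul, map_smul, Finset.smul_sum])

end GrHat

/-- The inclusion `I ^ n / I ^ (n + 1) → kG / I ^ (n + 1)`. -/
def grIncl (n : ℕ) : GrAlg k G n →ₗ[k] Trunc k G (n + 1) :=
  Submodule.liftQ _ ((truncMk k G (n + 1)).toLinearMap ∘ₗ (augPow k G n).subtype)
    fun _ ha => truncMk_eq_zero.2 ha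

lemma grIncl_mk (n : ℕ) (a : augPow k G n) : grIncl n (grMk n a) = truncMk k G (n + 1) a.1 :=
  rfl

lemma grIncl_injective (n : ℕ) : Function.Injective (grIncl (k := k) (G := G) n) := by
  rw [injective_iff_map_eq_zero]
  intro x hx
  obtain ⟨a, rfl⟩ := grMk_surjective n x
  exact (grMk_eq_zero a).2 (truncMk_eq_zero.1 hx)

/-- The inclusion of `I ^ i / I ^ (i + 1) ⊗ I ^ j / I ^ (j + 1)` in
`kG / I ^ (i + 1) ⊗ kG / I ^ (j + 1)`. -/
def grTensorIncl (i j : ℕ) :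
    GrAlg k G i ⊗[k] GrAlg k G j →ₗ[k] Trunc k G (i + 1) ⊗[k] Trunc k G (j + 1) :=
  TensorProduct.map (grIncl i) (grIncl j)

lemma grTensorIncl_injective (i j : ℕ) :
    Function.Injective (grTensorIncl (k := k) (G := G) i j) :=
  TensorProduct.map_injective_of_flat_flat _ _ (grIncl_injective i) (grIncl_injective j)

lemma truncTensor_mem_range {i j n : ℕ} (h : i + j = n)
    {t : GroupAlg k G ⊗[k] GroupAlg k G} (ht : t ∈ tensorFil k G n) :
    truncTensor k G (i + 1) (j + 1) t ∈ LinearMap.range (grTensorIncl (k := k) (G := G) i j) := by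
  induction ht using Submodule.span_induction with
  | zero => rw [map_zero]; exact zero_mem _
  | add x y _ _ hx hy => rw [map_add]; exact add_mem hx hy
  | smul c x _ hx => rw [map_smul]; exact Submodule.smul_mem _ _ hx
  | mem x hx =>
    obtain ⟨p, q, a, b, hpq, ha, hb, rfl⟩ := hx
    rw [truncTensor, Algebra.TensorProduct.map_tmul]
    rcases lt_trichotomy p i with hp | hp | hp
    · rw [truncMk_eq_zero.2 (augIdeal_pow_le (show j + 1 ≤ q by omega) hb),
        TensorProduct.tmul_zero]
      exact zero_mem _
    · obtain rfl : q = j := by omega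
      subst hp
      exact ⟨grMk p ⟨a, ha⟩ ⊗ₜ[k] grMk q ⟨b, hb⟩, rfl⟩
    · rw [truncMk_eq_zero.2 (augIdeal_pow_le (show i + 1 ≤ p by omega) ha),
        TensorProduct.zero_tmul]
      exact zero_mem _

/-- The restriction to `I ^ n` of the projection of the comultiplication of `kG` to bidegree
`(i, j)`, where `i + j = n`. -/
def preComul {i j n : ℕ} (h : i + j = n) :
    augPow k G n →ₗ[k] LinearMap.range (grTensorIncl (k := k) (G := G) i j) :=
  LinearMap.codRestrict _
    ((truncTensor k G (i + 1) (j + 1)).toLinearMap ∘ₗ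
      (Bialgebra.comulAlgHom k (GroupAlg k G)).toLinearMap ∘ₗ (augPow k G n).subtype)
    fun a => truncTensor_mem_range h (comul_mem_tensorFil a.2)

/-- The component `I ^ n / I ^ (n + 1) → I ^ i / I ^ (i + 1) ⊗ I ^ j / I ^ (j + 1)`, `i + j = n`,
of the comultiplication `gr(Δ)` of `gr(kG)`: it sends the class of `f ∈ I ^ n` to the class of
`Δ f ∈ ∑ I ^ p ⊗ I ^ q` in bidegree `(i, j)`. -/
def grComul {i j n : ℕ} (h : i + j = n) : GrAlg k G n →ₗ[k] GrAlg k G i ⊗[k] GrAlg k G j :=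
  Submodule.liftQ _
    ((LinearEquiv.ofInjective _ (grTensorIncl_injective (k := k) (G := G) i j)).symm.toLinearMap ∘ₗ
      preComul h)
    fun a ha => by
      rw [LinearMap.mem_ker, LinearMap.comp_apply]
      have : preComul h a = 0 :=
        Subtype.ext (truncTensor_eq_zero (by omega) (comul_mem_tensorFil (n := n + 1) ha))
      rw [this, map_zero]

lemma grTensorIncl_grComul {i j n : ℕ} (h : i + j = n) (a : augPow k G n) :
    grTensorIncl i j (grComul h (grMk n a)) =
      truncTensor k G (i + 1) (j + 1) (Bialgebra.comulAlgHom k (GroupAlg k G) a.1) := by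
  change grTensorIncl i j ((LinearEquiv.ofInjective _ (grTensorIncl_injective i j)).symm
    (preComul h a)) = _
  rw [← LinearEquiv.ofInjective_apply (h := grTensorIncl_injective (k := k) (G := G) i j),
    LinearEquiv.apply_symm_apply]
  rfl

variable (k G) in
/-- The completed tensor product of the degree completion of `gr(kG)` with itself, which is the
product of all `I ^ i / I ^ (i + 1) ⊗ I ^ j / I ^ (j + 1)`. -/
abbrev GrHatTensor := ∀ i j : ℕ, GrAlg k G i ⊗[k] GrAlg k G j

/-- The comultiplication of the degree completion of `gr(kG)`. -/
def grHatComul : GrHat k G →ₗ[k] GrHatTensor k G :=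
  LinearMap.pi fun i => LinearMap.pi fun j =>
    grComul (rfl : i + j = i + j) ∘ₗ GrHat.component (i + j)

/-- The element `x ⊗̂ y` of the completed tensor product. -/
def grHatTmul (x y : GrHat k G) : GrHatTensor k G :=
  fun i j => GrHat.component i x ⊗ₜ[k] GrHat.component j y

variable (k G) in
/-- The degree filtration of the degree completion: the `n`-th term consists of the elements whose
components of degree less than `n` vanish. -/
def grHatFil (n : ℕ) : Submodule k (GrHat k G) where
  carrier := {x | ∀ j < n, GrHat.component j x = 0}
  zero_mem' j _ := map_zero _
  add_mem' hx hy j hj := by rw [map_add, hx j hj, hy j hj, add_zero]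
  smul_mem' c x hx j hj := by rw [map_smul, hx j hj, smul_zero]

/-! ## Taylor expansions -/

/-- A (multiplicative) expansion of `G`: a map `E : G → gr^(kG)` whose linear extension `Ē` to `kG`
is an algebra morphism (equivalently, `E` is a monoid map), preserves the filtrations and induces
the identity on `gr(kG)`, that is, for `f ∈ I ^ n` the component of `Ē f` of degree `n` is the class
of `f`. -/
structure IsExpansion (E : G →* GrHat k G) : Prop where
  mem_fil : ∀ (n : ℕ) (f : augPow k G n),
    MonoidAlgebra.lift k (GrHat k G) G E (f : GroupAlg k G) ∈ grHatFil k G n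
  gr_eq_id : ∀ (n : ℕ) (f : augPow k G n),
    GrHat.component n (MonoidAlgebra.lift k (GrHat k G) G E (f : GroupAlg k G)) = grMk n f

/-- A Taylor expansion: an expansion whose values are group-like, `Δ̄ (E g) = E g ⊗̂ E g`. -/
structure IsTaylorExpansion (E : G →* GrHat k G) : Prop extends IsExpansion E where
  groupLike : ∀ g, grHatComul (E g) = grHatTmul (E g) (E g)

variable (k G) in
/-- `G` has a faithful Taylor expansion over `k`. -/
def HasFaithfulTaylorExpansion : Prop :=
  ∃ E : G →* GrHat k G, IsTaylorExpansion E ∧ Function.Injective E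

end Graded

/-! ## The associated graded Lie algebra of a group -/

section GroupLie

open scoped commutatorElement

variable (G : Type*) [Group G]

/-- The lower central series, with the indexing `Γ_1 = G`, `Γ_{n+1} = [Γ_n, G]`; also `Γ_0 = G`. -/
def lcs (n : ℕ) : Subgroup G := (⊤ : Subgroup G).lowerCentralSeries (n - 1)

instance lcs_normal (n : ℕ) : (lcs G n).Normal := by
  unfold lcs; infer_instance

/-- The quotient `Γ_n / Γ_{n+1}`. For `n = 0` this is the trivial group. -/
def LcsQuot (n : ℕ) : Type _ := lcs G n ⧸ (lcs G (n + 1)).subgroupOf (lcs G n)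

instance (n : ℕ) : Group (LcsQuot G n) :=
  inferInstanceAs (Group (lcs G n ⧸ (lcs G (n + 1)).subgroupOf (lcs G n)))

variable {G}

/-- The class in `Γ_n / Γ_{n+1}` of an element of `Γ_n`. -/
def lcsMk (n : ℕ) : lcs G n →* LcsQuot G n :=
  QuotientGroup.mk' _

lemma lcsMk_surjective (n : ℕ) : Function.Surjective (lcsMk (G := G) n) :=
  QuotientGroup.mk'_surjective _

lemma lcsMk_eq_one {n : ℕ} (a : lcs G n) : lcsMk n a = 1 ↔ (a : G) ∈ lcs G (n + 1) :=
  QuotientGroup.eq_one_iff _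

lemma lcsMk_eq {n : ℕ} {a b : lcs G n} (h : (a : G) / b ∈ lcs G (n + 1)) :
    lcsMk n a = lcsMk n b := by
  rw [← div_eq_one, ← map_div]
  exact (lcsMk_eq_one _).2 h

lemma commutator_lcs_top_le (n : ℕ) : ⁅lcs G n, (⊤ : Subgroup G)⁆ ≤ lcs G (n + 1) := by
  cases n with
  | zero => exact le_top
  | succ n => exact le_rfl

lemma commutator_lcs_le (i j : ℕ) : ⁅lcs G i, lcs G j⁆ ≤ lcs G (i + j) := by
  induction j generalizing i with
  | zero => exact Subgroup.commutator_le_left _ _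
  | succ j ih =>
    rcases j with _ | j
    · exact commutator_lcs_top_le i
    · -- the three subgroups lemma modulo `Γ_{i+j+2}`
      let N := lcs G (i + (j + 1 + 1))
      let π := QuotientGroup.mk' N
      have key : ∀ H : Subgroup G, H ≤ N ↔ H.map π = ⊥ := fun H => by
        rw [Subgroup.map_eq_bot_iff, QuotientGroup.ker_mk']
      change ⁅lcs G i, ⁅lcs G (j + 1), (⊤ : Subgroup G)⁆⁆ ≤ N
      have h1 : ⁅⁅(⊤ : Subgroup G), lcs G i⁆, lcs G (j + 1)⁆ ≤ N := by
        rw [Subgroup.commutator_comm ⊤]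
        refine (Subgroup.commutator_mono (commutator_lcs_top_le i) le_rfl).trans ((ih _).trans ?_)
        exact le_of_eq (congrArg (lcs G) (by omega))
      have h2 : ⁅⁅lcs G i, lcs G (j + 1)⁆, (⊤ : Subgroup G)⁆ ≤ N :=
        (Subgroup.commutator_mono (ih i) le_rfl).trans (commutator_lcs_top_le _)
      rw [Subgroup.commutator_comm]
      rw [key, Subgroup.map_commutator, Subgroup.map_commutator] at h1 h2 ⊢
      exact Subgroup.commutator_commutator_eq_bot_of_rotate h1 h2

lemma commutator_mem_lcs {i j n : ℕ} (h : i + j = n) {a b : G} (ha : a ∈ lcs G i)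
    (hb : b ∈ lcs G j) : ⁅a, b⁆ ∈ lcs G n :=
  h ▸ commutator_lcs_le i j (Subgroup.commutator_mem_commutator ha hb)

lemma conj_mem_lcs {n : ℕ} (g : G) {a : G} (ha : a ∈ lcs G n) : g * a * g⁻¹ ∈ lcs G n :=
  (lcs_normal G n).conj_mem a ha g

/-- Conjugation by `G` is trivial on `Γ_n / Γ_{n+1}`. -/
lemma lcsMk_conj {n : ℕ} (g : G) (a : lcs G n) :
    lcsMk n ⟨g * a.1 * g⁻¹, conj_mem_lcs g a.2⟩ = lcsMk n a := by
  refine lcsMk_eq ?_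
  have h : ⁅g, a.1⁆ ∈ lcs G (n + 1) := by
    refine commutator_lcs_top_le n ?_
    rw [Subgroup.commutator_comm]
    exact Subgroup.commutator_mem_commutator (Subgroup.mem_top g) a.2
  simpa [commutatorElement_def, div_eq_mul_inv] using h

instance (n : ℕ) : CommGroup (LcsQuot G n) :=
  { (inferInstance : Group (LcsQuot G n)) with
    mul_comm := fun x y => by
      obtain ⟨a, rfl⟩ := lcsMk_surjective n x
      obtain ⟨b, rfl⟩ := lcsMk_surjective n y
      rw [← mul_inv_eq_iff_eq_mul, ← map_mul, ← map_inv, ← map_mul]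
      exact lcsMk_conj a.1 b }

/-- The commutator pairing `Γ_i × Γ_j → Γ_n / Γ_{n+1}`, for `i + j = n`. -/
def preCommutator {i j n : ℕ} (h : i + j = n) : lcs G i →* lcs G j →* LcsQuot G n :=
  MonoidHom.mk' (fun a => MonoidHom.mk'
      (fun b => lcsMk n ⟨⁅a.1, b.1⁆, commutator_mem_lcs h a.2 b.2⟩)
      (fun b b' => by
        rw [← lcsMk_conj b.1 ⟨⁅a.1, b'.1⁆, commutator_mem_lcs h a.2 b'.2⟩, ← map_mul]
        refine congrArg _ (Subtype.ext ?_)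
        simp [commutatorElement_def, mul_assoc]))
    (fun a a' => by
      refine MonoidHom.ext fun b => ?_
      change lcsMk n ⟨⁅a.1 * a'.1, b.1⁆, _⟩ =
        lcsMk n ⟨⁅a.1, b.1⁆, commutator_mem_lcs h a.2 b.2⟩ *
          lcsMk n ⟨⁅a'.1, b.1⁆, commutator_mem_lcs h a'.2 b.2⟩
      rw [mul_comm, ← lcsMk_conj a.1 ⟨⁅a'.1, b.1⁆, commutator_mem_lcs h a'.2 b.2⟩, ← map_mul]
      refine congrArg _ (Subtype.ext ?_)
      simp [commutatorElement_def, mul_assoc])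

/-- The pairing `Γ_i / Γ_{i+1} × Γ_j / Γ_{j+1} → Γ_n / Γ_{n+1}`, for `i + j = n`, induced by the
group commutator `[a, b] = a b a⁻¹ b⁻¹`. -/
def lcsCommutator {i j n : ℕ} (h : i + j = n) : LcsQuot G i →* LcsQuot G j →* LcsQuot G n :=
  QuotientGroup.lift _
    (MonoidHom.flip (QuotientGroup.lift _ (preCommutator h).flip (fun b hb => by
      refine MonoidHom.ext fun a => (lcsMk_eq_one _).2 ?_
      exact commutator_mem_lcs (show i + (j + 1) = n + 1 by omega) a.2 hb)))
    (fun a ha => by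
      refine MonoidHom.ext fun b => ?_
      obtain ⟨b, rfl⟩ := lcsMk_surjective j b
      refine (lcsMk_eq_one _).2 ?_
      exact commutator_mem_lcs (show (i + 1) + j = n + 1 by omega) ha b.2)

lemma lcsCommutator_mk {i j n : ℕ} (h : i + j = n) (a : lcs G i) (b : lcs G j) :
    lcsCommutator h (lcsMk i a) (lcsMk j b) =
      lcsMk n ⟨⁅a.1, b.1⁆, commutator_mem_lcs h a.2 b.2⟩ :=
  rfl

lemma lcsCommutator_swap {i j n : ℕ} (h : i + j = n) (h' : j + i = n) (x : LcsQuot G i)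
    (y : LcsQuot G j) : lcsCommutator h x y = (lcsCommutator h' y x)⁻¹ := by
  obtain ⟨a, rfl⟩ := lcsMk_surjective i x
  obtain ⟨b, rfl⟩ := lcsMk_surjective j y
  rw [lcsCommutator_mk, lcsCommutator_mk, ← map_inv]
  exact congrArg _ (Subtype.ext (commutatorElement_inv b.1 a.1).symm)

/-- The Jacobi identity, from the Hall–Witt identity. -/
lemma lcsCommutator_jacobi {a b c d n : ℕ} (h1 : a + b = d) (h2 : d + c = n)
    {e : ℕ} (h3 : b + c = e) (h4 : e + a = n) {f : ℕ} (h5 : c + a = f) (h6 : f + b = n)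
    (x : LcsQuot G a) (y : LcsQuot G b) (z : LcsQuot G c) :
    lcsCommutator h2 (lcsCommutator h1 x y) z * lcsCommutator h4 (lcsCommutator h3 y z) x *
      lcsCommutator h6 (lcsCommutator h5 z x) y = 1 := by
  obtain ⟨x, rfl⟩ := lcsMk_surjective a x
  obtain ⟨y, rfl⟩ := lcsMk_surjective b y
  obtain ⟨z, rfl⟩ := lcsMk_surjective c z
  have e1 : lcsCommutator h2 (lcsCommutator h1 (lcsMk a x) (lcsMk b y)) (lcsMk c z) =
      lcsMk n ⟨⁅⁅x.1, y.1⁆, y.1 * z.1 * y.1⁻¹⁆,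
        commutator_mem_lcs h2 (commutator_mem_lcs h1 x.2 y.2) (conj_mem_lcs _ z.2)⟩ := by
    rw [← lcsMk_conj y.1 z]; rfl
  have e2 : lcsCommutator h4 (lcsCommutator h3 (lcsMk b y) (lcsMk c z)) (lcsMk a x) =
      lcsMk n ⟨⁅⁅y.1, z.1⁆, z.1 * x.1 * z.1⁻¹⁆,
        commutator_mem_lcs h4 (commutator_mem_lcs h3 y.2 z.2) (conj_mem_lcs _ x.2)⟩ := by
    rw [← lcsMk_conj z.1 x]; rfl
  have e3 : lcsCommutator h6 (lcsCommutator h5 (lcsMk c z) (lcsMk a x)) (lcsMk b y) =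
      lcsMk n ⟨⁅⁅z.1, x.1⁆, x.1 * y.1 * x.1⁻¹⁆,
        commutator_mem_lcs h6 (commutator_mem_lcs h5 z.2 x.2) (conj_mem_lcs _ y.2)⟩ := by
    rw [← lcsMk_conj x.1 y]; rfl
  rw [e1, e2, e3, ← map_mul, ← map_mul, ← map_one (lcsMk n)]
  exact congrArg _ (Subtype.ext (commutatorElement_commutatorElement_conj_mul x.1 y.1 z.1))

variable (G) in
/-- `Γ_n / Γ_{n+1}`, written additively. -/
abbrev AddLcsQuot (n : ℕ) := Additive (LcsQuot G n)

/-- The commutator pairing as a biadditive map. -/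
def lcsBracket {i j n : ℕ} (h : i + j = n) :
    AddLcsQuot G i →ₗ[ℤ] AddLcsQuot G j →ₗ[ℤ] AddLcsQuot G n :=
  AddMonoidHom.toIntLinearMap
    (AddMonoidHom.mk'
      (fun x => AddMonoidHom.toIntLinearMap (MonoidHom.toAdditive (lcsCommutator h x.toMul)))
      (fun x y => LinearMap.ext fun z =>
        congrArg Additive.ofMul
          (DFunLike.congr_fun (map_mul (lcsCommutator h) x.toMul y.toMul) z.toMul)))

lemma lcsBracket_apply {i j n : ℕ} (h : i + j = n) (x : AddLcsQuot G i) (y : AddLcsQuot G j) :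
    lcsBracket h x y = Additive.ofMul (lcsCommutator h x.toMul y.toMul) :=
  rfl

variable (k : Type*) [Field k]

variable (G) in
/-- The degree `n` piece `(Γ_n / Γ_{n+1}) ⊗ k` of the associated graded Lie algebra `gr(G; k)`. -/
abbrev GrLie (n : ℕ) := k ⊗[ℤ] AddLcsQuot G n

variable {k}

/-- The Lie bracket `gr_i(G; k) × gr_j(G; k) → gr_n(G; k)`, for `i + j = n`, the `k`-bilinear
extension of the commutator pairing. -/
def grBracket {i j n : ℕ} (h : i + j = n) : GrLie G k i →ₗ[k] GrLie G k j →ₗ[k] GrLie G k n :=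
  LinearMap.liftBaseChange k (LinearMap.baseChangeHom ℤ k _ _ ∘ₗ lcsBracket h)

lemma grBracket_tmul {i j n : ℕ} (h : i + j = n) (s t : k) (x : AddLcsQuot G i)
    (y : AddLcsQuot G j) :
    grBracket h (s ⊗ₜ[ℤ] x) (t ⊗ₜ[ℤ] y) = (s * t) ⊗ₜ[ℤ] lcsBracket h x y := by
  simp [grBracket, TensorProduct.smul_tmul']

lemma grBracket_swap {i j n : ℕ} (h : i + j = n) (h' : j + i = n) (x : GrLie G k i)
    (y : GrLie G k j) : grBracket h x y = -grBracket h' y x := by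
  induction x using TensorProduct.induction_on with
  | zero => simp
  | add x x' hx hx' => simp only [map_add, LinearMap.add_apply, hx, hx', neg_add]
  | tmul s x =>
    induction y using TensorProduct.induction_on with
    | zero => simp
    | add y y' hy hy' => simp only [map_add, LinearMap.add_apply, hy, hy', neg_add]
    | tmul t y =>
      rw [grBracket_tmul, grBracket_tmul, mul_comm, ← TensorProduct.tmul_neg]
      refine congrArg _ ?_
      rw [lcsBracket_apply, lcsBracket_apply, lcsCommutator_swap h h']
      rfl

lemma grBracket_jacobi {a b c d n : ℕ} (h1 : a + b = d) (h2 : d + c = n)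
    {e : ℕ} (h3 : b + c = e) (h4 : e + a = n) {f : ℕ} (h5 : c + a = f) (h6 : f + b = n)
    (x : GrLie G k a) (y : GrLie G k b) (z : GrLie G k c) :
    grBracket h2 (grBracket h1 x y) z + grBracket h4 (grBracket h3 y z) x +
      grBracket h6 (grBracket h5 z x) y = 0 := by
  induction x using TensorProduct.induction_on with
  | zero => simp
  | add x x' hx hx' =>
    simp only [map_add, LinearMap.add_apply]
    rw [← add_zero (0 : GrLie G k n)]
    nth_rewrite 1 [← hx]
    rw [← hx']
    abel
  | tmul s x =>
    induction y using TensorProduct.induction_on with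
    | zero => simp
    | add y y' hy hy' =>
      simp only [map_add, LinearMap.add_apply]
      rw [← add_zero (0 : GrLie G k n)]
      nth_rewrite 1 [← hy]
      rw [← hy']
      abel
    | tmul t y =>
      induction z using TensorProduct.induction_on with
      | zero => simp
      | add z z' hz hz' =>
        simp only [map_add, LinearMap.add_apply]
        rw [← add_zero (0 : GrLie G k n)]
        nth_rewrite 1 [← hz]
        rw [← hz']
        abel
      | tmul u z =>
        simp only [grBracket_tmul]
        rw [show t * u * s = s * t * u by ring, show u * s * t = s * t * u by ring,
          ← TensorProduct.tmul_add, ← TensorProduct.tmul_add]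
        refine Eq.trans (congrArg _ ?_) (TensorProduct.tmul_zero _ _)
        exact congrArg Additive.ofMul
          (lcsCommutator_jacobi h1 h2 h3 h4 h5 h6 x.toMul y.toMul z.toMul)

lemma grBracket_leibniz {a b c d n : ℕ} (h1 : b + c = d) (h2 : a + d = n)
    {e : ℕ} (h3 : a + b = e) (h4 : e + c = n) {f : ℕ} (h5 : a + c = f) (h6 : b + f = n)
    (x : GrLie G k a) (y : GrLie G k b) (z : GrLie G k c) :
    grBracket h2 x (grBracket h1 y z) =
      grBracket h4 (grBracket h3 x y) z + grBracket h6 y (grBracket h5 x z) := by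
  have := grBracket_jacobi h3 h4 h1 (show d + a = n by omega) (show c + a = f by omega)
    (show f + b = n by omega) x y z
  rw [grBracket_swap h2 (show d + a = n by omega), grBracket_swap h6 (show f + b = n by omega),
    grBracket_swap h5 (show c + a = f by omega), map_neg, LinearMap.neg_apply, neg_neg,
    neg_eq_iff_add_eq_zero, ← this]
  abel

variable (G k) in
/-- The degree completion `∏ gr_n(G; k)` of the associated graded Lie algebra of `G` (the piece of
degree `0` is zero). -/
def GrLieHat : Type _ := ∀ n, GrLie G k n

namespace GrLieHat

instance : AddCommGroup (GrLieHat G k) := inferInstanceAs (AddCommGroup (∀ n, GrLie G k n))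

instance : Module k (GrLieHat G k) := inferInstanceAs (Module k (∀ n, GrLie G k n))

/-- The homogeneous component of degree `n`. -/
def component (n : ℕ) : GrLieHat G k →ₗ[k] GrLie G k n :=
  LinearMap.proj (R := k) (φ := fun n => GrLie G k n) n

lemma ext {x y : GrLieHat G k} (h : ∀ n, component n x = component n y) : x = y :=
  funext h

/-- The Lie bracket of the degree completion. -/
instance : Bracket (GrLieHat G k) (GrLieHat G k) :=
  ⟨fun x y n => ∑ p : Finset.HasAntidiagonal.antidiagonal n,
    grBracket (Finset.HasAntidiagonal.mem_antidiagonal.1 p.2)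
      (component p.1.1 x) (component p.1.2 y)⟩

lemma component_lie (n : ℕ) (x y : GrLieHat G k) : component n ⁅x, y⁆ =
    ∑ p : Finset.HasAntidiagonal.antidiagonal n,
      grBracket (Finset.HasAntidiagonal.mem_antidiagonal.1 p.2)
        (component p.1.1 x) (component p.1.2 y) :=
  rfl

/-- Sums over `i + (j + l) = n` as iterated sums, in three ways. -/
lemma sum_triples {M : Type*} [AddCommMonoid M] (n : ℕ) (f : ℕ → ℕ → ℕ → M) :
    (∑ p ∈ Finset.HasAntidiagonal.antidiagonal n, ∑ q ∈ Finset.HasAntidiagonal.antidiagonal p.1,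
      f q.1 q.2 p.2) =
    (∑ p ∈ Finset.HasAntidiagonal.antidiagonal n, ∑ q ∈ Finset.HasAntidiagonal.antidiagonal p.2,
      f p.1 q.1 q.2) ∧
    (∑ p ∈ Finset.HasAntidiagonal.antidiagonal n, ∑ q ∈ Finset.HasAntidiagonal.antidiagonal p.2,
      f q.1 p.1 q.2) =
    (∑ p ∈ Finset.HasAntidiagonal.antidiagonal n, ∑ q ∈ Finset.HasAntidiagonal.antidiagonal p.2,
      f p.1 q.1 q.2) := by
  simp only [Finset.sum_sigma']
  constructor
  · refine Finset.sum_nbij' (fun s => ⟨(s.2.1, s.2.2 + s.1.2), (s.2.2, s.1.2)⟩)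
      (fun s => ⟨(s.1.1 + s.2.1, s.2.2), (s.1.1, s.2.1)⟩) ?_ ?_ ?_ ?_ ?_
    all_goals rintro ⟨⟨a, b⟩, ⟨c, d⟩⟩ hs
    all_goals simp only [Finset.mem_sigma, Finset.HasAntidiagonal.mem_antidiagonal] at hs ⊢
    all_goals first | exact ⟨by omega, trivial⟩ | (obtain ⟨h1, h2⟩ := hs; subst h2; rfl)
  · refine Finset.sum_nbij' (fun s => ⟨(s.2.1, s.1.1 + s.2.2), (s.1.1, s.2.2)⟩)
      (fun s => ⟨(s.2.1, s.1.1 + s.2.2), (s.1.1, s.2.2)⟩) ?_ ?_ ?_ ?_ ?_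
    all_goals rintro ⟨⟨a, b⟩, ⟨c, d⟩⟩ hs
    all_goals simp only [Finset.mem_sigma, Finset.HasAntidiagonal.mem_antidiagonal] at hs ⊢
    all_goals first | exact ⟨by omega, trivial⟩ | (obtain ⟨h1, h2⟩ := hs; subst h2; rfl)

lemma component_lie_total (n : ℕ) (x y : GrLieHat G k) : component n ⁅x, y⁆ =
    ∑ p ∈ Finset.HasAntidiagonal.antidiagonal n,
      if h : p.1 + p.2 = n then grBracket h (component p.1 x) (component p.2 y) else 0 := by
  rw [component_lie]
  refine Eq.trans ?_ (Finset.sum_coe_sort (Finset.HasAntidiagonal.antidiagonal n) fun p =>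
    if h : p.1 + p.2 = n then grBracket h (component p.1 x) (component p.2 y) else 0)
  refine Finset.sum_congr rfl fun p _ => ?_
  rw [dif_pos (Finset.HasAntidiagonal.mem_antidiagonal.1 p.2)]

lemma component_lie_lie (n : ℕ) (x y z : GrLieHat G k) : component n ⁅x, ⁅y, z⁆⁆ =
    ∑ p ∈ Finset.HasAntidiagonal.antidiagonal n, ∑ q ∈ Finset.HasAntidiagonal.antidiagonal p.2,
      if h : p.1 + (q.1 + q.2) = n then grBracket h (component p.1 x)
        (grBracket rfl (component q.1 y) (component q.2 z)) else 0 := by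
  rw [component_lie_total]
  refine Finset.sum_congr rfl fun ⟨a, b⟩ hp => ?_
  have hp' := Finset.HasAntidiagonal.mem_antidiagonal.1 hp
  rw [dif_pos hp', component_lie_total, map_sum]
  refine Finset.sum_congr rfl fun ⟨c, d⟩ hq => ?_
  have hq' := Finset.HasAntidiagonal.mem_antidiagonal.1 hq
  dsimp only at hp' hq' ⊢
  subst hq'
  rw [dif_pos rfl, dif_pos hp']

lemma component_lie_lie' (n : ℕ) (x y z : GrLieHat G k) : component n ⁅⁅x, y⁆, z⁆ =
    ∑ p ∈ Finset.HasAntidiagonal.antidiagonal n, ∑ q ∈ Finset.HasAntidiagonal.antidiagonal p.1,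
      if h : (q.1 + q.2) + p.2 = n then grBracket h
        (grBracket rfl (component q.1 x) (component q.2 y)) (component p.2 z) else 0 := by
  rw [component_lie_total]
  refine Finset.sum_congr rfl fun ⟨a, b⟩ hp => ?_
  have hp' := Finset.HasAntidiagonal.mem_antidiagonal.1 hp
  rw [dif_pos hp', component_lie_total, map_sum, LinearMap.sum_apply]
  refine Finset.sum_congr rfl fun ⟨c, d⟩ hq => ?_
  have hq' := Finset.HasAntidiagonal.mem_antidiagonal.1 hq
  dsimp only at hp' hq' ⊢
  subst hq'
  rw [dif_pos rfl, dif_pos hp']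

variable [CharZero k]

instance : LieRing (GrLieHat G k) where
  add_lie x y z := ext fun n => by
    simp only [component_lie, map_add, LinearMap.add_apply, Finset.sum_add_distrib]
  lie_add x y z := ext fun n => by
    simp only [component_lie, map_add, Finset.sum_add_distrib]
  lie_self x := by
    have h : ⁅x, x⁆ = -⁅x, x⁆ := ext fun n => by
      rw [map_neg, component_lie_total, ← Finset.sum_neg_distrib,
        ← Finset.Nat.sum_antidiagonal_swap]
      refine Finset.sum_congr rfl fun ⟨a, b⟩ hp => ?_
      have hp' : a + b = n := Finset.HasAntidiagonal.mem_antidiagonal.1 hp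
      have hp'' : b + a = n := by omega
      dsimp only [Prod.fst_swap, Prod.snd_swap]
      rw [dif_pos hp', dif_pos hp'']
      exact grBracket_swap hp'' hp' _ _
    have h2 : (2 : k) • ⁅x, x⁆ = 0 := by
      rw [two_smul]; nth_rewrite 1 [h]; exact neg_add_cancel _
    exact (smul_eq_zero.1 h2).resolve_left two_ne_zero
  leibniz_lie x y z := ext fun n => by
    rw [map_add, component_lie_lie, component_lie_lie', component_lie_lie,
      (sum_triples n fun a b c => if h : (a + b) + c = n then grBracket h
        (grBracket rfl (component a x) (component b y)) (component c z) else 0).1,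
      (sum_triples n fun a b c => if h : b + (a + c) = n then grBracket h (component b y)
        (grBracket rfl (component a x) (component c z)) else 0).2,
      ← Finset.sum_add_distrib]
    refine Finset.sum_congr rfl fun ⟨a, b⟩ hp => ?_
    have hp' : a + b = n := Finset.HasAntidiagonal.mem_antidiagonal.1 hp
    rw [← Finset.sum_add_distrib]
    refine Finset.sum_congr rfl fun ⟨c, d⟩ hq => ?_
    have hq' : c + d = b := Finset.HasAntidiagonal.mem_antidiagonal.1 hq
    dsimp only
    rw [dif_pos (show a + (c + d) = n by omega), dif_pos (show a + c + d = n by omega),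
      dif_pos (show c + (a + d) = n by omega)]
    exact grBracket_leibniz _ _ _ _ _ _ _ _ _

instance : LieAlgebra k (GrLieHat G k) where
  lie_smul t x y := ext fun n => by
    simp only [component_lie, map_smul, Finset.smul_sum]

end GrLieHat

variable (G k) in
/-- The degree filtration of the degree completion of `gr(G; k)`. -/
def grLieHatFil (n : ℕ) : Submodule k (GrLieHat G k) where
  carrier := {x | ∀ j < n, GrLieHat.component j x = 0}
  zero_mem' j _ := map_zero _
  add_mem' hx hy j hj := by rw [map_add, hx j hj, hy j hj, add_zero]
  smul_mem' c x hx j hj := by rw [map_smul, hx j hj, smul_zero]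

end GroupLie

/-! ## The comparison of `gr(G; k)` with `gr(kG)` -/

section Comparison

open scoped commutatorElement

variable {k : Type*} [Field k] {G : Type*} [Group G]

variable (k G) in
/-- The `n`-th dimension subgroup, consisting of all `g` with `g - 1 ∈ I ^ n`. -/
def dimSubgroup (n : ℕ) : Subgroup G where
  carrier := {g | MonoidAlgebra.of k G g - 1 ∈ augIdeal k G ^ n}
  one_mem' := by
    change MonoidAlgebra.of k G 1 - 1 ∈ augIdeal k G ^ n
    rw [map_one, sub_self]; exact zero_mem _
  mul_mem' {x y} hx hy := by
    change MonoidAlgebra.of k G (x * y) - 1 ∈ augIdeal k G ^ n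
    have : MonoidAlgebra.of k G (x * y) - 1 =
        (MonoidAlgebra.of k G x - 1) * MonoidAlgebra.of k G y +
          (MonoidAlgebra.of k G y - 1) := by
      rw [map_mul, sub_mul, one_mul]; abel
    rw [this]
    exact add_mem (Ideal.mul_mem_right _ _ hx) hy
  inv_mem' {x} hx := by
    change MonoidAlgebra.of k G x⁻¹ - 1 ∈ augIdeal k G ^ n
    have : MonoidAlgebra.of k G x⁻¹ - 1 =
        -(MonoidAlgebra.of k G x⁻¹ * (MonoidAlgebra.of k G x - 1)) := by
      rw [mul_sub, ← map_mul, inv_mul_cancel, map_one, mul_one, neg_sub]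
    rw [this]
    exact neg_mem (Ideal.mul_mem_left _ _ hx)

lemma lcs_le_dimSubgroup (n : ℕ) : lcs G n ≤ dimSubgroup k G n := by
  induction n with
  | zero => exact fun g _ => mem_augIdeal_pow_zero _
  | succ n ih =>
    rcases n with _ | n
    · intro g _
      change MonoidAlgebra.of k G g - 1 ∈ augIdeal k G ^ 1
      rw [Submodule.pow_one]
      exact of_sub_one_mem g
    · change ⁅lcs G (n + 1), (⊤ : Subgroup G)⁆ ≤ _
      rw [Subgroup.commutator_le]
      intro a ha b _
      have ha' : MonoidAlgebra.of k G a - 1 ∈ augIdeal k G ^ (n + 1) := ih ha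
      have hb' : MonoidAlgebra.of k G b - 1 ∈ augIdeal k G ^ 1 := by
        rw [Submodule.pow_one]; exact of_sub_one_mem b
      change MonoidAlgebra.of k G (a * b * a⁻¹ * b⁻¹) - 1 ∈ augIdeal k G ^ (n + 1 + 1)
      have : MonoidAlgebra.of k G (a * b * a⁻¹ * b⁻¹) - 1 =
          ((MonoidAlgebra.of k G a - 1) * (MonoidAlgebra.of k G b - 1) -
            (MonoidAlgebra.of k G b - 1) * (MonoidAlgebra.of k G a - 1)) *
            MonoidAlgebra.of k G (a⁻¹ * b⁻¹) := by
        have h1 : MonoidAlgebra.of k G (b * a) * MonoidAlgebra.of k G (a⁻¹ * b⁻¹) = 1 := by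
          rw [← map_mul, ← map_one (MonoidAlgebra.of k G)]; congr 1; group
        have h2 : MonoidAlgebra.of k G (a * b) * MonoidAlgebra.of k G (a⁻¹ * b⁻¹) =
            MonoidAlgebra.of k G (a * b * a⁻¹ * b⁻¹) := by
          rw [← map_mul]; congr 1; group
        have h3 : (MonoidAlgebra.of k G a - 1) * (MonoidAlgebra.of k G b - 1) -
            (MonoidAlgebra.of k G b - 1) * (MonoidAlgebra.of k G a - 1) =
            MonoidAlgebra.of k G (a * b) - MonoidAlgebra.of k G (b * a) := by
          rw [map_mul, map_mul]; noncomm_ring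
        rw [h3, sub_mul, h1, h2]
      rw [this]
      exact Ideal.mul_mem_right _ _ (sub_mem (mul_mem_augIdeal_pow rfl ha' hb')
        (mul_mem_augIdeal_pow (by omega) hb' ha'))

lemma sub_one_mem_augPow (n : ℕ) (g : lcs G n) : MonoidAlgebra.of k G g.1 - 1 ∈ augPow k G n := by
  have h : g.1 ∈ dimSubgroup k G n := lcs_le_dimSubgroup (k := k) n g.2
  exact h

/-- The class `[g - 1]` in `I ^ n / I ^ (n + 1)` of an element `g` of `Γ_n`. -/
def subOneClass (n : ℕ) (g : lcs G n) : GrAlg k G n :=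
  grMk n ⟨MonoidAlgebra.of k G g.1 - 1, sub_one_mem_augPow n g⟩

lemma subOneClass_mul (n : ℕ) (g h : lcs G n) :
    subOneClass (k := k) n (g * h) = subOneClass n g + subOneClass n h := by
  have h1 : MonoidAlgebra.of k G (g.1 * h.1) - 1 - (MonoidAlgebra.of k G g.1 - 1 +
      (MonoidAlgebra.of k G h.1 - 1)) =
      (MonoidAlgebra.of k G g.1 - 1) * (MonoidAlgebra.of k G h.1 - 1) := by
    rw [map_mul]; noncomm_ring
  have h2 : MonoidAlgebra.of k G h.1 - 1 ∈ augIdeal k G ^ 1 := by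
    rw [Submodule.pow_one]; exact of_sub_one_mem h.1
  have h3 : MonoidAlgebra.of k G (g.1 * h.1) - 1 - (MonoidAlgebra.of k G g.1 - 1 +
      (MonoidAlgebra.of k G h.1 - 1)) ∈ augIdeal k G ^ (n + 1) :=
    h1 ▸ mul_mem_augIdeal_pow rfl (sub_one_mem_augPow n g) h2
  rw [subOneClass, subOneClass, subOneClass, ← map_add]
  exact grMk_eq h3

/-- The map `Γ_n → I ^ n / I ^ (n + 1)`, `g ↦ [g - 1]`. -/
def preCompare (n : ℕ) : lcs G n →* Multiplicative (GrAlg k G n) :=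
  MonoidHom.mk' (fun g => Multiplicative.ofAdd (subOneClass n g))
    (fun g h => congrArg Multiplicative.ofAdd (subOneClass_mul n g h))

/-- The map `Γ_n / Γ_{n+1} → I ^ n / I ^ (n + 1)`, `[g] ↦ [g - 1]`. -/
def compareQuot (n : ℕ) : LcsQuot G n →* Multiplicative (GrAlg k G n) :=
  QuotientGroup.lift _ (preCompare n) fun _ hg => congrArg Multiplicative.ofAdd
    ((grMk_eq_zero _).2 (sub_one_mem_augPow (n + 1) ⟨_, hg⟩))

/-- The canonical map `gr_n(G; k) → gr_n(kG)`, which sends `[g] ⊗ t` to `t [g - 1]`. -/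
def compare (n : ℕ) : GrLie G k n →ₗ[k] GrAlg k G n :=
  LinearMap.liftBaseChange k
    (AddMonoidHom.toIntLinearMap (MonoidHom.toAdditiveLeft (compareQuot (k := k) n)))

lemma compare_tmul (n : ℕ) (t : k) (g : lcs G n) :
    compare n (t ⊗ₜ[ℤ] (Additive.ofMul (lcsMk n g))) = t • subOneClass n g := by
  rw [compare, LinearMap.liftBaseChange_tmul]
  rfl

end Comparison

/-! ## Filtered-formality and residual torsion-free nilpotence -/

section Main

variable (k : Type*) [Field k] [CharZero k] (G : Type*) [Group G]

variable {k G} in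
/-- A filtered Lie algebra isomorphism from `𝔪(G; k)` to the degree completion of `gr(G; k)`
which induces the identity on associated graded Lie algebras.

The associated graded pieces of `𝔪(G; k)` are contained in those of the completed group algebra,
which are the `I ^ n / I ^ (n + 1)`. The class of `x` in the `n`-th term of the filtration is the
class of any `f ∈ I ^ n` that agrees with `x` in `kG / I ^ (n + 1)`. This class is identified with
an element of `gr_n(G; k)` through the canonical map `[g] ⊗ t ↦ t [g - 1]` from `gr(G; k)` to
`gr(kG)`. -/
structure IsFilteredFormalityIso (α : malcev k G ≃ₗ⁅k⁆ GrLieHat G k) : Prop where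
  mem_fil_iff : ∀ (n : ℕ) (x : malcev k G), x ∈ malcevFil k G n ↔ α x ∈ grLieHatFil G k n
  gr_eq_id : ∀ (n : ℕ) (x : malcev k G) (f : augPow k G n),
    proj (n + 1) (x : CompletedAlg k G) = truncMk k G (n + 1) (f : GroupAlg k G) →
      compare n (GrLieHat.component n (α x)) = grMk n f

/-- `G` is filtered-formal over `k`. -/
def IsFilteredFormal : Prop :=
  ∃ α : malcev k G ≃ₗ⁅k⁆ GrLieHat G k, IsFilteredFormalityIso α

end Main

universe u in
/-- `G` is residually torsion-free nilpotent: every `g ≠ 1` has nontrivial image under some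
epimorphism from `G` to a nilpotent group without nontrivial elements of finite order. -/
def IsResiduallyTorsionFreeNilpotent (G : Type u) [Group G] : Prop :=
  ∀ g : G, g ≠ 1 → ∃ (Q : Type u) (_ : Group Q) (ψ : G →* Q), Group.IsNilpotent Q ∧
    (∀ q : Q, IsOfFinOrder q → q = 1) ∧ Function.Surjective ψ ∧ ψ g ≠ 1

end

end GroupExpansion

/-! Three facts carry the proof. The first is that gr(G; k) embeds in gr(kG) as a graded Lie algebra
in characteristic 0 (`compare_injective`). Suppose that a combination x of elements of Γ_n lies in
I^(n+1). It is shown that x is then a combination of products of factors m - 1, with m in Γ_n, of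
total lower central weight at least n + 1, and the linear map g ↦ 1 ⊗ [g] kills all of these. To
confine the factors to Γ_n, the support is pushed down the lower central series, discarding one
element t at a time: t is replaced by a root of t^q computed with the binomial series, where q
generates the exponents c with t^c in the smaller group (`mem_weightedFil_of_mem_sup_zpowers`).

The second is that G is residually torsion-free nilpotent exactly when the dimension subgroups D_n =
{g | g - 1 ∈ I^n} intersect trivially. The quotients G/D_n are torsion-free and nilpotent;
conversely, by the embedding above and flatness of k over ℤ, each element of D_n has a positive
power in Γ_n. For an expansion E, Ē(f) lies in the n-th filtration step if and only if f ∈ I^n, so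
the kernel of E is the intersection of the D_n. Hence faithfulness matches the residual condition,
and it remains to match Taylor expansions with filtered-formality isomorphisms.

The third is this matching. A Taylor expansion extends to a filtered algebra isomorphism from the
completed group algebra to the completion of gr(kG). Group-likeness makes it respect
comultiplications, so it identifies the Malcev Lie algebra with the primitive elements of the
completion of gr(kG). These come from gr(G; k): the logarithmic derivative E(g)⁻¹ θ(E(g)), θ being
the degree derivation, extends linearly to kG and sends I^n to elements whose degree n component is
a Lie element, by an induction producing commutators with E(g) - 1 (`IsExpansion.logDeriv_mem`); on
a primitive element it agrees with θ Ē in the relevant degree, so n times the leading component is a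
Lie element (`IsTaylorExpansion.leading_mem_range`).

Conversely, an isomorphism α gives E(g) = exp(α(log g)). Multiplicativity is the
Baker–Campbell–Hausdorff theorem (`exists_texp_sub_mul_texp_mem`), proved with the differential
equation of the exponential and applied in a product of two algebras to the graph of α, so that one
Lie element serves on both sides. Since E(g) - 1 begins with [g - 1] and these differences span I, E
is an expansion; it is group-like because exponentials of primitive elements are. -/

open scoped TensorProduct

namespace GroupExpansion

noncomputable section

/-! ## Linear maps out of the group algebra -/

section LinExt

variable {k : Type*} [Field k] {G : Type*} [Group G]

/-- The linear extension to `kG` of a map on `G`. -/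
def linExt {W : Type*} [AddCommGroup W] [Module k W] (f : G → W) : GroupAlg k G →ₗ[k] W :=
  Finsupp.linearCombination k f ∘ₗ (MonoidAlgebra.coeffLinearEquiv k).toLinearMap

@[simp] lemma linExt_of {W : Type*} [AddCommGroup W] [Module k W] (f : G → W) (g : G) :
    linExt (k := k) f (MonoidAlgebra.of k G g) = f g := by
  simp [linExt]

lemma span_of_eq_top : Submodule.span k (Set.range (MonoidAlgebra.of k G)) = ⊤ := by
  refine eq_top_iff.2 fun f _ => ?_
  induction f using MonoidAlgebra.induction_linear with
  | zero => exact zero_mem _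
  | add x y hx hy => exact add_mem (hx trivial) (hy trivial)
  | single g c =>
    have h1 : MonoidAlgebra.single g c = c • MonoidAlgebra.of k G g := by simp
    rw [h1]
    exact Submodule.smul_mem _ _ (Submodule.subset_span ⟨g, rfl⟩)

lemma linearMap_ext_of {W : Type*} [AddCommGroup W] [Module k W] {S T : GroupAlg k G →ₗ[k] W}
    (h : ∀ g, S (MonoidAlgebra.of k G g) = T (MonoidAlgebra.of k G g)) : S = T :=
  LinearMap.ext_on_range span_of_eq_top h

/-- The augmentation ideal is spanned by the elements `g - 1`. -/
lemma mem_augIdeal_iff_span (f : GroupAlg k G) : f ∈ augIdeal k G ↔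
    f ∈ Submodule.span k (Set.range fun g : G => MonoidAlgebra.of k G g - 1) := by
  constructor
  · intro hf
    have key : ∀ x : GroupAlg k G, x - algebraMap k _ (Coalgebra.counit (R := k) x) ∈
        Submodule.span k (Set.range fun g : G => MonoidAlgebra.of k G g - 1) := by
      intro x
      have hx : x ∈ Submodule.span k (Set.range (MonoidAlgebra.of k G)) := by
        rw [span_of_eq_top]; trivial
      induction hx using Submodule.span_induction with
      | zero => simp
      | add x y _ _ hx hy =>
        rw [map_add, map_add, add_sub_add_comm]; exact add_mem hx hy
      | smul c x _ hx =>
        rw [map_smul, smul_eq_mul, map_mul, ← Algebra.smul_def, ← smul_sub]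
        exact Submodule.smul_mem _ _ hx
      | mem x hx =>
        obtain ⟨g, rfl⟩ := hx
        refine Submodule.subset_span ⟨g, ?_⟩
        simp [MonoidAlgebra.one_def]
    have := key f
    have h0 : Coalgebra.counit (R := k) f = 0 := hf
    rwa [h0, map_zero, sub_zero] at this
  · intro hf
    induction hf using Submodule.span_induction with
    | zero => exact zero_mem _
    | add x y _ _ hx hy => exact add_mem hx hy
    | smul c x _ hx => exact (augIdeal k G).smul_of_tower_mem c hx
    | mem x hx => obtain ⟨g, rfl⟩ := hx; exact of_sub_one_mem g

end LinExt

/-! ## Weighted filtrations attached to subgroups -/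

section Weighted

open scoped commutatorElement

open Polynomial in
/-- The truncation of the binomial series `(1 + X) ^ r`. -/
def binPoly (k : Type*) [Field k] [CharZero k] (d : ℕ) (r : ℚ) : k[X] :=
  PowerSeries.trunc d (PowerSeries.binomialSeries k r)

/-! ### Truncated binomial series as formal roots -/

section BinPoly

variable (k : Type*) [Field k] [CharZero k] (d : ℕ)

lemma coeff_binPoly (r : ℚ) {n : ℕ} (hn : n < d) : (binPoly k d r).coeff n =
    PowerSeries.coeff n (PowerSeries.binomialSeries k r) := by
  rw [binPoly, PowerSeries.coeff_trunc, if_pos hn]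

-- The identity (1 + X)^r (1 + X)^s = (1 + X)^(r+s) holds for the full series, and truncation alters
-- only degrees at least d.
open Polynomial in
lemma X_pow_dvd_binPoly_mul (r s : ℚ) :
    X ^ d ∣ binPoly k d r * binPoly k d s - binPoly k d (r + s) := by
  refine Polynomial.X_pow_dvd_iff.2 fun n hn => ?_
  rw [Polynomial.coeff_sub, coeff_binPoly k d _ hn, PowerSeries.binomialSeries_add,
    Polynomial.coeff_mul, PowerSeries.coeff_mul, sub_eq_zero]
  refine Finset.sum_congr rfl fun p hp => ?_
  have := Finset.HasAntidiagonal.mem_antidiagonal.1 hp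
  rw [coeff_binPoly k d _ (by omega), coeff_binPoly k d _ (by omega)]

-- Integral exponents give honest powers, which ties the formal roots of `exists_root_powers` to
-- elements of the group.
open Polynomial in
lemma X_pow_dvd_binPoly_nat (n : ℕ) : X ^ d ∣ binPoly k d n - (1 + X) ^ n := by
  refine Polynomial.X_pow_dvd_iff.2 fun i hi => ?_
  rw [Polynomial.coeff_sub, coeff_binPoly k d _ hi, PowerSeries.binomialSeries_nat, sub_eq_zero]
  have : ((1 + PowerSeries.X) ^ n : PowerSeries k) = (((1 + X) ^ n : k[X]) : PowerSeries k) := by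
    simp
  rw [this, Polynomial.coeff_coe]

open Polynomial in
lemma X_dvd_binPoly_sub_one (hd : 0 < d) (r : ℚ) : X ∣ binPoly k d r - 1 := by
  rw [Polynomial.X_dvd_iff, Polynomial.coeff_sub, coeff_binPoly k d _ hd]
  simp

end BinPoly

variable (k : Type*) [Field k] {G : Type*} [Group G]

/-- Products of elements `m - 1` with `m ∈ M`, of the given total weight in the lower central
series. -/
inductive WeightedProd (M : Subgroup G) : ℕ → GroupAlg k G → Prop
  | one : WeightedProd M 0 1
  | cons {g : G} {i d : ℕ} {x : GroupAlg k G} (hM : g ∈ M) (hi : g ∈ lcs G i)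
      (hx : WeightedProd M d x) : WeightedProd M (i + d) ((MonoidAlgebra.of k G g - 1) * x)

/-- The span of the products of elements `m - 1` with `m ∈ M`, of total weight at least `d`. -/
def weightedFil (M : Subgroup G) (d : ℕ) : Submodule k (GroupAlg k G) :=
  Submodule.span k {x | ∃ e, d ≤ e ∧ WeightedProd k M e x}

variable {k} {M : Subgroup G}

lemma WeightedProd.mem {d e : ℕ} {x : GroupAlg k G} (h : WeightedProd k M e x) (hde : d ≤ e) :
    x ∈ weightedFil k M d :=
  Submodule.subset_span ⟨e, hde, h⟩

lemma weightedFil_anti {d e : ℕ} (h : d ≤ e) : weightedFil k M e ≤ weightedFil k M d :=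
  Submodule.span_mono fun _ ⟨f, hf, hx⟩ => ⟨f, h.trans hf, hx⟩

lemma WeightedProd.mono {M' : Subgroup G} (h : M ≤ M') {d : ℕ} {x : GroupAlg k G}
    (hx : WeightedProd k M d x) : WeightedProd k M' d x := by
  induction hx with
  | one => exact .one
  | cons hM hi _ ih => exact .cons (h hM) hi ih

lemma weightedFil_mono {M' : Subgroup G} (h : M ≤ M') (d : ℕ) :
    weightedFil k M d ≤ weightedFil k M' d :=
  Submodule.span_mono fun _ ⟨f, hf, hx⟩ => ⟨f, hf, hx.mono h⟩

lemma WeightedProd.mul {d e : ℕ} {x y : GroupAlg k G} (hx : WeightedProd k M d x)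
    (hy : WeightedProd k M e y) : WeightedProd k M (d + e) (x * y) := by
  induction hx with
  | one => simpa using hy
  | cons hM hi _ ih => rw [mul_assoc, add_assoc]; exact .cons hM hi ih

lemma weightedFil_mul {d e n : ℕ} (h : n ≤ d + e) {x y : GroupAlg k G}
    (hx : x ∈ weightedFil k M d) (hy : y ∈ weightedFil k M e) : x * y ∈ weightedFil k M n := by
  induction hx using Submodule.span_induction with
  | zero => simp
  | add x x' _ _ hx hx' => rw [add_mul]; exact add_mem hx hx'
  | smul c x _ hx => rw [smul_mul_assoc]; exact Submodule.smul_mem _ _ hx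
  | mem x hx =>
    obtain ⟨d', hd, hx⟩ := hx
    induction hy using Submodule.span_induction with
    | zero => simp
    | add x x' _ _ hx hx' => rw [mul_add]; exact add_mem hx hx'
    | smul c x _ hx => rw [mul_smul_comm]; exact Submodule.smul_mem _ _ hx
    | mem y hy =>
      obtain ⟨e', he, hy⟩ := hy
      exact (hx.mul hy).mem (by omega)

lemma one_mem_weightedFil : (1 : GroupAlg k G) ∈ weightedFil k M 0 :=
  WeightedProd.one.mem le_rfl

lemma of_sub_one_mem_weightedFil {g : G} {i : ℕ} (hM : g ∈ M) (hi : g ∈ lcs G i) :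
    MonoidAlgebra.of k G g - 1 ∈ weightedFil k M i := by
  have := WeightedProd.cons (k := k) hM hi .one
  rw [mul_one] at this
  exact this.mem le_rfl

lemma mem_lcs_zero (g : G) : g ∈ lcs G 0 := by
  change g ∈ lcs G 1
  simp [lcs]

lemma lcs_anti {i j : ℕ} (h : i ≤ j) : lcs G j ≤ lcs G i :=
  Subgroup.lowerCentralSeries_antitone _ (Nat.sub_le_sub_right h 1)

lemma of_mem_weightedFil {g : G} (hM : g ∈ M) :
    MonoidAlgebra.of k G g ∈ weightedFil k M 0 := by
  have := add_mem (of_sub_one_mem_weightedFil (k := k) hM (mem_lcs_zero g)) one_mem_weightedFil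
  rwa [sub_add_cancel] at this

/-- Expanding the factors g - 1 shows that only elements of M occur, so linear maps on the
filtration can be controlled on M alone. -/
lemma weightedFil_le_span (d : ℕ) : weightedFil k M d ≤
    Submodule.span k (MonoidAlgebra.of k G '' M) := by
  refine Submodule.span_le.2 ?_
  rintro x ⟨e, -, hx⟩
  change x ∈ Submodule.span k _
  induction hx with
  | one => exact Submodule.subset_span ⟨1, M.one_mem, map_one _⟩
  | @cons g i d x hM hi _ ih =>
    rw [sub_mul, one_mul]
    refine sub_mem ?_ ih
    clear * - ih hM
    induction ih using Submodule.span_induction with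
    | zero => simp
    | add x x' _ _ hx hx' => rw [mul_add]; exact add_mem hx hx'
    | smul c x _ hx => rw [mul_smul_comm]; exact Submodule.smul_mem _ _ hx
    | mem y hy =>
      obtain ⟨m, hm, rfl⟩ := hy
      exact Submodule.subset_span ⟨g * m, M.mul_mem hM hm, map_mul _ _ _⟩

open Polynomial in
lemma aeval_mem_weightedFil_zero {u : GroupAlg k G} (hu : u ∈ weightedFil k M 0) (p : k[X]) :
    aeval u p ∈ weightedFil k M 0 := by
  induction p using Polynomial.induction_on' with
  | add p q hp hq => rw [map_add]; exact add_mem hp hq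
  | monomial n a =>
    rw [aeval_monomial, ← Algebra.smul_def]
    refine Submodule.smul_mem _ _ ?_
    induction n with
    | zero => rw [pow_zero]; exact one_mem_weightedFil
    | succ n ih => rw [pow_succ]; exact weightedFil_mul (Nat.zero_le _) ih hu

lemma pow_mem_weightedFil {u : GroupAlg k G} {w : ℕ} (hu : u ∈ weightedFil k M w) (n : ℕ) :
    u ^ n ∈ weightedFil k M (n * w) := by
  induction n with
  | zero => rw [pow_zero, zero_mul]; exact one_mem_weightedFil
  | succ n ih => rw [pow_succ]; exact weightedFil_mul (by rw [Nat.succ_mul]) ih hu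

-- This turns congruences of polynomials modulo a power of X into congruences modulo terms of high
-- weight.
open Polynomial in
lemma aeval_mem_weightedFil {u : GroupAlg k G} {w : ℕ} (hu : u ∈ weightedFil k M w) {n : ℕ}
    {p : k[X]} (hp : X ^ n ∣ p) : aeval u p ∈ weightedFil k M (n * w) := by
  obtain ⟨q, rfl⟩ := hp
  have e1 : aeval u (X ^ n * q) = u ^ n * aeval u q := by simp
  rw [e1]
  exact weightedFil_mul (d := n * w) (e := 0) (Nat.le_add_right _ _) (pow_mem_weightedFil hu n)
    (aeval_mem_weightedFil_zero (weightedFil_anti (Nat.zero_le _) hu) q)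

/-- Conjugation by an element of weight `w` raises weights by `w`. -/
lemma conj_sub_mem_weightedFil {w : ℕ} (hw : 1 ≤ w) (h1 : lcs G (w + 1) ≤ M) (h2 : M ≤ lcs G w)
    {t : G} (ht : t ∈ lcs G w) {d : ℕ} {x : GroupAlg k G} (hx : x ∈ weightedFil k M d) :
    MonoidAlgebra.of k G t * x * MonoidAlgebra.of k G t⁻¹ - x ∈ weightedFil k M (d + w) := by
  have htt : MonoidAlgebra.of k G t⁻¹ * MonoidAlgebra.of k G t = 1 := by
    rw [← map_mul, inv_mul_cancel, map_one]
  have htt' : MonoidAlgebra.of k G t * MonoidAlgebra.of k G t⁻¹ = 1 := by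
    rw [← map_mul, mul_inv_cancel, map_one]
  induction hx using Submodule.span_induction with
  | zero => simp
  | add x y _ _ hx hy =>
    rw [mul_add, add_mul, add_sub_add_comm]; exact add_mem hx hy
  | smul c x _ hx =>
    rw [mul_smul_comm, smul_mul_assoc, ← smul_sub]; exact Submodule.smul_mem _ _ hx
  | mem x hx =>
    obtain ⟨e, hde, hx⟩ := hx
    refine weightedFil_anti (Nat.add_le_add_right hde w) ?_
    clear hde
    induction hx with
    | one => rw [mul_one, htt', sub_self]; exact zero_mem _
    | @cons g i d x hM hi hx ih =>
      have hc : ⁅t, g⁆ ∈ lcs G (w + i) := commutator_mem_lcs rfl ht hi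
      -- The commutator lies in Γ_{2w}, and 2w ≥ w + 1 because w ≥ 1.
      have hcM : ⁅t, g⁆ ∈ M := h1 (lcs_anti (by omega) (commutator_mem_lcs (n := w + w) rfl ht (h2 hM)))
      -- This is t g t⁻¹ = [t, g] g. Of the two summands, the first gains weight w from [t, g] - 1,
      -- the second from the induction hypothesis.
      have e1 : MonoidAlgebra.of k G t * ((MonoidAlgebra.of k G g - 1) * x) *
            MonoidAlgebra.of k G t⁻¹ - (MonoidAlgebra.of k G g - 1) * x =
          (MonoidAlgebra.of k G ⁅t, g⁆ - 1) * MonoidAlgebra.of k G g *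
            (MonoidAlgebra.of k G t * x * MonoidAlgebra.of k G t⁻¹) +
          (MonoidAlgebra.of k G g - 1) *
            (MonoidAlgebra.of k G t * x * MonoidAlgebra.of k G t⁻¹ - x) := by
        have e2 : MonoidAlgebra.of k G ⁅t, g⁆ * MonoidAlgebra.of k G g =
            MonoidAlgebra.of k G t * MonoidAlgebra.of k G g * MonoidAlgebra.of k G t⁻¹ := by
          rw [← map_mul, ← map_mul, ← map_mul]; congr 1; simp [commutatorElement_def]
        rw [sub_mul (MonoidAlgebra.of k G ⁅t, g⁆), e2, one_mul, sub_mul, sub_mul, sub_mul, mul_sub,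
          mul_sub, one_mul, one_mul]
        have e3 : MonoidAlgebra.of k G t * MonoidAlgebra.of k G g * MonoidAlgebra.of k G t⁻¹ *
            (MonoidAlgebra.of k G t * x * MonoidAlgebra.of k G t⁻¹) =
            MonoidAlgebra.of k G t * (MonoidAlgebra.of k G g * x) * MonoidAlgebra.of k G t⁻¹ := by
          calc _ = MonoidAlgebra.of k G t * MonoidAlgebra.of k G g *
                (MonoidAlgebra.of k G t⁻¹ * MonoidAlgebra.of k G t) * x *
                MonoidAlgebra.of k G t⁻¹ := by simp only [mul_assoc]
            _ = _ := by rw [htt, mul_one]; simp only [mul_assoc]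
        rw [e3]
        noncomm_ring
      have hx' : MonoidAlgebra.of k G t * x * MonoidAlgebra.of k G t⁻¹ ∈ weightedFil k M d := by
        have := add_mem (weightedFil_anti (Nat.le_add_right d w) ih) (hx.mem le_rfl)
        rwa [sub_add_cancel] at this
      rw [e1]
      refine add_mem (weightedFil_mul (d := w + i) (e := d) (by omega) ?_ hx')
        (weightedFil_mul (d := i) (e := d + w) (by omega) (of_sub_one_mem_weightedFil hM hi) ih)
      exact weightedFil_mul (d := w + i) (e := 0) le_rfl (of_sub_one_mem_weightedFil hcM hc)
        (of_mem_weightedFil hM)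

end Weighted

/-! ### Pushing the support down the lower central series -/

section WeightedStep

open scoped commutatorElement

variable {k : Type*} [Field k] {G : Type*} [Group G] {M : Subgroup G}

lemma of_mul_of_inv (g : G) : MonoidAlgebra.of k G g * MonoidAlgebra.of k G g⁻¹ = 1 := by
  rw [← map_mul, mul_inv_cancel, map_one]

/-- Since [t, m] ∈ Γ_{2w} ≤ Γ_{w+1} ≤ M, the subgroup M is normalized by Γ_w. -/
lemma conj_mem_of_mem_lcs {w : ℕ} (hw : 1 ≤ w) (h1 : lcs G (w + 1) ≤ M) (h2 : M ≤ lcs G w)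
    {t : G} (ht : t ∈ lcs G w) {m : G} (hm : m ∈ M) : t * m * t⁻¹ ∈ M := by
  have h : ⁅t, m⁆ ∈ M :=
    h1 (lcs_anti (by omega) (commutator_mem_lcs (n := w + w) rfl ht (h2 hm)))
  have := M.mul_mem h hm
  simpa [commutatorElement_def] using this

lemma conj_mem_weightedFil {w : ℕ} (hw : 1 ≤ w) (h1 : lcs G (w + 1) ≤ M) (h2 : M ≤ lcs G w)
    {t : G} (ht : t ∈ lcs G w) {d : ℕ} {x : GroupAlg k G} (hx : x ∈ weightedFil k M d) :
    MonoidAlgebra.of k G t * x * MonoidAlgebra.of k G t⁻¹ ∈ weightedFil k M d := by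
  have := add_mem (weightedFil_anti (Nat.le_add_right d w)
    (conj_sub_mem_weightedFil hw h1 h2 ht hx)) hx
  rwa [sub_add_cancel] at this

/-- The powers of a root, modulo terms of high weight, of the smallest power of `t` lying in `M`. -/
lemma exists_root_powers [CharZero k] {w d : ℕ} (hw : 1 ≤ w) (hd : 0 < d) (h2 : M ≤ lcs G w)
    (t : G) : ∃ s : ℤ → GroupAlg k G, (∀ a, s a ∈ weightedFil k M 0) ∧
      (∀ a, s a - 1 ∈ weightedFil k M w) ∧
      (∀ a b, s a * s b - s (a + b) ∈ weightedFil k M d) ∧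
      (∀ c : ℤ, t ^ c ∈ M → MonoidAlgebra.of k G (t ^ c) - s c ∈ weightedFil k M d) ∧
      ∀ a b : ℤ, s a * MonoidAlgebra.of k G (t ^ b) = MonoidAlgebra.of k G (t ^ b) * s a := by
  -- The exponents c with t^c ∈ M form a subgroup qℤ; q may be 0 or negative.
  let H : AddSubgroup ℤ := (M.comap (zpowersHom G t)).toAddSubgroup'
  have hH : ∀ c : ℤ, c ∈ H ↔ t ^ c ∈ M := fun c => Iff.rfl
  obtain ⟨q, hq⟩ := Int.subgroup_cyclic H
  have hqM : t ^ q ∈ M := (hH q).1 (hq ▸ AddSubgroup.subset_closure rfl)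
  set u : GroupAlg k G := MonoidAlgebra.of k G (t ^ q) - 1 with hu_def
  have hu : u ∈ weightedFil k M w := of_sub_one_mem_weightedFil hqM (h2 hqM)
  -- Order d in X becomes weight d w after substituting u, and d w ≥ d as w ≥ 1.
  have hdw : ∀ {x : GroupAlg k G}, x ∈ weightedFil k M (d * w) → x ∈ weightedFil k M d :=
    fun h => weightedFil_anti (Nat.le_mul_of_pos_right d hw) h
  -- Here s a stands for (t^q)^(a/q) = (1 + u)^(a/q). If q = 0, the quotient is 0 by convention, so
  -- the exponent is 0; then only the exponent c = 0 is concerned.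
  let s : ℤ → GroupAlg k G := fun a => Polynomial.aeval u (binPoly k d ((a : ℚ) / (q : ℚ)))
  have s0 : ∀ a, s a ∈ weightedFil k M 0 := fun a =>
    aeval_mem_weightedFil_zero (weightedFil_anti (Nat.zero_le _) hu) _
  have smul : ∀ a b, s a * s b - s (a + b) ∈ weightedFil k M d := fun a b => by
    have := aeval_mem_weightedFil hu
      (X_pow_dvd_binPoly_mul k d ((a : ℚ) / (q : ℚ)) ((b : ℚ) / (q : ℚ)))
    rw [map_sub, map_mul, ← add_div, ← Int.cast_add] at this
    exact hdw this
  have smem : ∀ {r : ℚ} (n : ℕ), r = n → Polynomial.aeval u (binPoly k d r) -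
      MonoidAlgebra.of k G (t ^ q) ^ n ∈ weightedFil k M d := fun n hn => by
    have := aeval_mem_weightedFil hu (X_pow_dvd_binPoly_nat k d n)
    rw [map_sub, map_pow, map_add, map_one, Polynomial.aeval_X, hu_def, add_sub_cancel,
      ← hn] at this
    exact hdw this
  have s00 : s 0 - 1 ∈ weightedFil k M d := by
    have := smem (r := ((0 : ℤ) : ℚ) / q) 0 (by simp)
    rwa [pow_zero] at this
  have hnat : ∀ n : ℕ, MonoidAlgebra.of k G (t ^ (n * q)) - s (n * q) ∈ weightedFil k M d := by
    intro n
    by_cases hq0 : q = 0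
    · have := neg_mem s00
      rw [neg_sub] at this
      simpa only [hq0, mul_zero, zpow_zero, map_one] using this
    · have := neg_mem (smem (r := ((n * q : ℤ) : ℚ) / q) n (by
        have : (q : ℚ) ≠ 0 := by exact_mod_cast hq0
        field_simp; push_cast; rw [mul_comm]))
      rw [neg_sub, ← map_pow, ← zpow_natCast (t ^ q), ← zpow_mul, mul_comm q] at this
      exact this
  refine ⟨s, s0, fun a => ?_, smul, fun c hc => ?_, fun a b => ?_⟩
  · have := aeval_mem_weightedFil (n := 1) (p := binPoly k d ((a : ℚ) / (q : ℚ)) - 1) hu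
      (by rw [pow_one]; exact X_dvd_binPoly_sub_one k d hd ((a : ℚ) / (q : ℚ)))
    rwa [map_sub, map_one, one_mul] at this
  · have hc' : c ∈ H := hc
    rw [hq, AddSubgroup.mem_closure_singleton] at hc'
    obtain ⟨b, rfl⟩ := hc'
    rw [smul_eq_mul] at hc ⊢
    obtain ⟨n, rfl | rfl⟩ := b.eq_nat_or_neg
    · exact hnat n
    -- For negative multiples, t^(nq) ≡ s(nq) and s(nq) s(-nq) ≡ s 0 ≡ 1 give t^(nq) s(-nq) ≡ 1;
    -- multiply by t^(-nq).
    · have h1 : MonoidAlgebra.of k G (t ^ (-(n : ℤ) * q)) *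
          MonoidAlgebra.of k G (t ^ ((n : ℤ) * q)) = 1 := by
        rw [← map_mul, ← zpow_add, neg_mul, neg_add_cancel, zpow_zero, map_one]
      have h2 := smul (n * q) (-(n : ℤ) * q)
      rw [neg_mul, add_neg_cancel, ← neg_mul] at h2
      have h3 := weightedFil_mul (n := d) (d := d) (e := 0) le_rfl (hnat n) (s0 (-(n : ℤ) * q))
      have h4 := neg_mem (add_mem (add_mem h2 h3) s00)
      have h5 := weightedFil_mul (n := d) (d := 0) (e := d) (by omega)
        (of_mem_weightedFil (k := k) hc) h4
      have h6 : -(s (n * q) * s (-(n : ℤ) * q) - s 0 +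
          (MonoidAlgebra.of k G (t ^ ((n : ℤ) * q)) - s (n * q)) * s (-(n : ℤ) * q) + (s 0 - 1)) =
          1 - MonoidAlgebra.of k G (t ^ ((n : ℤ) * q)) * s (-(n : ℤ) * q) := by
        rw [sub_mul]; abel
      rwa [h6, mul_sub, mul_one, ← mul_assoc, h1, one_mul] at h5
  · have hcomm : Commute u (MonoidAlgebra.of k G (t ^ b)) := by
      refine Commute.sub_left ?_ (Commute.one_left _)
      rw [Commute, SemiconjBy, ← map_mul, ← map_mul, ← zpow_add, ← zpow_add, add_comm]
    refine (?_ : Commute (Polynomial.aeval (R := k) u _) (MonoidAlgebra.of k G (t ^ b)))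
    generalize binPoly k d ((a : ℚ) / (q : ℚ)) = p
    induction p using Polynomial.induction_on' with
    | add p q hp hq => rw [map_add]; exact hp.add_left hq
    | monomial n a =>
      rw [Polynomial.aeval_monomial, ← Algebra.smul_def]
      exact (hcomm.pow_left n).smul_left a

/-- Replacing `M` by `M⟨t⟩` does not change the elements of high weight supported on `M`. -/
lemma mem_weightedFil_of_mem_sup_zpowers [CharZero k] {w d : ℕ} (hw : 1 ≤ w)
    (h1 : lcs G (w + 1) ≤ M) (h2 : M ≤ lcs G w) {t : G} (ht : t ∈ lcs G w) {x : GroupAlg k G}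
    (hx0 : x ∈ weightedFil k M 0) (hx : x ∈ weightedFil k (M ⊔ Subgroup.zpowers t) d) :
    x ∈ weightedFil k M d := by
  rcases Nat.eq_zero_or_pos d with rfl | hd
  · exact hx0
  obtain ⟨s, s0, sw, smul, st, scomm⟩ := exists_root_powers (k := k) hw hd h2 t
  have htz : ∀ a : ℤ, t ^ a ∈ lcs G w := fun a => (lcs G w).zpow_mem ht a
  have hconj : ∀ (a : ℤ) {m : G}, m ∈ M → t ^ a * m * (t ^ a)⁻¹ ∈ M := fun a m hm =>
    conj_mem_of_mem_lcs hw h1 h2 (htz a) hm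
  -- Powers of t normalize M, so products m t^a are closed under multiplication and inversion.
  have hsup : ∀ g ∈ M ⊔ Subgroup.zpowers t, ∃ m ∈ M, ∃ a : ℤ, g = m * t ^ a := by
    intro g hg
    rw [Subgroup.sup_eq_closure_mul] at hg
    induction hg using Subgroup.closure_induction with
    | mem x hx =>
      obtain ⟨m, hm, y, ⟨a, rfl⟩, rfl⟩ := hx
      exact ⟨m, hm, a, rfl⟩
    | one => exact ⟨1, M.one_mem, 0, by simp⟩
    | mul x y _ _ hx hy =>
      obtain ⟨m, hm, a, rfl⟩ := hx
      obtain ⟨m', hm', a', rfl⟩ := hy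
      exact ⟨m * (t ^ a * m' * (t ^ a)⁻¹), M.mul_mem hm (hconj a hm'), a + a', by
        rw [zpow_add]; group⟩
    | inv x _ hx =>
      obtain ⟨m, hm, a, rfl⟩ := hx
      exact ⟨t ^ (-a) * m⁻¹ * (t ^ (-a))⁻¹, hconj (-a) (M.inv_mem hm), -a, by group⟩
  choose! mm hmm aa haa using hsup
  classical
  -- A retraction onto the part supported on M: m t^a goes to m s(a), for a chosen decomposition.
  -- Outside M⟨t⟩ the value is irrelevant.
  let π : GroupAlg k G →ₗ[k] GroupAlg k G :=
    linExt fun g => if g ∈ M ⊔ Subgroup.zpowers t then MonoidAlgebra.of k G (mm g) * s (aa g) else 0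
  have hmem : ∀ {m : G} (_ : m ∈ M) (a : ℤ), m * t ^ a ∈ M ⊔ Subgroup.zpowers t := fun hm a =>
    mul_mem (Subgroup.mem_sup_left hm) (Subgroup.mem_sup_right ⟨a, rfl⟩)
  -- The choice is immaterial modulo weight d: if m t^a = m' t^a', then t^(a'-a) ∈ M, so m = m'
  -- t^(a'-a) ≡ m' s(a'-a), and s is multiplicative.
  have π1 : ∀ {m : G} (_ : m ∈ M) (a : ℤ), π (MonoidAlgebra.of k G (m * t ^ a)) -
      MonoidAlgebra.of k G m * s a ∈ weightedFil k M d := by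
    intro m hm a
    have hg := hmem hm a
    rw [linExt_of, if_pos hg]
    set m' := mm (m * t ^ a)
    set a' := aa (m * t ^ a)
    have hm' : m' ∈ M := hmm _ hg
    have h3 : m * t ^ a = m' * t ^ a' := haa _ hg
    have h4 : t ^ (a' - a) = m'⁻¹ * m := by
      rw [zpow_sub, mul_inv_eq_iff_eq_mul, mul_assoc, h3, inv_mul_cancel_left]
    have h5 : t ^ (a' - a) ∈ M := h4 ▸ M.mul_mem (M.inv_mem hm') hm
    have h6 := weightedFil_mul (n := d) (d := d) (e := 0) le_rfl (st _ h5) (s0 a)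
    have h7 := neg_mem (add_mem (smul (a' - a) a) h6)
    have h8 := weightedFil_mul (n := d) (d := 0) (e := d) (by omega)
      (of_mem_weightedFil (k := k) hm') h7
    have h9 : MonoidAlgebra.of k G m = MonoidAlgebra.of k G m' *
        MonoidAlgebra.of k G (t ^ (a' - a)) := by
      rw [← map_mul, h4, mul_inv_cancel_left]
    rw [sub_add_cancel] at h8
    convert h8 using 1
    rw [h9]; noncomm_ring
  have s01 : s 0 - 1 ∈ weightedFil k M d := by
    have := neg_mem (st 0 (by rw [zpow_zero]; exact M.one_mem))
    rwa [zpow_zero, map_one, neg_sub] at this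
  have π2 : ∀ {y : GroupAlg k G}, y ∈ Submodule.span k (MonoidAlgebra.of k G '' M) →
      π y - y ∈ weightedFil k M d := by
    intro y hy
    induction hy using Submodule.span_induction with
    | zero => simp
    | add x y _ _ hx hy => rw [map_add, add_sub_add_comm]; exact add_mem hx hy
    | smul c x _ hx => rw [map_smul, ← smul_sub]; exact Submodule.smul_mem _ _ hx
    | mem x hx =>
      obtain ⟨m, hm, rfl⟩ := hx
      have h3 := π1 hm 0
      rw [zpow_zero, mul_one] at h3
      have h4 := add_mem h3 (weightedFil_mul (n := d) (d := 0) (e := d) (by omega)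
        (of_mem_weightedFil (k := k) hm) s01)
      rwa [mul_sub, mul_one, sub_add_sub_cancel] at h4
  -- A twisted multiplicativity: moving t^a past π(y) conjugates π(y), and s(a) remains on the
  -- right.
  have π3 : ∀ {m : G} (_ : m ∈ M) (a : ℤ) {y : GroupAlg k G},
      y ∈ Submodule.span k (MonoidAlgebra.of k G '' (M ⊔ Subgroup.zpowers t : Subgroup G)) →
      π (MonoidAlgebra.of k G (m * t ^ a) * y) - MonoidAlgebra.of k G m *
        (MonoidAlgebra.of k G (t ^ a) * π y * MonoidAlgebra.of k G (t ^ a)⁻¹) * s a ∈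
          weightedFil k M d := by
    intro m hm a y hy
    induction hy using Submodule.span_induction with
    | zero => simp
    | add x y _ _ hx hy =>
      have := add_mem hx hy
      simp only [mul_add, map_add, add_mul]
      rwa [add_sub_add_comm]
    | smul c x _ hx =>
      have := Submodule.smul_mem _ c hx
      simpa only [mul_smul_comm, map_smul, smul_mul_assoc, smul_sub] using this
    | mem y hy =>
      obtain ⟨g, hg, rfl⟩ := hy
      obtain ⟨m', hm', b, rfl⟩ : ∃ m' ∈ M, ∃ b : ℤ, g = m' * t ^ b :=
        ⟨mm g, hmm g hg, aa g, haa g hg⟩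
      have hc := hconj a hm'
      have e1 : m * t ^ a * (m' * t ^ b) = m * (t ^ a * m' * (t ^ a)⁻¹) * t ^ (a + b) := by
        rw [zpow_add]; group
      have e2 : MonoidAlgebra.of k G (m * (t ^ a * m' * (t ^ a)⁻¹)) =
          MonoidAlgebra.of k G m * (MonoidAlgebra.of k G (t ^ a) * MonoidAlgebra.of k G m' *
            MonoidAlgebra.of k G (t ^ a)⁻¹) := by
        simp only [map_mul]
      have e3 : MonoidAlgebra.of k G m * (MonoidAlgebra.of k G (t ^ a) *
          (MonoidAlgebra.of k G m' * s b) * MonoidAlgebra.of k G (t ^ a)⁻¹) * s a =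
          MonoidAlgebra.of k G (m * (t ^ a * m' * (t ^ a)⁻¹)) * (s b * s a) := by
        have := scomm b (-a)
        rw [zpow_neg] at this
        rw [e2]
        simp only [mul_assoc]
        rw [← mul_assoc (s b) (MonoidAlgebra.of k G (t ^ a)⁻¹), this]
        simp only [mul_assoc]
      have h3 := π1 (M.mul_mem hm hc) (a + b)
      have h4 := weightedFil_mul (n := d) (d := 0) (e := d) (by omega)
        (of_mem_weightedFil (k := k) (M.mul_mem hm hc)) (smul b a)
      have h5 := weightedFil_mul (n := d) (d := d) (e := 0) le_rfl
        (weightedFil_mul (n := d) (d := 0) (e := d) (by omega) (of_mem_weightedFil (k := k) hm)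
          (conj_mem_weightedFil hw h1 h2 (htz a) (π1 hm' b))) (s0 a)
      have h6 := sub_mem (sub_mem h3 h4) h5
      rw [mul_sub (MonoidAlgebra.of k G (t ^ a)), sub_mul _ _ (MonoidAlgebra.of k G (t ^ a)⁻¹),
        mul_sub (MonoidAlgebra.of k G m) (_ * _), sub_mul _ _ (s a), e3, mul_sub,
        add_comm b a] at h6
      rw [← map_mul, e1]
      convert h6 using 1
      abel
  -- The heart of the argument: π does not lower weights, up to the precision d to which it is
  -- controlled.
  have π4 : ∀ {e : ℕ} {y : GroupAlg k G}, WeightedProd k (M ⊔ Subgroup.zpowers t) e y →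
      π y ∈ weightedFil k M (min e d) := by
    intro e y hy
    induction hy with
    | one =>
      have h3 := π1 M.one_mem 0
      rw [zpow_zero, mul_one, map_one, one_mul] at h3
      have h4 := add_mem (weightedFil_anti (Nat.zero_le d) h3) (s0 0)
      rw [sub_add_cancel] at h4
      exact weightedFil_anti (by omega) h4
    | @cons g i e y hg hi hy ih =>
      have hys := weightedFil_le_span e (hy.mem le_rfl)
      rw [sub_mul, one_mul, map_sub]
      -- A factor of weight above w already lies in M and passes through π modulo weight d; a factor
      -- of weight at most w may involve t.
      rcases Nat.lt_or_ge w i with hiw | hiw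
      · have hgM : g ∈ M := h1 (lcs_anti hiw hi)
        have h3 := π3 hgM 0 hys
        rw [zpow_zero, mul_one, inv_one, map_one, one_mul, mul_one] at h3
        have h4 := weightedFil_mul (n := d) (d := 0) (e := d) (by omega)
          (weightedFil_mul (n := 0) (d := 0) (e := min e d) (by omega)
            (of_mem_weightedFil (k := k) hgM) ih) s01
        have h5 := weightedFil_mul (n := min (i + e) d) (by omega)
          (of_sub_one_mem_weightedFil (k := k) hgM hi) ih
        have h6 := add_mem (weightedFil_anti (d := min (i + e) d) (by omega) (add_mem h3 h4)) h5
        convert h6 using 1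
        noncomm_ring
      · obtain ⟨m, hm, a, rfl⟩ : ∃ m ∈ M, ∃ a : ℤ, g = m * t ^ a :=
          ⟨mm g, hmm g hg, aa g, haa g hg⟩
        -- With C = t^a π(y) t^(-a), the image is m C s(a) - π(y) = (m - 1) C s(a) + (C - π(y)) + C
        -- (s(a) - 1) modulo weight d. Each summand gains w ≥ i.
        have h3 := π3 hm a hys
        have hcj := conj_mem_weightedFil hw h1 h2 (htz a) ih
        have h4 := conj_sub_mem_weightedFil hw h1 h2 (htz a) ih
        have h5 := weightedFil_mul (n := min (i + e) d) (d := w) (e := min e d) (by omega)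
          (of_sub_one_mem_weightedFil (k := k) hm (h2 hm))
          (weightedFil_mul (n := min e d) (e := 0) le_rfl hcj (s0 a))
        have h6 := weightedFil_mul (n := min (i + e) d) (e := w) (by omega) hcj (sw a)
        have h7 := add_mem (add_mem (add_mem (weightedFil_anti (d := min (i + e) d) (by omega) h3)
          (weightedFil_anti (d := min (i + e) d) (by omega) h4)) h5) h6
        convert h7 using 1
        noncomm_ring
  have h3 : ∀ z ∈ weightedFil k (M ⊔ Subgroup.zpowers t) d, π z ∈ weightedFil k M d := by
    intro z hz
    induction hz using Submodule.span_induction with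
    | zero => rw [map_zero]; exact zero_mem _
    | add x y _ _ hx hy => rw [map_add]; exact add_mem hx hy
    | smul c x _ hx => rw [map_smul]; exact Submodule.smul_mem _ _ hx
    | mem x hx =>
      obtain ⟨e, hde, hx⟩ := hx
      exact weightedFil_anti (by omega) (π4 hx)
  -- As x is supported on M, it agrees with π(x) modulo weight d.
  have h4 := sub_mem (h3 x hx) (π2 (weightedFil_le_span 0 hx0))
  rwa [sub_sub_cancel] at h4

/-- Only finitely many group elements occur in a given expression, so generators can be removed one
at a time. -/
lemma exists_finset_mem_weightedFil {d : ℕ} {x : GroupAlg k G} (hx : x ∈ weightedFil k M d) :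
    ∃ T : Finset G, (∀ t ∈ T, t ∈ M) ∧ x ∈ weightedFil k (Subgroup.closure (T : Set G)) d := by
  classical
  have hmono : ∀ {S T : Finset G} {e : ℕ}, S ⊆ T →
      weightedFil k (Subgroup.closure (S : Set G)) e ≤
        weightedFil k (Subgroup.closure (T : Set G)) e := fun h =>
    weightedFil_mono (Subgroup.closure_mono (by exact_mod_cast h)) _
  induction hx using Submodule.span_induction with
  | zero => exact ⟨∅, by simp, zero_mem _⟩
  | add x y _ _ hx hy =>
    obtain ⟨S, hS, hx⟩ := hx
    obtain ⟨T, hT, hy⟩ := hy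
    exact ⟨S ∪ T, fun t ht => (Finset.mem_union.1 ht).elim (hS t) (hT t),
      add_mem (hmono Finset.subset_union_left hx) (hmono Finset.subset_union_right hy)⟩
  | smul c x _ hx =>
    obtain ⟨S, hS, hx⟩ := hx
    exact ⟨S, hS, Submodule.smul_mem _ _ hx⟩
  | mem x hx =>
    obtain ⟨e, hde, hx⟩ := hx
    suffices h : ∃ T : Finset G, (∀ t ∈ T, t ∈ M) ∧
        x ∈ weightedFil k (Subgroup.closure (T : Set G)) e by
      obtain ⟨T, hT, hx⟩ := h
      exact ⟨T, hT, weightedFil_anti hde hx⟩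
    clear hde
    induction hx with
    | one => exact ⟨∅, by simp, one_mem_weightedFil⟩
    | @cons g i e x hM hi _ ih =>
      obtain ⟨T, hT, hx⟩ := ih
      refine ⟨insert g T, fun t ht => (Finset.mem_insert.1 ht).elim (fun h => h ▸ hM) (hT t),
        weightedFil_mul le_rfl (of_sub_one_mem_weightedFil (Subgroup.subset_closure (by simp)) hi)
          (hmono (Finset.subset_insert _ _) hx)⟩

/-- Adjoin to Γ_{w+1} the finitely many elements of Γ_w occurring in an expression of x, and remove
them one by one with `mem_weightedFil_of_mem_sup_zpowers`. Every intermediate subgroup lies between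
Γ_{w+1} and Γ_w. -/
lemma mem_weightedFil_lcs_succ [CharZero k] {w d : ℕ} (hw : 1 ≤ w) {x : GroupAlg k G}
    (hx0 : x ∈ weightedFil k (lcs G (w + 1)) 0) (hx : x ∈ weightedFil k (lcs G w) d) :
    x ∈ weightedFil k (lcs G (w + 1)) d := by
  classical
  obtain ⟨T, hT, hx⟩ := exists_finset_mem_weightedFil hx
  replace hx := weightedFil_mono (le_sup_right (a := lcs G (w + 1))) d hx
  induction T using Finset.induction_on with
  | empty => simpa using hx
  | insert t T _ ih =>
    have hT' : ∀ s ∈ T, s ∈ lcs G w := fun s hs => hT s (Finset.mem_insert_of_mem hs)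
    refine ih hT' ?_
    refine mem_weightedFil_of_mem_sup_zpowers hw le_sup_left
      (sup_le (lcs_anti (Nat.le_succ w)) ((Subgroup.closure_le _).2 hT'))
      (hT t (Finset.mem_insert_self t T)) (weightedFil_mono le_sup_left 0 hx0) ?_
    rwa [Finset.coe_insert, Set.insert_eq, Subgroup.closure_union,
      ← Subgroup.zpowers_eq_closure, sup_comm (Subgroup.zpowers t), ← sup_assoc] at hx

lemma augIdeal_pow_le_weightedFil (n : ℕ) {x : GroupAlg k G} (hx : x ∈ augIdeal k G ^ n) :
    x ∈ weightedFil k (lcs G 1) n := by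
  have h1 : ∀ g : G, g ∈ lcs G 1 := mem_lcs_zero
  induction n generalizing x with
  | zero =>
    have hx : x ∈ Submodule.span k (Set.range (MonoidAlgebra.of k G)) := by
      rw [span_of_eq_top]; trivial
    refine Submodule.span_le.2 ?_ hx
    rintro _ ⟨g, rfl⟩
    exact of_mem_weightedFil (h1 g)
  | succ n ih =>
    rw [Submodule.pow_succ] at hx
    induction hx using Submodule.mul_induction_on' with
    | mem_mul_mem a ha b hb =>
      refine weightedFil_mul le_rfl (ih ha) ?_
      refine Submodule.span_le.2 ?_ ((mem_augIdeal_iff_span b).1 hb)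
      rintro _ ⟨g, rfl⟩
      exact of_sub_one_mem_weightedFil (h1 g) (h1 g)
    | add x _ y _ hx hy => exact add_mem hx hy

/-- For Γ_1 = G the powers of I are visibly weighted; descending from each term of the lower central
series to the next keeps the weight while shrinking the group from which the factors are taken. -/
lemma mem_weightedFil_lcs [CharZero k] {n d : ℕ} {x : GroupAlg k G}
    (hx0 : x ∈ weightedFil k (lcs G (n + 1)) 0) (hx : x ∈ augIdeal k G ^ d) :
    x ∈ weightedFil k (lcs G (n + 1)) d := by
  induction n with
  | zero => exact augIdeal_pow_le_weightedFil d hx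
  | succ n ih =>
    exact mem_weightedFil_lcs_succ (by omega) hx0
      (ih (weightedFil_mono (lcs_anti (Nat.le_succ _)) 0 hx0))

/-! ### Injectivity of gr(G; k) → gr(kG) -/

instance subsingleton_grLie_zero : Subsingleton (GrLie G k 0) := by
  have h : ∀ x : AddLcsQuot G 0, x = 0 := fun x => by
    obtain ⟨a, ha⟩ := lcsMk_surjective 0 x.toMul
    -- In this indexing Γ_0 = Γ_1 = G.
    have h1 : lcsMk 0 a = 1 := (lcsMk_eq_one a).2 (mem_lcs_zero a.1)
    exact congrArg Additive.ofMul (ha.symm.trans h1)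
  refine ⟨fun x y => ?_⟩
  have h0 : ∀ x : GrLie G k 0, x = 0 := fun x => by
    induction x using TensorProduct.induction_on with
    | zero => rfl
    | tmul t x => rw [h x, TensorProduct.tmul_zero]
    | add x y hx hy => rw [hx, hy, add_zero]
  rw [h0 x, h0 y]

/-- The map `gr_n(G; k) → gr_n(kG)` is injective in characteristic zero. -/
theorem compare_injective [CharZero k] (n : ℕ) :
    Function.Injective (compare (k := k) (G := G) n) := by
  rcases n with _ | n
  · exact fun x y _ => Subsingleton.elim x y
  classical
  rw [injective_iff_map_eq_zero]
  intro X hX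
  -- L detects the class of a group element; it is additive on Γ_{n+1} and recovers X from the lift
  -- chosen below.
  let L : GroupAlg k G →ₗ[k] GrLie G k (n + 1) := linExt fun g =>
    if h : g ∈ lcs G (n + 1) then 1 ⊗ₜ[ℤ] Additive.ofMul (lcsMk (n + 1) ⟨g, h⟩) else 0
  have hL : ∀ g : lcs G (n + 1), L (MonoidAlgebra.of k G g.1) =
      1 ⊗ₜ[ℤ] Additive.ofMul (lcsMk (n + 1) g) := fun g => by
    rw [linExt_of, dif_pos g.2]
  have hLmul : ∀ g h : lcs G (n + 1), L (MonoidAlgebra.of k G (g.1 * h.1)) =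
      L (MonoidAlgebra.of k G g.1) + L (MonoidAlgebra.of k G h.1) := fun g h => by
    rw [hL g, hL h, ← TensorProduct.tmul_add, ← ofMul_mul, ← map_mul, ← hL]; rfl
  have hL1 : L 1 = 0 := by
    have := hLmul 1 1
    rw [OneMemClass.coe_one, mul_one, map_one] at this
    exact left_eq_add.1 this
  have hlift : ∀ X : GrLie G k (n + 1), ∃ x : augPow k G (n + 1),
      x.1 ∈ weightedFil k (lcs G (n + 1)) 0 ∧ L x.1 = X ∧ compare (n + 1) X = grMk (n + 1) x := by
    intro X
    induction X using TensorProduct.induction_on with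
    | zero => exact ⟨0, zero_mem _, map_zero _, by rw [map_zero, map_zero]⟩
    | add X Y hX hY =>
      obtain ⟨x, hx1, hx2, hx3⟩ := hX
      obtain ⟨y, hy1, hy2, hy3⟩ := hY
      exact ⟨x + y, add_mem hx1 hy1, by rw [← hx2, ← hy2, ← map_add]; rfl,
        by rw [map_add, map_add, hx3, hy3]⟩
    | tmul t a =>
      obtain ⟨g, hg⟩ := lcsMk_surjective (n + 1) a.toMul
      obtain rfl : a = Additive.ofMul (lcsMk (n + 1) g) := congrArg Additive.ofMul hg.symm
      refine ⟨t • ⟨MonoidAlgebra.of k G g.1 - 1, sub_one_mem_augPow (n + 1) g⟩,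
        Submodule.smul_mem _ _ (sub_mem (of_mem_weightedFil g.2) one_mem_weightedFil), ?_, ?_⟩
      · change L (t • (MonoidAlgebra.of k G g.1 - 1)) = _
        rw [map_smul, map_sub, hL1, sub_zero, hL, TensorProduct.smul_tmul', smul_eq_mul, mul_one]
      · rw [compare_tmul, map_smul]; rfl
  obtain ⟨x, hx1, rfl, hx3⟩ := hlift X
  rw [hX] at hx3
  -- A zero image in gr(kG) puts the lift x in I^(n+2), hence in weight n + 2 with all factors taken
  -- from Γ_{n+1}.
  have hx4 := mem_weightedFil_lcs hx1 ((grMk_eq_zero x).1 hx3.symm)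
  -- A map additive on the group kills every product containing two factors of the form g - 1.
  have hspan : ∀ {g h : G}, g ∈ lcs G (n + 1) → h ∈ lcs G (n + 1) → ∀ y ∈ Submodule.span k
      (MonoidAlgebra.of k G '' (lcs G (n + 1))),
      L ((MonoidAlgebra.of k G g - 1) * ((MonoidAlgebra.of k G h - 1) * y)) = 0 := by
    intro g h hg hh y hy
    induction hy using Submodule.span_induction with
    | zero => simp
    | add x y _ _ hx hy => rw [mul_add, mul_add, map_add, hx, hy, add_zero]
    | smul c x _ hx => rw [mul_smul_comm, mul_smul_comm, map_smul, hx, smul_zero]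
    | mem y hy =>
      obtain ⟨m, hm, rfl⟩ := hy
      have e1 : (MonoidAlgebra.of k G g - 1) * ((MonoidAlgebra.of k G h - 1) *
          MonoidAlgebra.of k G m) = MonoidAlgebra.of k G (g * (h * m)) -
          MonoidAlgebra.of k G (h * m) - (MonoidAlgebra.of k G (g * m) -
          MonoidAlgebra.of k G m) := by
        simp only [map_mul]; noncomm_ring
      have e2 := hLmul ⟨g, hg⟩ (⟨h, hh⟩ * ⟨m, hm⟩)
      have e3 := hLmul ⟨g, hg⟩ ⟨m, hm⟩
      rw [e1, map_sub, map_sub, map_sub]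
      exact (congrArg₂ (fun a b => a - L (MonoidAlgebra.of k G (h * m)) -
        (b - L (MonoidAlgebra.of k G m))) e2 e3).trans (by
          change L _ + L (MonoidAlgebra.of k G (h * m)) - _ - _ = 0
          abel)
  have hfin : ∀ z ∈ weightedFil k (lcs G (n + 1)) (n + 1 + 1), L z = 0 := by
    intro z hz
    induction hz using Submodule.span_induction with
    | zero => exact map_zero _
    | add x y _ _ hx hy => rw [map_add, hx, hy, add_zero]
    | smul c x _ hx => rw [map_smul, hx, smul_zero]
    | mem z hz =>
      obtain ⟨e, hde, hz⟩ := hz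
      cases hz with
      | one => omega
      | @cons g i d x hg hi hx =>
        cases hx with
        -- A single factor of weight at least n + 2 has g ∈ Γ_{n+2}, whose class is trivial.
        | one =>
          have h1 : lcsMk (n + 1) ⟨g, hg⟩ = 1 :=
            (lcsMk_eq_one _).2 (lcs_anti (by omega) hi)
          have h2 := hL ⟨g, hg⟩
          rw [h1, ofMul_one, TensorProduct.tmul_zero] at h2
          rw [mul_one, map_sub, hL1, sub_zero]
          exact h2
        | @cons h j d' y hh hj hy =>
          exact hspan hg hh y (weightedFil_le_span d' (hy.mem le_rfl))
  exact hfin _ hx4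

end WeightedStep

/-! ## The degree filtration of the completion of `gr(kG)` -/

section GrHatBasics

variable {k : Type*} [Field k] {G : Type*} [Group G]

open GrHat (component)

lemma component_one_zero : component 0 (1 : GrHat k G) = grMk 0 ⟨1, mem_augIdeal_pow_zero 1⟩ :=
  rfl

lemma component_one_of_ne {n : ℕ} (hn : n ≠ 0) : component n (1 : GrHat k G) = 0 :=
  dif_neg hn

lemma mem_grHatFil {n : ℕ} {x : GrHat k G} :
    x ∈ grHatFil k G n ↔ ∀ j < n, component j x = 0 :=
  Iff.rfl

lemma mem_grHatFil_succ {n : ℕ} {x : GrHat k G} :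
    x ∈ grHatFil k G (n + 1) ↔ x ∈ grHatFil k G n ∧ component n x = 0 := by
  simp only [mem_grHatFil, Nat.lt_succ_iff_lt_or_eq, or_imp, forall_and, forall_eq]

lemma grHatFil_zero : grHatFil k G 0 = ⊤ :=
  eq_top_iff.2 fun _ _ j hj => absurd hj (Nat.not_lt_zero j)

lemma grHatFil_anti {m n : ℕ} (h : m ≤ n) : grHatFil k G n ≤ grHatFil k G m :=
  fun _ hx j hj => hx j (hj.trans_le h)

lemma eq_zero_of_mem_grHatFil {x : GrHat k G} (h : ∀ n, x ∈ grHatFil k G n) : x = 0 :=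
  GrHat.ext fun n => (h (n + 1) n (Nat.lt_succ_self n)).trans (map_zero _).symm

lemma mul_mem_grHatFil {i j : ℕ} {x y : GrHat k G} (hx : x ∈ grHatFil k G i)
    (hy : y ∈ grHatFil k G j) : x * y ∈ grHatFil k G (i + j) := by
  intro n hn
  rw [GrHat.component_mul]
  refine Finset.sum_eq_zero fun p _ => ?_
  have hp := Finset.HasAntidiagonal.mem_antidiagonal.1 p.2
  rcases lt_or_ge p.1.1 i with h | h
  · rw [hx _ h, map_zero, LinearMap.zero_apply]
  · rw [hy _ (by omega), map_zero]

/-- Any other pair of degrees with sum i + j has its first entry below i or its second below j. -/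
lemma component_mul_of_mem {i j n : ℕ} (h : i + j = n) {x y : GrHat k G}
    (hx : x ∈ grHatFil k G i) (hy : y ∈ grHatFil k G j) :
    component n (x * y) = grMul h (component i x) (component j y) := by
  rw [GrHat.component_mul, Finset.sum_eq_single (⟨(i, j),
    Finset.HasAntidiagonal.mem_antidiagonal.2 h⟩ : Finset.HasAntidiagonal.antidiagonal n)]
  · rintro ⟨⟨a, b⟩, hp⟩ _ hne
    have hp' := Finset.HasAntidiagonal.mem_antidiagonal.1 hp
    dsimp only at hp' ⊢
    rcases lt_trichotomy a i with h1 | h1 | h1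
    · rw [hx _ h1, map_zero, LinearMap.zero_apply]
    · refine absurd (Subtype.ext (Prod.ext h1 ?_)) hne
      dsimp only; omega
    · rw [hy _ (by omega), map_zero]
  · exact fun h => absurd (Finset.mem_univ _) h

/-- The product only depends on the components of low degree. -/
lemma mul_sub_mul_mem_grHatFil {n : ℕ} {x x' y y' : GrHat k G} (hx : x - x' ∈ grHatFil k G n)
    (hy : y - y' ∈ grHatFil k G n) : x * y - x' * y' ∈ grHatFil k G n := by
  have h1 := mul_mem_grHatFil hx (show y ∈ grHatFil k G 0 by rw [grHatFil_zero]; trivial)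
  have h2 := mul_mem_grHatFil (show x' ∈ grHatFil k G 0 by rw [grHatFil_zero]; trivial) hy
  rw [add_zero] at h1
  rw [zero_add] at h2
  have := add_mem h1 h2
  rwa [sub_mul, mul_sub, sub_add_sub_cancel] at this

lemma exists_component_eq (u : ∀ n, GrAlg k G n) : ∃ y : GrHat k G, ∀ n, component n y = u n :=
  ⟨u, fun _ => rfl⟩

/-- The element of the degree completion with the given components. -/
def grHatOfComponents (u : ∀ n, GrAlg k G n) : GrHat k G :=
  (exists_component_eq u).choose

@[simp] lemma component_grHatOfComponents (u : ∀ n, GrAlg k G n) (n : ℕ) :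
    component n (grHatOfComponents u) = u n :=
  (exists_component_eq u).choose_spec n

/-- The homogeneous part of degree `n`. -/
def homPart (n : ℕ) (y : GrHat k G) : GrHat k G :=
  grHatOfComponents fun m => if m = n then component m y else 0

lemma component_homPart (n m : ℕ) (y : GrHat k G) :
    component m (homPart n y) = if m = n then component m y else 0 :=
  component_grHatOfComponents _ _

/-- The degree derivation, which multiplies the component of degree `n` by `n`. -/
def degDeriv : GrHat k G →ₗ[k] GrHat k G where
  toFun x := grHatOfComponents fun n => (n : k) • component n x
  map_add' x y := GrHat.ext fun n => by
    simp only [map_add, component_grHatOfComponents, smul_add]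
  map_smul' c x := GrHat.ext fun n => by
    simp only [map_smul, component_grHatOfComponents, RingHom.id_apply]
    rw [smul_comm]

@[simp] lemma component_degDeriv (n : ℕ) (x : GrHat k G) :
    component n (degDeriv x) = (n : k) • component n x :=
  component_grHatOfComponents _ _

lemma degDeriv_mul (x y : GrHat k G) : degDeriv (x * y) = degDeriv x * y + x * degDeriv y := by
  refine GrHat.ext fun n => ?_
  rw [component_degDeriv, map_add, GrHat.component_mul, GrHat.component_mul, GrHat.component_mul,
    Finset.smul_sum, ← Finset.sum_add_distrib]
  refine Finset.sum_congr rfl fun p _ => ?_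
  have hn : ((p.1.1 : k) + (p.1.2 : k)) = n := by
    exact_mod_cast congrArg _ (Finset.HasAntidiagonal.mem_antidiagonal.1 p.2)
  rw [component_degDeriv, component_degDeriv, map_smul, LinearMap.smul_apply, map_smul, ← add_smul,
    hn]

lemma degDeriv_one : degDeriv (1 : GrHat k G) = 0 := by
  refine GrHat.ext fun n => ?_
  rw [component_degDeriv, map_zero]
  rcases Nat.eq_zero_or_pos n with rfl | hn
  · rw [Nat.cast_zero, zero_smul]
  · rw [component_one_of_ne hn.ne', smul_zero]

lemma degDeriv_mem {n : ℕ} {x : GrHat k G} (hx : x ∈ grHatFil k G n) :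
    degDeriv x ∈ grHatFil k G n := fun j hj => by
  rw [component_degDeriv, hx j hj, smul_zero]

lemma degDeriv_mem_one (x : GrHat k G) : degDeriv x ∈ grHatFil k G 1 := fun j hj => by
  obtain rfl : j = 0 := by omega
  rw [component_degDeriv, Nat.cast_zero, zero_smul]

end GrHatBasics

/-! ## The comparison map on degree completions -/

section CompareHat

open scoped commutatorElement
open GrHat (component)

variable {k : Type*} [Field k] {G : Type*} [Group G]

/-- One has [a, b] - 1 = ((a-1)(b-1) - (b-1)(a-1)) a⁻¹ b⁻¹, and the last factor is 1 modulo I. -/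
lemma grMul_subOneClass_sub {i j n : ℕ} (h : i + j = n) (h' : j + i = n) (a : lcs G i)
    (b : lcs G j) : subOneClass (k := k) n ⟨⁅a.1, b.1⁆, commutator_mem_lcs h a.2 b.2⟩ =
      grMul h (subOneClass i a) (subOneClass j b) - grMul h' (subOneClass j b) (subOneClass i a) := by
  rw [subOneClass, subOneClass, subOneClass, grMul_mk, grMul_mk, ← map_sub]
  refine grMk_eq ?_
  have ha : MonoidAlgebra.of k G a.1 - 1 ∈ augIdeal k G ^ i := sub_one_mem_augPow i a
  have hb : MonoidAlgebra.of k G b.1 - 1 ∈ augIdeal k G ^ j := sub_one_mem_augPow j b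
  have hab := sub_mem (mul_mem_augIdeal_pow h ha hb) (mul_mem_augIdeal_pow h' hb ha)
  have h1 : MonoidAlgebra.of k G (a.1⁻¹ * b.1⁻¹) - 1 ∈ augIdeal k G ^ 1 := by
    rw [Submodule.pow_one]; exact of_sub_one_mem _
  have h2 : MonoidAlgebra.of k G ⁅a.1, b.1⁆ - 1 =
      ((MonoidAlgebra.of k G a.1 - 1) * (MonoidAlgebra.of k G b.1 - 1) -
        (MonoidAlgebra.of k G b.1 - 1) * (MonoidAlgebra.of k G a.1 - 1)) *
        MonoidAlgebra.of k G (a.1⁻¹ * b.1⁻¹) := by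
    have h3 : MonoidAlgebra.of k G (b.1 * a.1) * MonoidAlgebra.of k G (a.1⁻¹ * b.1⁻¹) = 1 := by
      rw [← map_mul, ← map_one (MonoidAlgebra.of k G)]; congr 1; group
    have h4 : MonoidAlgebra.of k G (a.1 * b.1) * MonoidAlgebra.of k G (a.1⁻¹ * b.1⁻¹) =
        MonoidAlgebra.of k G ⁅a.1, b.1⁆ := by
      rw [← map_mul, commutatorElement_def]; congr 1; group
    have h5 : (MonoidAlgebra.of k G a.1 - 1) * (MonoidAlgebra.of k G b.1 - 1) -
        (MonoidAlgebra.of k G b.1 - 1) * (MonoidAlgebra.of k G a.1 - 1) =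
        MonoidAlgebra.of k G (a.1 * b.1) - MonoidAlgebra.of k G (b.1 * a.1) := by
      rw [map_mul, map_mul]; noncomm_ring
    rw [h5, sub_mul, h3, h4]
  have h6 := mul_mem_augIdeal_pow (rfl : n + 1 = n + 1) hab h1
  rw [mul_sub, mul_one, ← h2] at h6
  exact h6

lemma compare_grBracket {i j n : ℕ} (h : i + j = n) (h' : j + i = n) (X : GrLie G k i)
    (Y : GrLie G k j) : compare n (grBracket h X Y) =
      grMul h (compare i X) (compare j Y) - grMul h' (compare j Y) (compare i X) := by
  induction X using TensorProduct.induction_on with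
  | zero => simp
  | add X X' hX hX' => simp only [map_add, LinearMap.add_apply, hX, hX']; abel
  | tmul s x =>
    induction Y using TensorProduct.induction_on with
    | zero => simp
    | add Y Y' hY hY' => simp only [map_add, LinearMap.add_apply, hY, hY']; abel
    | tmul t y =>
      obtain ⟨a, ha⟩ := lcsMk_surjective i x.toMul
      obtain rfl : x = Additive.ofMul (lcsMk i a) := congrArg Additive.ofMul ha.symm
      obtain ⟨b, hb⟩ := lcsMk_surjective j y.toMul
      obtain rfl : y = Additive.ofMul (lcsMk j b) := congrArg Additive.ofMul hb.symm
      rw [grBracket_tmul, lcsBracket_apply, toMul_ofMul, toMul_ofMul, lcsCommutator_mk,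
        compare_tmul, compare_tmul, compare_tmul, grMul_subOneClass_sub h h']
      simp only [map_smul, LinearMap.smul_apply, smul_smul, smul_sub, mul_comm t s]

/-- Since Δ(a) = a ⊗ a, Δ(a-1) is the sum of the three displayed tensors. As gr_i ⊗ gr_j embeds in
the truncations, the component can be identified there. -/
lemma grComul_subOneClass_eq {i j n : ℕ} (h : i + j = n) (a : lcs G n)
    (w : GrAlg k G i ⊗[k] GrAlg k G j)
    (hw : truncTensor k G (i + 1) (j + 1) ((MonoidAlgebra.of k G a.1 - 1) ⊗ₜ 1 +
      1 ⊗ₜ (MonoidAlgebra.of k G a.1 - 1) +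
      (MonoidAlgebra.of k G a.1 - 1) ⊗ₜ (MonoidAlgebra.of k G a.1 - 1)) = grTensorIncl i j w) :
    grComul h (subOneClass n a) = w := by
  refine grTensorIncl_injective i j ?_
  rw [subOneClass, grTensorIncl_grComul, ← hw]
  have h1 : Bialgebra.comulAlgHom k (GroupAlg k G) (MonoidAlgebra.of k G a.1) =
    MonoidAlgebra.of k G a.1 ⊗ₜ[k] MonoidAlgebra.of k G a.1 := by simp
  rw [map_sub, map_one, h1, Algebra.TensorProduct.one_def]
  congr 1
  simp only [TensorProduct.sub_tmul, TensorProduct.tmul_sub]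
  abel

lemma truncMk_of_sub_one {m n : ℕ} (h : m ≤ n) (a : lcs G n) :
    truncMk k G m (MonoidAlgebra.of k G a.1 - 1) = 0 :=
  truncMk_eq_zero.2 (augIdeal_pow_le h (sub_one_mem_augPow n a))

/-- Both i + 1 and j + 1 are at most n, so each of the three terms of Δ(a-1) dies in the
truncations. -/
lemma grComul_compare {i j n : ℕ} (h : i + j = n) (hi : 1 ≤ i) (hj : 1 ≤ j) (X : GrLie G k n) :
    grComul h (compare n X) = 0 := by
  induction X using TensorProduct.induction_on with
  | zero => simp
  | add X Y hX hY => rw [map_add, map_add, hX, hY, add_zero]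
  | tmul t x =>
    obtain ⟨a, ha⟩ := lcsMk_surjective n x.toMul
    obtain rfl : x = Additive.ofMul (lcsMk n a) := congrArg Additive.ofMul ha.symm
    rw [compare_tmul, map_smul, grComul_subOneClass_eq h a 0, smul_zero]
    simp only [truncTensor, map_add, Algebra.TensorProduct.map_tmul,
      truncMk_of_sub_one (show i + 1 ≤ n by omega), truncMk_of_sub_one (show j + 1 ≤ n by omega)]
    simp

lemma grComul_compare_left {n : ℕ} (h : 0 + n = n) (X : GrLie G k n) :
    grComul h (compare n X) = component 0 (1 : GrHat k G) ⊗ₜ compare n X := by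
  rcases n with _ | n
  · rw [Subsingleton.elim X 0]; simp
  induction X using TensorProduct.induction_on with
  | zero => simp
  | add X Y hX hY => rw [map_add, map_add, hX, hY, TensorProduct.tmul_add]
  | tmul t x =>
    obtain ⟨a, ha⟩ := lcsMk_surjective _ x.toMul
    obtain rfl : x = Additive.ofMul (lcsMk _ a) := congrArg Additive.ofMul ha.symm
    rw [compare_tmul, map_smul, grComul_subOneClass_eq h a
      (component 0 (1 : GrHat k G) ⊗ₜ subOneClass _ a), TensorProduct.tmul_smul]
    simp only [truncTensor, map_add, Algebra.TensorProduct.map_tmul,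
      truncMk_of_sub_one (show 0 + 1 ≤ n + 1 by omega)]
    rw [TensorProduct.zero_tmul, TensorProduct.zero_tmul, add_zero]
    exact zero_add _

lemma grComul_compare_right {n : ℕ} (h : n + 0 = n) (X : GrLie G k n) :
    grComul h (compare n X) = compare n X ⊗ₜ component 0 (1 : GrHat k G) := by
  rcases n with _ | n
  · rw [Subsingleton.elim X 0]; simp
  induction X using TensorProduct.induction_on with
  | zero => simp
  | add X Y hX hY => rw [map_add, map_add, hX, hY, TensorProduct.add_tmul]
  | tmul t x =>
    obtain ⟨a, ha⟩ := lcsMk_surjective _ x.toMul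
    obtain rfl : x = Additive.ofMul (lcsMk _ a) := congrArg Additive.ofMul ha.symm
    rw [compare_tmul, map_smul, grComul_subOneClass_eq h a
      (subOneClass _ a ⊗ₜ component 0 (1 : GrHat k G)), TensorProduct.smul_tmul']
    simp only [truncTensor, map_add, Algebra.TensorProduct.map_tmul,
      truncMk_of_sub_one (show 0 + 1 ≤ n + 1 by omega)]
    rw [TensorProduct.tmul_zero, TensorProduct.tmul_zero, add_zero]
    exact add_zero _

/-- The canonical map from the degree completion of `gr(G; k)` to that of `gr(kG)`. -/
def compareHat : GrLieHat G k →ₗ[k] GrHat k G where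
  toFun y n := compare n (GrLieHat.component n y)
  map_add' x y := GrHat.ext fun n => by
    change compare n (GrLieHat.component n (x + y)) = _
    rw [map_add, map_add]; rfl
  map_smul' c x := GrHat.ext fun n => by
    change compare n (GrLieHat.component n (c • x)) = _
    rw [map_smul, map_smul]; rfl

@[simp] lemma component_compareHat (n : ℕ) (y : GrLieHat G k) :
    component n (compareHat y) = compare n (GrLieHat.component n y) :=
  rfl

lemma compareHat_mem_grHatFil_one (y : GrLieHat G k) : compareHat y ∈ grHatFil k G 1 := by
  intro j hj
  obtain rfl : j = 0 := by omega
  rw [component_compareHat, Subsingleton.elim (GrLieHat.component 0 y) 0, map_zero]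

lemma compareHat_mem_grHatFil [CharZero k] {n : ℕ} {y : GrLieHat G k} :
    compareHat y ∈ grHatFil k G n ↔ y ∈ grLieHatFil G k n :=
  forall₂_congr fun j _ => by
    rw [component_compareHat, map_eq_zero_iff _ (compare_injective j)]

lemma compareHat_injective [CharZero k] :
    Function.Injective (compareHat : GrLieHat G k →ₗ[k] GrHat k G) := by
  rw [injective_iff_map_eq_zero]
  intro y hy
  refine GrLieHat.ext fun n => ?_
  rw [map_zero, ← map_eq_zero_iff _ (compare_injective n), ← component_compareHat, hy, map_zero]

lemma compareHat_lie [CharZero k] (x y : GrLieHat G k) :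
    compareHat ⁅x, y⁆ = compareHat x * compareHat y - compareHat y * compareHat x := by
  refine GrHat.ext fun n => ?_
  rw [map_sub, component_compareHat, GrLieHat.component_lie, map_sum, GrHat.component_mul,
    GrHat.component_mul]
  have h1 : ∀ p : Finset.HasAntidiagonal.antidiagonal n, p.1.2 + p.1.1 = n := fun p => by
    rw [add_comm]; exact Finset.HasAntidiagonal.mem_antidiagonal.1 p.2
  -- Swapping the two degrees in the second product lets both products run over the same pairs.
  have h2 : ∑ p : Finset.HasAntidiagonal.antidiagonal n,
      grMul (Finset.HasAntidiagonal.mem_antidiagonal.1 p.2) (component p.1.1 (compareHat y))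
        (component p.1.2 (compareHat x)) = ∑ p : Finset.HasAntidiagonal.antidiagonal n,
      grMul (h1 p) (component p.1.2 (compareHat y)) (component p.1.1 (compareHat x)) := by
    let e : Finset.HasAntidiagonal.antidiagonal n ≃ Finset.HasAntidiagonal.antidiagonal n :=
      { toFun := fun p => ⟨p.1.swap, Finset.HasAntidiagonal.mem_antidiagonal.2 (h1 p)⟩
        invFun := fun p => ⟨p.1.swap, Finset.HasAntidiagonal.mem_antidiagonal.2 (h1 p)⟩
        left_inv := fun _ => rfl
        right_inv := fun _ => rfl }
    exact (e.sum_comp _).symm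
  rw [h2, ← Finset.sum_sub_distrib]
  refine Finset.sum_congr rfl fun p _ => ?_
  exact compare_grBracket _ (h1 p) _ _

lemma grHatComul_compareHat (y : GrLieHat G k) : grHatComul (compareHat y) =
    grHatTmul (compareHat y) 1 + grHatTmul 1 (compareHat y) := by
  -- The total degree is a separate variable so that it can be substituted when i or j is 0.
  have key : ∀ {i j n : ℕ} (h : i + j = n), grComul h (component n (compareHat y)) =
      component i (compareHat y) ⊗ₜ component j 1 + component i 1 ⊗ₜ component j (compareHat y) := by
    intro i j n h
    simp only [component_compareHat]
    rcases Nat.eq_zero_or_pos i with rfl | hi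
    · obtain rfl : n = j := by omega
      rw [grComul_compare_left, Subsingleton.elim (GrLieHat.component 0 y) 0, map_zero,
        TensorProduct.zero_tmul]
      exact (zero_add _).symm
    rcases Nat.eq_zero_or_pos j with rfl | hj
    · obtain rfl : n = i := by omega
      rw [grComul_compare_right, Subsingleton.elim (GrLieHat.component 0 y) 0, map_zero,
        TensorProduct.tmul_zero]
      exact (add_zero _).symm
    · rw [grComul_compare h hi hj, component_one_of_ne (by omega), component_one_of_ne (by omega),
        TensorProduct.tmul_zero, TensorProduct.zero_tmul, add_zero]
  funext i j
  exact key rfl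

end CompareHat

/-! ## Dimension subgroups and residual torsion-free nilpotence -/

section Residual

variable {k : Type*} [Field k] {G : Type*} [Group G]

lemma mem_dimSubgroup {n : ℕ} {g : G} :
    g ∈ dimSubgroup k G n ↔ MonoidAlgebra.of k G g - 1 ∈ augIdeal k G ^ n :=
  Iff.rfl

lemma mem_dimSubgroup_one (g : G) : g ∈ dimSubgroup k G 1 := by
  rw [mem_dimSubgroup, Submodule.pow_one]
  exact of_sub_one_mem g

lemma dimSubgroup_anti {m n : ℕ} (h : m ≤ n) : dimSubgroup k G n ≤ dimSubgroup k G m :=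
  fun _ hg => augIdeal_pow_le h hg

instance dimSubgroup_normal (n : ℕ) : (dimSubgroup k G n).Normal where
  conj_mem x hx g := by
    have h1 : MonoidAlgebra.of k G (g * x * g⁻¹) - 1 =
        MonoidAlgebra.of k G g * (MonoidAlgebra.of k G x - 1) * MonoidAlgebra.of k G g⁻¹ := by
      rw [mul_sub, sub_mul, mul_one, of_mul_of_inv, map_mul, map_mul]
    rw [mem_dimSubgroup, h1]
    exact Ideal.mul_mem_right _ _ (Ideal.mul_mem_left _ _ hx)

/-- The defect of additivity is (g^m - 1)(g - 1), which lies one step deeper. -/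
lemma of_pow_sub_one_sub_smul_mem {j : ℕ} {g : G} (hg : g ∈ dimSubgroup k G j) (m : ℕ) :
    MonoidAlgebra.of k G (g ^ m) - 1 - m • (MonoidAlgebra.of k G g - 1) ∈
      augIdeal k G ^ (j + 1) := by
  induction m with
  | zero => rw [pow_zero, map_one, zero_nsmul, sub_self, sub_zero]; exact zero_mem _
  | succ m ih =>
    have h1 := mul_mem_augIdeal_pow (rfl : j + 1 = j + 1)
      (mem_dimSubgroup.1 ((dimSubgroup k G j).pow_mem hg m)) (mem_dimSubgroup.1 (mem_dimSubgroup_one g))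
    have h2 := add_mem ih h1
    convert h2 using 1
    rw [pow_succ, map_mul, succ_nsmul]
    noncomm_ring

/-- Since g^m - 1 ≡ m (g - 1) one step deeper and m is invertible in k, g climbs the filtration step
by step. This makes the quotients G/D_n torsion-free. -/
lemma mem_dimSubgroup_of_pow_mem [CharZero k] {n m : ℕ} (hm : 0 < m) {g : G}
    (hg : g ^ m ∈ dimSubgroup k G n) : g ∈ dimSubgroup k G n := by
  induction n with
  | zero => exact mem_augIdeal_pow_zero _
  | succ j ih =>
    have h1 := of_pow_sub_one_sub_smul_mem (ih (dimSubgroup_anti (Nat.le_succ j) hg)) m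
    have h2 := sub_mem (mem_dimSubgroup.1 hg) h1
    rw [sub_sub_cancel, ← Nat.cast_smul_eq_nsmul k] at h2
    have h3 := (augIdeal k G ^ (j + 1)).smul_of_tower_mem (m : k)⁻¹ h2
    rwa [inv_smul_smul₀ (by exact_mod_cast hm.ne')] at h3

lemma isResiduallyTorsionFreeNilpotent_of_dimSubgroup [CharZero k]
    (h : ∀ g : G, (∀ n, g ∈ dimSubgroup k G n) → g = 1) : IsResiduallyTorsionFreeNilpotent G := by
  intro g hg
  obtain ⟨n, hn⟩ : ∃ n, g ∉ dimSubgroup k G n := by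
    by_contra hcon
    exact hg (h g (by simpa using hcon))
  refine ⟨G ⧸ dimSubgroup k G n, inferInstance, QuotientGroup.mk' _, ?_, ?_,
    QuotientGroup.mk'_surjective _, ?_⟩
  · rw [Subgroup.nilpotent_iff_lowerCentralSeries]
    -- `lcs G n` is the lower central term of index n - 1, and Γ_n ≤ D_n.
    refine ⟨n - 1, ?_⟩
    rw [← Subgroup.map_top_of_surjective _ (QuotientGroup.mk'_surjective (dimSubgroup k G n)),
      ← Subgroup.map_lowerCentralSeries, Subgroup.map_eq_bot_iff, QuotientGroup.ker_mk']
    exact lcs_le_dimSubgroup n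
  · intro q hq
    obtain ⟨x, rfl⟩ := QuotientGroup.mk'_surjective _ q
    obtain ⟨m, hm, hx⟩ := isOfFinOrder_iff_pow_eq_one.1 hq
    rw [← map_pow, QuotientGroup.mk'_apply, QuotientGroup.eq_one_iff] at hx
    exact (QuotientGroup.eq_one_iff _).2 (mem_dimSubgroup_of_pow_mem hm hx)
  · exact fun h => hn ((QuotientGroup.eq_one_iff _).1 h)

lemma map_mem_dimSubgroup {Q : Type*} [Group Q] (ψ : G →* Q) {n : ℕ} {g : G}
    (hg : g ∈ dimSubgroup k G n) : ψ g ∈ dimSubgroup k Q n := by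
  let f : GroupAlg k G →ₐ[k] GroupAlg k Q := MonoidAlgebra.lift k _ G ((MonoidAlgebra.of k Q).comp ψ)
  have hf : ∀ g, f (MonoidAlgebra.of k G g) = MonoidAlgebra.of k Q (ψ g) := fun g => by simp [f]
  have hI : ∀ n : ℕ, ∀ x ∈ augIdeal k G ^ n, f x ∈ augIdeal k Q ^ n := by
    intro n
    induction n with
    | zero => exact fun x _ => mem_augIdeal_pow_zero _
    | succ n ih =>
      intro x hx
      rw [Submodule.pow_succ] at hx
      induction hx using Submodule.mul_induction_on' with
      | mem_mul_mem a ha b hb =>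
        rw [map_mul]
        refine mul_mem_augIdeal_pow rfl (ih a ha) ?_
        rw [Submodule.pow_one]
        have h1 : b ∈ ((augIdeal k Q).restrictScalars k).comap f.toLinearMap := by
          refine Submodule.span_le.2 ?_ ((mem_augIdeal_iff_span b).1 hb)
          rintro _ ⟨g, rfl⟩
          change f (MonoidAlgebra.of k G g - 1) ∈ augIdeal k Q
          rw [map_sub, map_one, hf]
          exact of_sub_one_mem _
        exact h1
      | add x _ y _ hx hy => rw [map_add]; exact add_mem hx hy
  have := hI n _ hg
  rwa [map_sub, map_one, hf] at this

/-- The field k is torsion-free, hence flat, over ℤ. If x had infinite order, the embedding ℤ → M of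
its multiples would stay injective after tensoring with k, so 1 ⊗ x would be nonzero. -/
lemma exists_nsmul_eq_zero_of_tmul_eq_zero [CharZero k] {M : Type*} [AddCommGroup M] {x : M}
    (hx : (1 : k) ⊗ₜ[ℤ] x = 0) : ∃ m : ℕ, 0 < m ∧ m • x = 0 := by
  by_contra hcon
  push Not at hcon
  have hinj : Function.Injective (LinearMap.toSpanSingleton ℤ M x) := by
    rw [injective_iff_map_eq_zero]
    intro a ha
    by_contra ha0
    refine hcon a.natAbs (Int.natAbs_pos.2 ha0) ?_
    rw [LinearMap.toSpanSingleton_apply] at ha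
    rcases Int.natAbs_eq a with h | h <;> rw [h] at ha <;> simpa using ha
  have hflat : Module.Flat ℤ k := by
    rw [IsDedekindDomain.flat_iff_torsion_eq_bot, Submodule.eq_bot_iff]
    intro x hx
    obtain ⟨a, ha⟩ := hx
    have h1 : (a.1 : ℤ) • x = 0 := ha
    rw [zsmul_eq_mul] at h1
    exact (mul_eq_zero.1 h1).resolve_left (by exact_mod_cast nonZeroDivisors.coe_ne_zero a)
  have h2 := Module.Flat.lTensor_preserves_injective_linearMap (M := k) _ hinj
  have h3 : (1 : k) ⊗ₜ[ℤ] (1 : ℤ) = 0 := h2 (by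
    rw [LinearMap.lTensor_tmul, LinearMap.toSpanSingleton_apply, one_smul, hx, map_zero])
  have h4 := congrArg (TensorProduct.rid ℤ k) h3
  simp at h4

/-- If g^m ∈ Γ_j with j < n, its class maps to 0 in gr_j(kG). By `compare_injective` the class is
torsion in Γ_j/Γ_{j+1}, so a further power lies in Γ_{j+1}. -/
lemma exists_pow_mem_lcs [CharZero k] {n : ℕ} {g : G} (hg : g ∈ dimSubgroup k G n) :
    ∃ m : ℕ, 0 < m ∧ g ^ m ∈ lcs G n := by
  suffices h : ∀ j ≤ n, ∃ m : ℕ, 0 < m ∧ g ^ m ∈ lcs G j from h n le_rfl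
  intro j hj
  induction j with
  | zero => exact ⟨1, one_pos, mem_lcs_zero _⟩
  | succ j ih =>
    obtain ⟨m, hm, hgm⟩ := ih (by omega)
    have h1 : subOneClass (k := k) j ⟨g ^ m, hgm⟩ = 0 := (grMk_eq_zero _).2
      (dimSubgroup_anti hj ((dimSubgroup k G n).pow_mem hg m))
    rw [← one_smul k (subOneClass j _), ← compare_tmul, map_eq_zero_iff _ (compare_injective j)] at h1
    obtain ⟨l, hl, h2⟩ := exists_nsmul_eq_zero_of_tmul_eq_zero h1
    refine ⟨m * l, Nat.mul_pos hm hl, ?_⟩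
    rw [← ofMul_pow, ← map_pow] at h2
    have h3 := (lcsMk_eq_one _).1 (Additive.ofMul.injective h2)
    rw [pow_mul]
    exact h3

lemma eq_one_of_mem_dimSubgroup [CharZero k] (hG : IsResiduallyTorsionFreeNilpotent G) {g : G}
    (hg : ∀ n, g ∈ dimSubgroup k G n) : g = 1 := by
  by_contra hne
  obtain ⟨Q, _, ψ, hnil, htf, -, hψ⟩ := hG g hne
  obtain ⟨n, hn⟩ := Subgroup.nilpotent_iff_lowerCentralSeries.1 hnil
  -- `lcs Q (n + 1)` is the lower central term of index n, which is trivial; so ψ(g) has finite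
  -- order.
  obtain ⟨m, hm, h⟩ := exists_pow_mem_lcs (k := k) (map_mem_dimSubgroup ψ (hg (n + 1)))
  have h1 : ψ g ^ m ∈ (⊤ : Subgroup Q).lowerCentralSeries n := h
  rw [hn, Subgroup.mem_bot] at h1
  exact hψ (htf _ (isOfFinOrder_iff_pow_eq_one.2 ⟨m, hm, h1⟩))

end Residual

/-! ## The linear extension of an expansion -/

section Expansion

open GrHat (component)

variable {k : Type*} [Field k] {G : Type*} [Group G] {E : G →* GrHat k G}

/-- The linear extension of an expansion. -/
abbrev expLift (E : G →* GrHat k G) : GroupAlg k G →ₐ[k] GrHat k G :=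
  MonoidAlgebra.lift k (GrHat k G) G E

lemma expLift_of (g : G) : expLift E (MonoidAlgebra.of k G g) = E g := by simp [expLift]

/-- If the degree n component of Ē(f) vanishes, then so does the class of f in I^n/I^(n+1). Thus an
expansion loses no information about the filtration. -/
lemma IsExpansion.expLift_mem_iff (hE : IsExpansion E) {n : ℕ} {f : GroupAlg k G} :
    expLift E f ∈ grHatFil k G n ↔ f ∈ augIdeal k G ^ n := by
  refine ⟨fun h => ?_, fun h => hE.mem_fil n ⟨f, h⟩⟩
  induction n with
  | zero => exact mem_augIdeal_pow_zero f
  | succ n ih =>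
    have h1 := ih (grHatFil_anti (Nat.le_succ n) h)
    exact (grMk_eq_zero (⟨f, h1⟩ : augPow k G n)).1
      ((hE.gr_eq_id n ⟨f, h1⟩).symm.trans (h n (Nat.lt_succ_self n)))

lemma IsExpansion.component_expLift (hE : IsExpansion E) {n : ℕ} (f : augPow k G n) :
    component n (expLift E f) = grMk n f :=
  hE.gr_eq_id n f

lemma IsExpansion.sub_one_mem (hE : IsExpansion E) (g : G) : E g - 1 ∈ grHatFil k G 1 := by
  rw [← expLift_of (E := E) g, ← map_one (expLift E), ← map_sub, hE.expLift_mem_iff,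
    Submodule.pow_one]
  exact of_sub_one_mem g

lemma IsExpansion.eq_of_proj_eq (hE : IsExpansion E) {n : ℕ} {f f' : GroupAlg k G}
    (h : truncMk k G n f = truncMk k G n f') {j : ℕ} (hj : j < n) :
    component j (expLift E f) = component j (expLift E f') := by
  rw [← sub_eq_zero, ← map_sub, ← map_sub]
  refine hE.expLift_mem_iff.2 ?_ j hj
  rw [← truncMk_eq_zero, map_sub, h, sub_self]

/-- Ē maps the intersection of the I^n to 0, so E is trivial on the intersection of the dimension
subgroups; `IsExpansion.injective` is the converse. -/
lemma IsExpansion.dimSubgroup_eq_one (hE : IsExpansion E) (hinj : Function.Injective E) {g : G}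
    (hg : ∀ n, g ∈ dimSubgroup k G n) : g = 1 := by
  refine hinj ?_
  rw [map_one, ← sub_eq_zero, ← expLift_of (E := E), ← map_one (expLift E), ← map_sub]
  exact eq_zero_of_mem_grHatFil fun n => hE.expLift_mem_iff.2 (hg n)

lemma IsExpansion.injective (hE : IsExpansion E)
    (h : ∀ g : G, (∀ n, g ∈ dimSubgroup k G n) → g = 1) : Function.Injective E := by
  rw [injective_iff_map_eq_one]
  intro g hg
  refine h g fun n => ?_
  rw [mem_dimSubgroup, ← hE.expLift_mem_iff, map_sub, map_one, expLift_of, hg, sub_self]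
  exact zero_mem _

lemma exists_proj_eq (x : CompletedAlg k G) :
    ∃ f : ℕ → GroupAlg k G, ∀ n, proj n x = truncMk k G n (f n) := by
  choose f hf using fun n => truncMk_surjective n (proj n x)
  exact ⟨f, fun n => (hf n).symm⟩

/-- The extension of an expansion to the completed group algebra. -/
def completedExp (E : G →* GrHat k G) (x : CompletedAlg k G) : GrHat k G :=
  grHatOfComponents fun n => component n (expLift E ((exists_proj_eq x).choose (n + 1)))

lemma IsExpansion.component_completedExp (hE : IsExpansion E) {x : CompletedAlg k G} {n : ℕ}
    {f : GroupAlg k G} (h : proj n x = truncMk k G n f) {j : ℕ} (hj : j < n) :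
    component j (completedExp E x) = component j (expLift E f) := by
  rw [completedExp, component_grHatOfComponents]
  refine hE.eq_of_proj_eq (n := j + 1) ?_ (Nat.lt_succ_self j)
  rw [← (exists_proj_eq x).choose_spec (j + 1), ← truncMap_proj hj, h]
  exact AlgHom.congr_fun (truncMap_comp hj) f

lemma IsExpansion.completedExp_sub_mem (hE : IsExpansion E) {x : CompletedAlg k G} {n : ℕ}
    {f : GroupAlg k G} (h : proj n x = truncMk k G n f) :
    completedExp E x - expLift E f ∈ grHatFil k G n := fun j hj => by
  rw [map_sub, hE.component_completedExp h hj, sub_self]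

lemma IsExpansion.completedExp_mem_iff (hE : IsExpansion E) {x : CompletedAlg k G} {n : ℕ} :
    completedExp E x ∈ grHatFil k G n ↔ proj n x = 0 := by
  obtain ⟨f, hf⟩ := truncMk_surjective n (proj n x)
  rw [← hf, truncMk_eq_zero, ← hE.expLift_mem_iff]
  have h1 := hE.completedExp_sub_mem hf.symm
  refine ⟨fun h => ?_, fun h => ?_⟩
  · have := sub_mem h h1; rwa [sub_sub_cancel] at this
  · have := add_mem h1 h; rwa [sub_add_cancel] at this

lemma eq_of_sub_mem_grHatFil {x y : GrHat k G} (h : ∀ n, x - y ∈ grHatFil k G n) : x = y :=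
  sub_eq_zero.1 (eq_zero_of_mem_grHatFil h)

lemma IsExpansion.completedExp_eq (hE : IsExpansion E) {x : CompletedAlg k G} {y : GrHat k G}
    {f : ℕ → GroupAlg k G} (hx : ∀ n, proj n x = truncMk k G n (f n))
    (hy : ∀ n, y - expLift E (f n) ∈ grHatFil k G n) : completedExp E x = y :=
  eq_of_sub_mem_grHatFil fun n => by
    have := sub_mem (hE.completedExp_sub_mem (hx n)) (hy n)
    rwa [sub_sub_sub_cancel_right] at this

/-- The algebra morphism from the completed group algebra to the degree completion of its
associated graded algebra given by an expansion. -/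
def IsExpansion.completedHom (hE : IsExpansion E) : CompletedAlg k G →ₐ[k] GrHat k G where
  toFun := completedExp E
  map_one' := hE.completedExp_eq (f := fun _ => 1) (fun n => by rw [map_one, map_one])
    fun n => by rw [map_one, sub_self]; exact zero_mem _
  map_zero' := hE.completedExp_eq (f := fun _ => 0) (fun n => by rw [map_zero, map_zero])
    fun n => by rw [map_zero, sub_self]; exact zero_mem _
  map_mul' x y := by
    obtain ⟨a, ha⟩ := exists_proj_eq x
    obtain ⟨b, hb⟩ := exists_proj_eq y
    refine hE.completedExp_eq (f := fun n => a n * b n)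
      (fun n => by rw [map_mul, map_mul, ha, hb]) fun n => ?_
    rw [map_mul]
    exact mul_sub_mul_mem_grHatFil (hE.completedExp_sub_mem (ha n)) (hE.completedExp_sub_mem (hb n))
  map_add' x y := by
    obtain ⟨a, ha⟩ := exists_proj_eq x
    obtain ⟨b, hb⟩ := exists_proj_eq y
    refine hE.completedExp_eq (f := fun n => a n + b n)
      (fun n => by rw [map_add, map_add, ha, hb]) fun n => ?_
    rw [map_add, add_sub_add_comm]
    exact add_mem (hE.completedExp_sub_mem (ha n)) (hE.completedExp_sub_mem (hb n))
  commutes' c := hE.completedExp_eq (f := fun _ => algebraMap k _ c)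
    (fun n => by rw [AlgHom.commutes, AlgHom.commutes])
    fun n => by rw [AlgHom.commutes, sub_self]; exact zero_mem _

lemma IsExpansion.completedHom_bijective (hE : IsExpansion E) :
    Function.Bijective hE.completedHom := by
  constructor
  · rw [injective_iff_map_eq_zero]
    intro x hx
    refine completedAlg_ext fun n => ?_
    rw [map_zero, ← hE.completedExp_mem_iff]
    change completedExp E x = 0 at hx
    rw [hx]
    exact zero_mem _
  · intro y
    -- Successive approximation: the degree n error is the class of some d ∈ I^n, and Ē(d) has
    -- exactly this leading component.
    have hf : ∀ n, ∃ f : GroupAlg k G, y - expLift E f ∈ grHatFil k G n := by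
      intro n
      induction n with
      | zero => exact ⟨0, by rw [grHatFil_zero]; trivial⟩
      | succ n ih =>
        obtain ⟨f, hf⟩ := ih
        obtain ⟨d, hd⟩ := grMk_surjective n (component n (y - expLift E f))
        refine ⟨f + d, mem_grHatFil_succ.2 ⟨?_, ?_⟩⟩
        · rw [map_add, ← sub_sub]
          exact sub_mem hf (hE.mem_fil n d)
        · rw [map_add, ← sub_sub, map_sub, hE.component_expLift, hd, sub_self]
    choose f hf using hf
    -- For m ≤ n, f m and f n approximate y to orders m and n, so their difference lies in I^m and
    -- the classes are compatible.
    let x : CompletedAlg k G := ⟨fun n => truncMk k G n (f n), fun m n h => by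
      change truncMk k G m (f n) = truncMk k G m (f m)
      rw [← sub_eq_zero, ← map_sub, truncMk_eq_zero, ← hE.expLift_mem_iff, map_sub,
        ← sub_sub_sub_cancel_left _ _ y]
      exact sub_mem (hf m) (grHatFil_anti h (hf n))⟩
    exact ⟨x, hE.completedExp_eq (x := x) (f := f) (fun n => rfl) hf⟩

/-- The algebra isomorphism from the completed group algebra to the degree completion of its
associated graded algebra given by an expansion. -/
def IsExpansion.completedEquiv (hE : IsExpansion E) : CompletedAlg k G ≃ₐ[k] GrHat k G :=
  AlgEquiv.ofBijective hE.completedHom hE.completedHom_bijective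

lemma IsExpansion.completedEquiv_apply (hE : IsExpansion E) (x : CompletedAlg k G) :
    hE.completedEquiv x = completedExp E x :=
  rfl

end Expansion

/-! ## Primitive elements under a Taylor expansion -/

section Primitive

open GrHat (component)

variable {k : Type*} [Field k] {G : Type*} [Group G] {E : G →* GrHat k G}

lemma exists_comp_eq_of_ker_le {V W U : Type*} [AddCommGroup V] [Module k V] [AddCommGroup W]
    [Module k W] [AddCommGroup U] [Module k U] (f : V →ₗ[k] W) (g : V →ₗ[k] U)
    (h : LinearMap.ker f ≤ LinearMap.ker g) : ∃ r : W →ₗ[k] U, ∀ v, r (f v) = g v := by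
  let g' : LinearMap.range f →ₗ[k] U :=
    ((LinearMap.ker f).liftQ g h) ∘ₗ f.quotKerEquivRange.symm.toLinearMap
  obtain ⟨r, hr⟩ := g'.exists_extend
  refine ⟨r, fun v => ?_⟩
  have h1 : r (f v) = g' ⟨f v, v, rfl⟩ := LinearMap.congr_fun hr ⟨f v, v, rfl⟩
  rw [h1]
  have h2 : f.quotKerEquivRange.symm ⟨f v, v, rfl⟩ = (LinearMap.ker f).mkQ v := by
    rw [LinearEquiv.symm_apply_eq]
    exact Subtype.ext (f.quotKerEquivRange_apply_mk v).symm
  change (LinearMap.ker f).liftQ g h (f.quotKerEquivRange.symm ⟨f v, v, rfl⟩) = _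
  rw [h2]
  exact Submodule.liftQ_apply _ _ _

/-- A bilinear map that kills `I ^ n` in both variables factors through
`kG / I ^ n ⊗ kG / I ^ n`. -/
lemma lift_eq_zero_of_truncTensor_eq_zero {W : Type*} [AddCommGroup W] [Module k W]
    (T : GroupAlg k G →ₗ[k] GroupAlg k G →ₗ[k] W) {n : ℕ}
    (h1 : ∀ a ∈ augIdeal k G ^ n, ∀ b, T a b = 0) (h2 : ∀ a, ∀ b ∈ augIdeal k G ^ n, T a b = 0)
    {t : GroupAlg k G ⊗[k] GroupAlg k G} (ht : truncTensor k G n n t = 0) :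
    TensorProduct.lift T t = 0 := by
  -- A linear section s of the truncation: T(a, b) depends only on the classes of a and b, so both
  -- may be replaced by their values under s.
  obtain ⟨s, hs⟩ := (truncMk k G n).toLinearMap.exists_rightInverse_of_surjective
    (LinearMap.range_eq_top.2 (truncMk_surjective n))
  have hs' : ∀ a, a - s (truncMk k G n a) ∈ augIdeal k G ^ n := fun a => by
    rw [← truncMk_eq_zero, map_sub]
    exact sub_eq_zero.2 (LinearMap.congr_fun hs (truncMk k G n a)).symm
  have key : ∀ t : GroupAlg k G ⊗[k] GroupAlg k G, TensorProduct.lift T t =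
      TensorProduct.lift (T.compl₁₂ s s) (truncTensor k G n n t) := by
    intro t
    induction t using TensorProduct.induction_on with
    | zero => simp
    | add x y hx hy => rw [map_add, map_add, map_add, hx, hy]
    | tmul a b =>
      rw [truncTensor, Algebra.TensorProduct.map_tmul, TensorProduct.lift.tmul,
        TensorProduct.lift.tmul, LinearMap.compl₁₂_apply]
      have e1 := h1 _ (hs' a) b
      have e2 := h2 (s (truncMk k G n a)) _ (hs' b)
      rw [map_sub, LinearMap.sub_apply, sub_eq_zero] at e1
      rw [map_sub, sub_eq_zero] at e2
      rw [e1, e2]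
  rw [key, ht, map_zero]

/-- The component of bidegree `(i, j)` of the tensor square of the linear extension of an
expansion. -/
def expTensor (E : G →* GrHat k G) (i j : ℕ) :
    GroupAlg k G ⊗[k] GroupAlg k G →ₗ[k] GrAlg k G i ⊗[k] GrAlg k G j :=
  TensorProduct.map (component i ∘ₗ (expLift E).toLinearMap)
    (component j ∘ₗ (expLift E).toLinearMap)

lemma expTensor_tmul (i j : ℕ) (a b : GroupAlg k G) : expTensor E i j (a ⊗ₜ b) =
    component i (expLift E a) ⊗ₜ component j (expLift E b) :=
  rfl

lemma IsExpansion.expTensor_eq_zero (hE : IsExpansion E) {i j n : ℕ} (hi : i < n) (hj : j < n)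
    {t : GroupAlg k G ⊗[k] GroupAlg k G} (ht : truncTensor k G n n t = 0) :
    expTensor E i j t = 0 := by
  refine lift_eq_zero_of_truncTensor_eq_zero _ (fun a ha b => ?_) (fun a b hb => ?_) ht
  · change component i (expLift E a) ⊗ₜ component j (expLift E b) = 0
    rw [hE.expLift_mem_iff.2 ha i hi, TensorProduct.zero_tmul]
  · change component i (expLift E a) ⊗ₜ component j (expLift E b) = 0
    rw [hE.expLift_mem_iff.2 hb j hj, TensorProduct.tmul_zero]

/-- The kernel condition gives p = ∑ ρ_i ∘ c_i over i < n, so p ⊗ p is a sum of maps factoring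
through the c_i ⊗ c_j. -/
lemma map_eq_zero_of_forall_map_eq_zero {A T : Type*} [AddCommGroup A] [Module k A]
    [AddCommGroup T] [Module k T] {V : ℕ → Type*} [∀ i, AddCommMonoid (V i)] [∀ i, Module k (V i)]
    (c : ∀ i, A →ₗ[k] V i) (p : A →ₗ[k] T) {n : ℕ} (h : ∀ a, (∀ i < n, c i a = 0) → p a = 0)
    {t : A ⊗[k] A} (ht : ∀ i < n, ∀ j < n, TensorProduct.map (c i) (c j) t = 0) :
    TensorProduct.map p p t = 0 := by
  let _ : ∀ i, AddCommGroup (V i) := fun i => Module.addCommMonoidToAddCommGroup k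
  let L : A →ₗ[k] ((i : Fin n) → V i.1) := LinearMap.pi fun i => c i
  have hL : LinearMap.ker L ≤ LinearMap.ker p := fun a ha =>
    h a fun j hj => congrFun (LinearMap.mem_ker.1 ha) (⟨j, hj⟩ : Fin n)
  obtain ⟨r, hr⟩ := exists_comp_eq_of_ker_le L p hL
  let ρ : ∀ i : Fin n, V i.1 →ₗ[k] T := fun i =>
    r ∘ₗ LinearMap.single k (fun i : Fin n => V i.1) i
  have hρ : ∀ a, p a = ∑ i : Fin n, ρ i (c i.1 a) := fun a => by
    have h1 : L a = ∑ i : Fin n, LinearMap.single k (fun i : Fin n => V i.1) i (c i.1 a) :=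
      (LinearMap.sum_single_apply (fun i : Fin n => V i.1) (L a)).symm
    rw [← hr a, h1, map_sum]
    rfl
  have key : ∀ t : A ⊗[k] A, TensorProduct.map p p t =
      ∑ i : Fin n, ∑ j : Fin n, TensorProduct.map (ρ i) (ρ j)
        (TensorProduct.map (c i.1) (c j.1) t) := by
    intro t
    induction t using TensorProduct.induction_on with
    | zero => simp
    | add x y hx hy => simp only [map_add, hx, hy, Finset.sum_add_distrib]
    | tmul a b =>
      rw [TensorProduct.map_tmul, hρ a, hρ b, TensorProduct.sum_tmul]
      refine Finset.sum_congr rfl fun i _ => ?_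
      rw [TensorProduct.tmul_sum]
      rfl
  rw [key]
  refine Finset.sum_eq_zero fun i _ => Finset.sum_eq_zero fun j _ => ?_
  rw [ht i i.2 j j.2, map_zero]

lemma IsExpansion.truncMk_eq_zero_of_component (hE : IsExpansion E) {n : ℕ} (a : GroupAlg k G)
    (ha : ∀ i < n, (component i ∘ₗ (expLift E).toLinearMap) a = 0) :
    (truncMk k G n).toLinearMap a = 0 := by
  have h1 : expLift E a ∈ grHatFil k G n := fun j hj => ha j hj
  exact truncMk_eq_zero.2 (hE.expLift_mem_iff.1 h1)

lemma truncTensor_apply (n : ℕ) (t : GroupAlg k G ⊗[k] GroupAlg k G) : truncTensor k G n n t =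
    TensorProduct.map (truncMk k G n).toLinearMap (truncMk k G n).toLinearMap t :=
  rfl

/-- With `IsExpansion.expTensor_eq_zero`, vanishing in kG/I^n ⊗ kG/I^n can be tested in the
bidegrees with i, j < n. -/
lemma IsExpansion.truncTensor_eq_zero_of_expTensor (hE : IsExpansion E) {n : ℕ}
    {t : GroupAlg k G ⊗[k] GroupAlg k G} (ht : ∀ i < n, ∀ j < n, expTensor E i j t = 0) :
    truncTensor k G n n t = 0 := by
  rw [truncTensor_apply]
  exact map_eq_zero_of_forall_map_eq_zero (V := fun i => GrAlg k G i)
    (fun i => component i ∘ₗ (expLift E).toLinearMap) (truncMk k G n).toLinearMap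
    hE.truncMk_eq_zero_of_component ht

lemma IsTaylorExpansion.grHatComul_expLift (hE : IsTaylorExpansion E) (f : GroupAlg k G)
    (i j : ℕ) : grHatComul (expLift E f) i j =
      expTensor E i j (Bialgebra.comulAlgHom k (GroupAlg k G) f) := by
  let S : GroupAlg k G →ₗ[k] GrAlg k G i ⊗[k] GrAlg k G j :=
    LinearMap.proj j ∘ₗ LinearMap.proj i ∘ₗ grHatComul ∘ₗ (expLift E).toLinearMap
  let T : GroupAlg k G →ₗ[k] GrAlg k G i ⊗[k] GrAlg k G j :=
    expTensor E i j ∘ₗ (Bialgebra.comulAlgHom k (GroupAlg k G)).toLinearMap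
  have hST : S = T := linearMap_ext_of fun g => by
    have h1 : Bialgebra.comulAlgHom k (GroupAlg k G) (MonoidAlgebra.of k G g) =
      MonoidAlgebra.of k G g ⊗ₜ[k] MonoidAlgebra.of k G g := by simp
    change grHatComul (expLift E (MonoidAlgebra.of k G g)) i j = expTensor E i j
      (Bialgebra.comulAlgHom k (GroupAlg k G) (MonoidAlgebra.of k G g))
    rw [h1, expTensor_tmul, expLift_of, hE.groupLike]
    rfl
  exact LinearMap.congr_fun hST f

/-- Primitivity in the degree completion of `gr(kG)`. -/
def IsGrPrimitive (y : GrHat k G) : Prop :=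
  grHatComul y = grHatTmul y 1 + grHatTmul 1 y

lemma comulTrunc_mk (n : ℕ) (f : GroupAlg k G) : comulTrunc k G n (truncMk k G (2 * n) f) =
    truncTensor k G n n (Bialgebra.comulAlgHom k (GroupAlg k G) f) :=
  rfl

lemma comulTrunc_eq_iff {n : ℕ} {x : CompletedAlg k G} {f : GroupAlg k G}
    (hf : proj (2 * n) x = truncMk k G (2 * n) f) :
    comulTrunc k G n (proj (2 * n) x) = proj n x ⊗ₜ[k] 1 + 1 ⊗ₜ[k] proj n x ↔
      truncTensor k G n n (Bialgebra.comulAlgHom k (GroupAlg k G) f - (f ⊗ₜ 1 + 1 ⊗ₜ f)) = 0 := by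
  have h1 : proj n x = truncMk k G n f := by
    rw [← truncMap_proj (show n ≤ 2 * n by omega), hf]
    exact AlgHom.congr_fun (truncMap_comp (show n ≤ 2 * n by omega)) f
  rw [hf, h1, comulTrunc_mk, map_sub, map_add, sub_eq_zero, truncTensor,
    Algebra.TensorProduct.map_tmul, Algebra.TensorProduct.map_tmul, map_one]

lemma IsTaylorExpansion.isPrimitive_iff_isGrPrimitive (hE : IsTaylorExpansion E) {x : CompletedAlg k G} :
    IsPrimitive x ↔ IsGrPrimitive (completedExp E x) := by
  obtain ⟨f, hf⟩ := exists_proj_eq x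
  -- The comultiplication at level n only sees x modulo I^(2n), and bidegrees with i, j < n have
  -- total degree below 2n, so the representative f (2 * n) suffices.
  have key : ∀ {n i j : ℕ}, i + j < 2 * n → i < n → j < n →
      (expTensor E i j (Bialgebra.comulAlgHom k (GroupAlg k G) (f (2 * n)) -
        (f (2 * n) ⊗ₜ 1 + 1 ⊗ₜ f (2 * n))) = 0 ↔
      grHatComul (completedExp E x) i j =
        (grHatTmul (completedExp E x) 1 + grHatTmul 1 (completedExp E x)) i j) := by
    intro n i j hij hi hj
    have h1 : ∀ l < 2 * n, component l (completedExp E x) = component l (expLift E (f (2 * n))) :=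
      fun l hl => hE.component_completedExp (hf _) hl
    have h2 : grHatComul (completedExp E x) i j = grHatComul (expLift E (f (2 * n))) i j := by
      change grComul rfl (component (i + j) _) = grComul rfl (component (i + j) _)
      rw [h1 _ hij]
    have h3 : (grHatTmul (completedExp E x) 1 + grHatTmul 1 (completedExp E x)) i j =
        expTensor E i j (f (2 * n) ⊗ₜ 1 + 1 ⊗ₜ f (2 * n)) := by
      rw [map_add, expTensor_tmul, expTensor_tmul, map_one, ← h1 i (by omega), ← h1 j (by omega)]
      rfl
    rw [h2, h3, hE.grHatComul_expLift, map_sub, sub_eq_zero]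
  rw [isPrimitive_iff]
  constructor
  · intro h
    funext i j
    refine (key (n := i + j + 1) (by omega) (by omega) (by omega)).1 ?_
    exact hE.expTensor_eq_zero (by omega) (by omega) ((comulTrunc_eq_iff (hf _)).1 (h (i + j + 1)))
  · intro h n
    refine (comulTrunc_eq_iff (hf _)).2 (hE.truncTensor_eq_zero_of_expTensor fun i hi j hj => ?_)
    exact (key (by omega) hi hj).2 (congrFun (congrFun h i) j)

/-- Primitive elements have zero augmentation. -/
lemma proj_one_eq_zero_of_isPrimitive {x : CompletedAlg k G} (hx : IsPrimitive x) :
    proj 1 x = 0 := by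
  obtain ⟨f, hf⟩ := exists_proj_eq x
  have h1 := (comulTrunc_eq_iff (hf (2 * 1))).1 ((isPrimitive_iff x).1 hx 1)
  let ε : GroupAlg k G →ₗ[k] k := Coalgebra.counit
  have hε : ∀ a ∈ augIdeal k G ^ 1, ε a = 0 := fun a ha => by
    rw [Submodule.pow_one] at ha; exact ha
  -- Apply ε ⊗ ε to the primitivity relation: as (ε ⊗ ε) Δ = ε, it reads ε(f) = 2 ε(f).
  let T : GroupAlg k G →ₗ[k] GroupAlg k G →ₗ[k] k := (LinearMap.mul k k).compl₁₂ ε ε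
  have hT : ∀ a b, T a b = ε a * ε b := fun a b => rfl
  have h2 := lift_eq_zero_of_truncTensor_eq_zero T (n := 1)
    (fun a ha b => by rw [hT, hε a ha, zero_mul]) (fun a b hb => by rw [hT, hε b hb, mul_zero]) h1
  have h3 : TensorProduct.lift T ∘ₗ (Bialgebra.comulAlgHom k (GroupAlg k G)).toLinearMap = ε :=
    linearMap_ext_of fun g => by
      have h4 : Bialgebra.comulAlgHom k (GroupAlg k G) (MonoidAlgebra.of k G g) =
        MonoidAlgebra.of k G g ⊗ₜ[k] MonoidAlgebra.of k G g := by simp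
      have h5 : ε (MonoidAlgebra.of k G g) = 1 := by simp [ε]
      change TensorProduct.lift T (Bialgebra.comulAlgHom k (GroupAlg k G) _) = _
      rw [h4, TensorProduct.lift.tmul, hT, h5, one_mul]
  have h4 : TensorProduct.lift T (Bialgebra.comulAlgHom k (GroupAlg k G) (f (2 * 1))) =
      ε (f (2 * 1)) := LinearMap.congr_fun h3 _
  have h5 : ε 1 = 1 := by simp [ε]
  rw [map_sub, h4, map_add, TensorProduct.lift.tmul, TensorProduct.lift.tmul, hT, hT, h5] at h2
  have h6 : ε (f (2 * 1)) = 0 := by linear_combination -h2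
  rw [← truncMap_proj (show 1 ≤ 2 * 1 by omega), hf, ← AlgHom.comp_apply, truncMap_comp,
    truncMk_eq_zero, Submodule.pow_one]
  exact h6

end Primitive

/-! ## The logarithmic derivative of a Taylor expansion -/

section LogDeriv

open GrHat (component)

variable {k : Type*} [Field k] {G : Type*} [Group G] {E : G →* GrHat k G}

/-- Since I^(n+1) = I^n I and I is spanned by the g - 1, a linear condition on I^(n+1) need only be
checked on products a (g - 1). -/
lemma mem_of_mem_augIdeal_pow_succ {P : Submodule k (GroupAlg k G)} {n : ℕ}
    (h : ∀ a ∈ augIdeal k G ^ n, ∀ g, a * (MonoidAlgebra.of k G g - 1) ∈ P)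
    {f : GroupAlg k G} (hf : f ∈ augIdeal k G ^ (n + 1)) : f ∈ P := by
  rw [Submodule.pow_succ] at hf
  induction hf using Submodule.mul_induction_on' with
  | mem_mul_mem a ha b hb =>
    have h1 : Submodule.span k (Set.range fun g : G => MonoidAlgebra.of k G g - 1) ≤
        P.comap (LinearMap.mulLeft k a) := by
      refine Submodule.span_le.2 ?_
      rintro _ ⟨g, rfl⟩
      exact h a ha g
    exact h1 ((mem_augIdeal_iff_span b).1 hb)
  | add x _ y _ hx hy => exact add_mem hx hy

lemma component_mul_of_sub_one_mem {n : ℕ} {u w : GrHat k G} (hu : u - 1 ∈ grHatFil k G 1)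
    (hw : w ∈ grHatFil k G n) : component n (u * w) = component n w := by
  have h1 := mul_mem_grHatFil hu hw n (by omega)
  rw [sub_mul, one_mul, map_sub, sub_eq_zero] at h1
  exact h1

lemma mul_mem_grHatFil_right {n : ℕ} (u : GrHat k G) {w : GrHat k G}
    (hw : w ∈ grHatFil k G n) : u * w ∈ grHatFil k G n := by
  have h1 := mul_mem_grHatFil (show u ∈ grHatFil k G 0 by rw [grHatFil_zero]; trivial) hw
  rwa [zero_add] at h1

lemma mul_mem_grHatFil_left {n : ℕ} {u : GrHat k G} (w : GrHat k G)
    (hu : u ∈ grHatFil k G n) : u * w ∈ grHatFil k G n :=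
  mul_mem_grHatFil hu (show w ∈ grHatFil k G 0 by rw [grHatFil_zero]; trivial)

lemma map_inv_mul_map (g : G) : E g⁻¹ * E g = 1 := by
  rw [← map_mul, inv_mul_cancel, map_one]

/-- The linear extension of `g ↦ E(g⁻¹)`. -/
def invExp (E : G →* GrHat k G) : GroupAlg k G →ₗ[k] GrHat k G :=
  linExt fun g => E g⁻¹

lemma invExp_mul_of (a : GroupAlg k G) (g : G) :
    invExp E (a * MonoidAlgebra.of k G g) = E g⁻¹ * invExp E a := by
  have h1 : invExp E ∘ₗ LinearMap.mulRight k (MonoidAlgebra.of k G g) =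
      LinearMap.mulLeft k (E g⁻¹) ∘ₗ invExp E := linearMap_ext_of fun h => by
    change invExp E (MonoidAlgebra.of k G h * MonoidAlgebra.of k G g) =
      E g⁻¹ * invExp E (MonoidAlgebra.of k G h)
    rw [← map_mul, invExp, linExt_of, linExt_of, mul_inv_rev, map_mul]
  exact LinearMap.congr_fun h1 a

/-- Right multiplication by g - 1 becomes left multiplication by E(g⁻¹) - 1, which raises degrees by
one. -/
lemma IsExpansion.invExp_mem (hE : IsExpansion E) {n : ℕ} {f : GroupAlg k G}
    (hf : f ∈ augIdeal k G ^ n) : invExp E f ∈ grHatFil k G n := by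
  induction n generalizing f with
  | zero => rw [grHatFil_zero]; trivial
  | succ n ih =>
    refine mem_of_mem_augIdeal_pow_succ (P := (grHatFil k G (n + 1)).comap (invExp E))
      (fun a ha g => ?_) hf
    rw [Submodule.mem_comap, mul_sub, mul_one, map_sub, invExp_mul_of, ← sub_one_mul, add_comm]
    exact mul_mem_grHatFil (hE.sub_one_mem g⁻¹) (ih ha)

/-- The linear extension of the logarithmic derivative `g ↦ E(g)⁻¹ θ(E(g))`, where `θ` is the
degree derivation. -/
def logDeriv (E : G →* GrHat k G) : GroupAlg k G →ₗ[k] GrHat k G :=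
  linExt fun g => E g⁻¹ * degDeriv (E g)

lemma logDeriv_of (g : G) : logDeriv E (MonoidAlgebra.of k G g) = E g⁻¹ * degDeriv (E g) :=
  linExt_of _ _

lemma logDeriv_one : logDeriv E 1 = 0 := by
  rw [← map_one (MonoidAlgebra.of k G), logDeriv_of, map_one, degDeriv_one, mul_zero]

/-- The product rule for E(h g)⁻¹ θ(E(h) E(g)); the counit appears on extending linearly in h. -/
lemma logDeriv_mul_of (a : GroupAlg k G) (g : G) :
    logDeriv E (a * MonoidAlgebra.of k G g) = E g⁻¹ * logDeriv E a * E g +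
      Coalgebra.counit (R := k) a • logDeriv E (MonoidAlgebra.of k G g) := by
  have h1 : logDeriv E ∘ₗ LinearMap.mulRight k (MonoidAlgebra.of k G g) =
      LinearMap.mulRight k (E g) ∘ₗ LinearMap.mulLeft k (E g⁻¹) ∘ₗ logDeriv E +
        LinearMap.toSpanSingleton k _ (logDeriv E (MonoidAlgebra.of k G g)) ∘ₗ
          (Coalgebra.counit (R := k) (A := GroupAlg k G)) := linearMap_ext_of fun h => by
    have h2 : Coalgebra.counit (R := k) (MonoidAlgebra.of k G h) = 1 := by simp
    change logDeriv E (MonoidAlgebra.of k G h * MonoidAlgebra.of k G g) =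
      E g⁻¹ * logDeriv E (MonoidAlgebra.of k G h) * E g +
        Coalgebra.counit (R := k) (MonoidAlgebra.of k G h) • logDeriv E (MonoidAlgebra.of k G g)
    rw [h2, one_smul, ← map_mul, logDeriv_of, logDeriv_of, logDeriv_of, mul_inv_rev, map_mul,
      map_mul, degDeriv_mul, mul_add]
    congr 1
    · simp only [mul_assoc]
    · rw [mul_assoc, ← mul_assoc (E h⁻¹), map_inv_mul_map, one_mul]
  exact LinearMap.congr_fun h1 a

/-- Elements of the `n`-th filtration step whose component of degree `n` comes from the Lie algebra
of the group. -/
def lieLeading (k : Type*) [Field k] (G : Type*) [Group G] (n : ℕ) : Submodule k (GrHat k G) :=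
  grHatFil k G n ⊓ (LinearMap.range (compare (k := k) (G := G) n)).comap (component n)

lemma compare_one_of (g : G) : compare 1 ((1 : k) ⊗ₜ[ℤ] Additive.ofMul (lcsMk 1 ⟨g, Subgroup.mem_top g⟩)) =
    grMk 1 ⟨MonoidAlgebra.of k G g - 1, by
      change _ ∈ augIdeal k G ^ 1; rw [Submodule.pow_one]; exact of_sub_one_mem g⟩ := by
  rw [compare_tmul, one_smul]
  rfl

lemma IsExpansion.component_one (hE : IsExpansion E) (g : G) : component 1 (E g - 1) =
    compare 1 ((1 : k) ⊗ₜ[ℤ] Additive.ofMul (lcsMk 1 ⟨g, Subgroup.mem_top g⟩)) := by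
  have h1 : E g - 1 = expLift E (MonoidAlgebra.of k G g - 1) := by
    rw [map_sub, map_one, expLift_of]
  rw [compare_one_of, ← hE.component_expLift, h1]

/-- In degree 1 the leading component of E(g)⁻¹ θ(E(g)) is [g - 1]. When ε(a) = 0, the product rule
sends a (g - 1) to E(g)⁻¹ times the commutator of the logarithmic derivative of a with E(g) - 1,
whose leading component is a Lie bracket by induction. -/
lemma IsExpansion.logDeriv_mem (hE : IsExpansion E) {n : ℕ} {f : GroupAlg k G}
    (hf : f ∈ augIdeal k G ^ (n + 1)) : logDeriv E f ∈ lieLeading k G (n + 1) := by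
  induction n generalizing f with
  | zero =>
    rw [zero_add, Submodule.pow_one, mem_augIdeal_iff_span] at hf
    refine (Submodule.span_le (p := (lieLeading k G 1).comap (logDeriv E))).2 ?_ hf
    rintro _ ⟨g, rfl⟩
    change logDeriv E (MonoidAlgebra.of k G g - 1) ∈ lieLeading k G 1
    rw [map_sub, logDeriv_one, sub_zero, logDeriv_of]
    refine ⟨mul_mem_grHatFil_right _ (degDeriv_mem_one _), ?_⟩
    change component 1 _ ∈ LinearMap.range _
    rw [component_mul_of_sub_one_mem (hE.sub_one_mem _) (degDeriv_mem_one _),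
      component_degDeriv, Nat.cast_one, one_smul]
    refine ⟨_, (hE.component_one g).symm.trans ?_⟩
    rw [map_sub, component_one_of_ne one_ne_zero, sub_zero]
  | succ n ih =>
    refine mem_of_mem_augIdeal_pow_succ (P := (lieLeading k G (n + 1 + 1)).comap (logDeriv E))
      (fun a ha g => ?_) hf
    have h0 : Coalgebra.counit (R := k) a = 0 := by
      have := augIdeal_pow_le (show 1 ≤ n + 1 by omega) ha
      rw [Submodule.pow_one] at this
      exact this
    obtain ⟨h1, X, hX⟩ := ih ha
    have h2 : logDeriv E (a * (MonoidAlgebra.of k G g - 1)) =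
        E g⁻¹ * (logDeriv E a * (E g - 1) - (E g - 1) * logDeriv E a) := by
      rw [mul_sub, mul_one, map_sub, logDeriv_mul_of, h0, zero_smul, add_zero, mul_sub, mul_sub,
        mul_one, sub_mul, one_mul, mul_sub, mul_sub, ← mul_assoc (E g⁻¹) (E g), map_inv_mul_map,
        one_mul, ← mul_assoc]
      abel
    have h3 := sub_mem (mul_mem_grHatFil h1 (hE.sub_one_mem g))
      (show _ ∈ grHatFil k G (n + 1 + 1) by
        rw [add_comm]; exact mul_mem_grHatFil (hE.sub_one_mem g) h1)
    rw [Submodule.mem_comap, h2]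
    refine ⟨mul_mem_grHatFil_right _ h3, ?_⟩
    change component (n + 1 + 1) _ ∈ LinearMap.range _
    rw [component_mul_of_sub_one_mem (hE.sub_one_mem _) h3, map_sub,
      component_mul_of_mem rfl h1 (hE.sub_one_mem g),
      component_mul_of_mem (add_comm 1 (n + 1)) (hE.sub_one_mem g) h1, hE.component_one, ← hX]
    exact ⟨_, compare_grBracket rfl (add_comm 1 (n + 1)) _ _⟩

/-- The logarithmic derivative in terms of the comultiplication. -/
lemma logDeriv_eq (f : GroupAlg k G) : logDeriv E f =
    TensorProduct.lift ((LinearMap.mul k (GrHat k G)).compl₁₂ (invExp E)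
      (degDeriv ∘ₗ (expLift E).toLinearMap)) (Bialgebra.comulAlgHom k (GroupAlg k G) f) := by
  have h1 : logDeriv E = TensorProduct.lift ((LinearMap.mul k (GrHat k G)).compl₁₂ (invExp E)
      (degDeriv ∘ₗ (expLift E).toLinearMap)) ∘ₗ
        (Bialgebra.comulAlgHom k (GroupAlg k G)).toLinearMap := linearMap_ext_of fun g => by
    have h2 : Bialgebra.comulAlgHom k (GroupAlg k G) (MonoidAlgebra.of k G g) =
      MonoidAlgebra.of k G g ⊗ₜ[k] MonoidAlgebra.of k G g := by simp
    rw [LinearMap.comp_apply, AlgHom.toLinearMap_apply, h2, TensorProduct.lift.tmul, logDeriv_of]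
    change _ = invExp E (MonoidAlgebra.of k G g) * degDeriv (expLift E (MonoidAlgebra.of k G g))
    rw [expLift_of, invExp, linExt_of]
  exact LinearMap.congr_fun h1 f

/-- By `logDeriv_eq` only Δ(f) matters. When Δ(f) may be replaced by f ⊗ 1 + 1 ⊗ f, the first term
contributes θ(1) = 0 and the second θ(Ē(f)). -/
lemma IsExpansion.component_logDeriv (hE : IsExpansion E) {n : ℕ} {f : GroupAlg k G}
    (hf : truncTensor k G (n + 1) (n + 1)
      (Bialgebra.comulAlgHom k (GroupAlg k G) f - (f ⊗ₜ 1 + 1 ⊗ₜ f)) = 0) :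
    component n (logDeriv E f) = (n : k) • component n (expLift E f) := by
  let T : GroupAlg k G →ₗ[k] GroupAlg k G →ₗ[k] GrAlg k G n :=
    ((LinearMap.mul k (GrHat k G)).compl₁₂ (invExp E)
      (degDeriv ∘ₗ (expLift E).toLinearMap)).compr₂ (component n)
  have hT : ∀ a b, T a b = component n (invExp E a * degDeriv (expLift E b)) := fun _ _ => rfl
  have h1 := lift_eq_zero_of_truncTensor_eq_zero T (n := n + 1)
    (fun a ha b => by
      rw [hT]
      exact mul_mem_grHatFil_left _ (hE.invExp_mem ha) n (Nat.lt_succ_self n))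
    (fun a b hb => by
      rw [hT]
      exact mul_mem_grHatFil_right _ (degDeriv_mem (hE.expLift_mem_iff.2 hb)) n
        (Nat.lt_succ_self n)) hf
  have h2 : ∀ t, TensorProduct.lift T t = component n (TensorProduct.lift
      ((LinearMap.mul k (GrHat k G)).compl₁₂ (invExp E)
        (degDeriv ∘ₗ (expLift E).toLinearMap)) t) := fun t => by
    rw [TensorProduct.lift_compr₂]; rfl
  have h3 : invExp E 1 = 1 := by
    rw [← map_one (MonoidAlgebra.of k G), invExp, linExt_of, inv_one, map_one]
  rw [map_sub, h2 (Bialgebra.comulAlgHom k (GroupAlg k G) f), ← logDeriv_eq, map_add,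
    TensorProduct.lift.tmul, TensorProduct.lift.tmul, hT, hT, map_one, degDeriv_one, mul_zero,
    map_zero, zero_add, h3, one_mul, component_degDeriv, sub_eq_zero] at h1
  exact h1

/-- The leading component of a primitive element comes from the Lie algebra of the group. -/
lemma IsTaylorExpansion.leading_mem_range [CharZero k] (hE : IsTaylorExpansion E) {n : ℕ}
    (hn : n ≠ 0) {x : CompletedAlg k G} (hx : IsPrimitive x) (h : proj n x = 0) :
    component n (completedExp E x) ∈ LinearMap.range (compare (k := k) (G := G) n) := by
  -- Degree n is seen at level n + 1 of the tensor truncations, where the comultiplication requires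
  -- x modulo I^(2(n+1)).
  obtain ⟨f, hf⟩ := truncMk_surjective _ (proj (2 * (n + 1)) x)
  have h1 := (comulTrunc_eq_iff hf.symm).1 ((isPrimitive_iff x).1 hx (n + 1))
  have h2 : f ∈ augIdeal k G ^ n := by
    rw [← truncMk_eq_zero, ← h, ← truncMap_proj (show n ≤ 2 * (n + 1) by omega), ← hf]
    exact (AlgHom.congr_fun (truncMap_comp (show n ≤ 2 * (n + 1) by omega)) f).symm
  obtain ⟨m, rfl⟩ := Nat.exists_eq_succ_of_ne_zero hn
  have h3 : component (m + 1) (logDeriv E f) ∈ LinearMap.range (compare (m + 1)) :=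
    (hE.logDeriv_mem h2).2
  rw [hE.component_logDeriv h1] at h3
  rw [hE.component_completedExp hf.symm (by omega)]
  -- The logarithmic derivative gives n times the component, and n is invertible in k.
  exact (Submodule.smul_mem_iff _ (by exact_mod_cast hn)).1 h3

/-- The comultiplication is graded, so the relation in bidegree (i, j) only involves the component
of total degree i + j or holds trivially. -/
lemma IsGrPrimitive.homPart {y : GrHat k G} (hy : IsGrPrimitive y) (n : ℕ) :
    IsGrPrimitive (homPart n y) := by
  have h1 : ∀ {i j m : ℕ} (h : i + j = m), grComul h (component m y) =
      component i y ⊗ₜ component j 1 + component i 1 ⊗ₜ component j y := fun {i j m} h => by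
    subst h; exact congrFun (congrFun hy i) j
  have key : ∀ {i j m : ℕ} (h : i + j = m), grComul h (component m (GroupExpansion.homPart n y)) =
      component i (GroupExpansion.homPart n y) ⊗ₜ component j 1 +
        component i 1 ⊗ₜ component j (GroupExpansion.homPart n y) := by
    intro i j m h
    have h2 := h1 h
    simp only [component_homPart]
    rcases Nat.eq_zero_or_pos i with rfl | hi
    · rcases Nat.eq_zero_or_pos j with rfl | hj
      · obtain rfl : m = 0 := by omega
        by_cases hn : 0 = n
        · simp only [if_pos hn]; exact h2
        · simp only [if_neg hn, map_zero, TensorProduct.tmul_zero, TensorProduct.zero_tmul,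
            add_zero]
      · obtain rfl : j = m := by omega
        rw [component_one_of_ne hj.ne', TensorProduct.tmul_zero] at h2 ⊢
        by_cases hn : j = n
        · simp only [if_pos hn]; exact h2
        · simp only [if_neg hn, map_zero, TensorProduct.tmul_zero, add_zero]
    · rw [component_one_of_ne hi.ne', TensorProduct.zero_tmul, add_zero] at h2 ⊢
      rcases Nat.eq_zero_or_pos j with rfl | hj
      · obtain rfl : i = m := by omega
        by_cases hn : i = n
        · simp only [if_pos hn]; exact h2
        · simp only [if_neg hn, map_zero, TensorProduct.zero_tmul]
      · rw [component_one_of_ne hj.ne', TensorProduct.tmul_zero] at h2 ⊢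
        by_cases hn : m = n
        · simp only [if_pos hn]; exact h2
        · simp only [if_neg hn, map_zero]
  funext i j
  exact key rfl

/-- A homogeneous part of y is primitive and is its own leading component, so `leading_mem_range`
applies to its preimage under the completed expansion; in degree 0 primitive elements vanish. -/
lemma IsTaylorExpansion.exists_compareHat_eq [CharZero k] (hE : IsTaylorExpansion E)
    {y : GrHat k G} (hy : IsGrPrimitive y) : ∃ z : GrLieHat G k, compareHat z = y := by
  have key : ∀ n, component n y ∈ LinearMap.range (compare (k := k) (G := G) n) := by
    intro n
    obtain ⟨x, hx⟩ := hE.completedHom_bijective.2 (homPart n y)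
    have hx' : completedExp E x = homPart n y := hx
    have h1 : IsPrimitive x := hE.isPrimitive_iff_isGrPrimitive.2 (hx' ▸ hy.homPart n)
    have h2 : component n (homPart n y) = component n y := by rw [component_homPart, if_pos rfl]
    rw [← h2, ← hx']
    rcases Nat.eq_zero_or_pos n with rfl | hn
    · have h3 := hE.completedExp_mem_iff.2 (proj_one_eq_zero_of_isPrimitive h1) 0 one_pos
      rw [h3]; exact zero_mem _
    · refine hE.leading_mem_range hn.ne' h1 (hE.completedExp_mem_iff.1 ?_)
      rw [hx']
      intro j hj
      rw [component_homPart, if_neg hj.ne]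
  choose z hz using key
  exact ⟨z, GrHat.ext fun n => (component_compareHat n _).trans (hz n)⟩

/-- The isomorphism from the degree completion of the Lie algebra of the group to the Malcev Lie
algebra given by a Taylor expansion. -/
def IsTaylorExpansion.toMalcev [CharZero k] (hE : IsTaylorExpansion E) :
    GrLieHat G k →ₗ⁅k⁆ malcev k G where
  toFun y := ⟨hE.completedEquiv.symm (compareHat y), by
    refine hE.isPrimitive_iff_isGrPrimitive.2 ?_
    rw [← hE.completedEquiv_apply, AlgEquiv.apply_symm_apply]
    exact grHatComul_compareHat y⟩
  map_add' x y := Subtype.ext (by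
    change hE.completedEquiv.symm (compareHat (x + y)) = hE.completedEquiv.symm (compareHat x) +
      hE.completedEquiv.symm (compareHat y)
    rw [map_add, map_add])
  map_smul' c x := Subtype.ext (by
    change hE.completedEquiv.symm (compareHat (c • x)) = c • hE.completedEquiv.symm (compareHat x)
    rw [map_smul, map_smul])
  map_lie' {x y} := Subtype.ext (by
    change hE.completedEquiv.symm (compareHat ⁅x, y⁆) =
      ⁅hE.completedEquiv.symm (compareHat x), hE.completedEquiv.symm (compareHat y)⁆
    rw [compareHat_lie, Ring.lie_def, map_sub, map_mul, map_mul])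

lemma IsTaylorExpansion.completedExp_toMalcev [CharZero k] (hE : IsTaylorExpansion E)
    (y : GrLieHat G k) : completedExp E (hE.toMalcev y : CompletedAlg k G) = compareHat y :=
  hE.completedEquiv.apply_symm_apply _

lemma IsTaylorExpansion.toMalcev_bijective [CharZero k] (hE : IsTaylorExpansion E) :
    Function.Bijective hE.toMalcev := by
  constructor
  · intro x y h
    refine compareHat_injective ?_
    rw [← hE.completedExp_toMalcev, h, hE.completedExp_toMalcev]
  · intro x
    obtain ⟨z, hz⟩ := hE.exists_compareHat_eq (hE.isPrimitive_iff_isGrPrimitive.1 x.2)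
    refine ⟨z, Subtype.ext (hE.completedHom_bijective.1 ?_)⟩
    exact (hE.completedExp_toMalcev z).trans hz

lemma IsTaylorExpansion.isFilteredFormal [CharZero k] (hE : IsTaylorExpansion E) :
    IsFilteredFormal k G := by
  let e := LieEquiv.ofBijective hE.toMalcev hE.toMalcev_bijective
  -- The embedding of gr(G; k) turns the inverse isomorphism into the completed expansion, so both
  -- conditions follow from those on E.
  have he : ∀ x : malcev k G, compareHat (e.symm x) = completedExp E (x : CompletedAlg k G) := by
    intro x
    rw [← hE.completedExp_toMalcev]
    exact congrArg (fun z : malcev k G => completedExp E (z : CompletedAlg k G)) (e.apply_symm_apply x)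
  refine ⟨e.symm, fun n x => ?_, fun n x f hf => ?_⟩
  · rw [← compareHat_mem_grHatFil, he, hE.completedExp_mem_iff]
    rfl
  · rw [← component_compareHat, he, hE.component_completedExp hf (Nat.lt_succ_self n),
      hE.component_expLift]

lemma HasFaithfulTaylorExpansion.residual_and_formal [CharZero k]
    (h : HasFaithfulTaylorExpansion k G) :
    IsResiduallyTorsionFreeNilpotent G ∧ IsFilteredFormal k G := by
  obtain ⟨E, hE, hinj⟩ := h
  exact ⟨isResiduallyTorsionFreeNilpotent_of_dimSubgroup fun g hg => hE.dimSubgroup_eq_one hinj hg,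
    hE.isFilteredFormal⟩

end LogDeriv

/-! ## Truncated exponentials in filtered algebras -/

section TruncatedExp

open Finset.HasAntidiagonal (antidiagonal mem_antidiagonal)
open scoped Nat

/-- A decreasing multiplicative filtration of an algebra by subspaces. -/
structure AlgFiltration (k B : Type*) [Field k] [Ring B] [Algebra k B] where
  /-- The filtration steps. -/
  fil : ℕ → Submodule k B
  fil_zero : fil 0 = ⊤
  anti : ∀ {m n : ℕ}, m ≤ n → fil n ≤ fil m
  mul_mem : ∀ {i j : ℕ} {a b : B}, a ∈ fil i → b ∈ fil j → a * b ∈ fil (i + j)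

variable {k : Type*} [Field k] {B : Type*} [Ring B] [Algebra k B]

namespace AlgFiltration

variable (F : AlgFiltration k B)

lemma mem_zero (a : B) : a ∈ F.fil 0 := by rw [F.fil_zero]; trivial

lemma mul_mem_right {n : ℕ} (a : B) {b : B} (hb : b ∈ F.fil n) : a * b ∈ F.fil n := by
  have := F.mul_mem (F.mem_zero a) hb
  rwa [zero_add] at this

lemma mul_mem_left {n : ℕ} {a : B} (ha : a ∈ F.fil n) (b : B) : a * b ∈ F.fil n :=
  F.mul_mem ha (F.mem_zero b)

lemma pow_mem {a : B} (ha : a ∈ F.fil 1) (m : ℕ) : a ^ m ∈ F.fil m := by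
  induction m with
  | zero => exact F.mem_zero _
  | succ m ih => rw [pow_succ]; exact F.mul_mem ih ha

lemma mul_sub_mul_mem {n : ℕ} {a a' b b' : B} (ha : a - a' ∈ F.fil n) (hb : b - b' ∈ F.fil n) :
    a * b - a' * b' ∈ F.fil n := by
  have := add_mem (F.mul_mem_left ha b) (F.mul_mem_right a' hb)
  rwa [sub_mul, mul_sub, sub_add_sub_cancel] at this

lemma sum_range_sub_mem {b : ℕ → B} (hb : ∀ j, b j ∈ F.fil j) {m n : ℕ} (h : m ≤ n) :
    ∑ j ∈ Finset.range n, b j - ∑ j ∈ Finset.range m, b j ∈ F.fil m := by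
  rw [← Finset.sum_range_add_sum_Ico _ h, add_sub_cancel_left]
  exact sum_mem fun j hj => F.anti (Finset.mem_Ico.1 hj).1 (hb j)

/-- The Cauchy product of truncated sums. -/
lemma sum_antidiagonal_sub_mem {a b : ℕ → B} (ha : ∀ i, a i ∈ F.fil i) (hb : ∀ j, b j ∈ F.fil j)
    (N : ℕ) : ∑ m ∈ Finset.range N, ∑ p ∈ antidiagonal m, a p.1 * b p.2 -
      (∑ i ∈ Finset.range N, a i) * ∑ j ∈ Finset.range N, b j ∈ F.fil N := by
  -- Grouped by i, the inner sum stops at j < N - i; the omitted terms have total order at least N.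
  have h1 : ∑ m ∈ Finset.range N, ∑ p ∈ antidiagonal m, a p.1 * b p.2 =
      ∑ i ∈ Finset.range N, a i * ∑ j ∈ Finset.range (N - i), b j := by
    simp only [Finset.mul_sum]
    rw [← Finset.sum_range_diag_flip N fun i j => a i * b j]
    exact Finset.sum_congr rfl fun m _ =>
      Finset.Nat.sum_antidiagonal_eq_sum_range_succ (fun i j => a i * b j) m
  rw [h1, Finset.sum_mul, ← Finset.sum_sub_distrib]
  refine sum_mem fun i hi => ?_
  rw [← mul_sub, ← neg_sub, mul_neg]
  have h2 := F.mul_mem (ha i) (F.sum_range_sub_mem hb (Nat.sub_le N i))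
  rw [Nat.add_sub_cancel' (Finset.mem_range.1 hi).le] at h2
  exact neg_mem h2

end AlgFiltration

/-- The exponential series truncated at degree `N`. -/
def texp (k : Type*) [Field k] {B : Type*} [Ring B] [Algebra k B] (N : ℕ) (a : B) : B :=
  ∑ m ∈ Finset.range N, (m ! : k)⁻¹ • a ^ m

lemma map_texp {C : Type*} [Ring C] [Algebra k C] (f : B →ₐ[k] C) (N : ℕ) (a : B) :
    f (texp k N a) = texp k N (f a) := by
  simp only [texp, map_sum, map_smul, map_pow]

lemma texp_mem_subalgebra (S : Subalgebra k B) (N : ℕ) {a : B} (ha : a ∈ S) : texp k N a ∈ S :=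
  sum_mem fun m _ => S.smul_mem (pow_mem ha m) _

lemma texp_zero_right {N : ℕ} (hN : 0 < N) : texp k N (0 : B) = 1 := by
  rw [texp, Finset.sum_eq_single 0]
  · simp
  · intro m _ hm; rw [zero_pow hm, smul_zero]
  · intro h; exact absurd (Finset.mem_range.2 hN) h

lemma texp_one (a : B) : texp k 1 a = 1 := by simp [texp]

lemma texp_two (a : B) : texp k 2 a = 1 + a := by simp [texp, Finset.sum_range_succ]

/-- Commutation with a fixed element, `u ↦ u a - a u`. -/
def adRight (k : Type*) [Field k] {B : Type*} [Ring B] [Algebra k B] (a : B) : B →ₗ[k] B :=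
  LinearMap.mulRight k a - LinearMap.mulLeft k a

lemma adRight_apply (a u : B) : adRight k a u = u * a - a * u := rfl

lemma inv_factorial_mul_choose [CharZero k] {i j m : ℕ} (h : i + j = m) :
    (m ! : k)⁻¹ * (m.choose i : k) = (i ! : k)⁻¹ * (j ! : k)⁻¹ := by
  have h1 : (m.choose i : k) * (i ! : k) * (j ! : k) = (m ! : k) := by
    subst h
    rw [Nat.choose_symm_add]
    exact_mod_cast Nat.add_choose_mul_factorial_mul_factorial i j
  have h2 : ∀ l : ℕ, (l ! : k) ≠ 0 := fun l => by exact_mod_cast Nat.factorial_ne_zero l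
  field_simp [h2 i, h2 j, h2 m]
  rw [← h1]

/-- The divided binomial formula for commuting elements. -/
lemma inv_factorial_smul_add_pow [CharZero k] {x y : B} (h : Commute x y) (m : ℕ) :
    (m ! : k)⁻¹ • (x + y) ^ m =
      ∑ p ∈ antidiagonal m, ((p.1 ! : k)⁻¹ • x ^ p.1) * ((p.2 ! : k)⁻¹ • y ^ p.2) := by
  rw [h.add_pow', Finset.smul_sum]
  refine Finset.sum_congr rfl fun p hp => ?_
  rw [← Nat.cast_smul_eq_nsmul k, smul_smul, inv_factorial_mul_choose (mem_antidiagonal.1 hp),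
    smul_mul_smul_comm]

/-- Right multiplication by a is left multiplication plus `adRight`, and these commute; the binomial
formula in the endomorphism algebra yields u e^a = e^a (e^ad u). -/
lemma mul_texp [CharZero k] (u a : B) (N : ℕ) : u * texp k N a = ∑ m ∈ Finset.range N,
    ∑ p ∈ antidiagonal m, ((p.1 ! : k)⁻¹ • a ^ p.1) * ((p.2 ! : k)⁻¹ • (adRight k a ^ p.2) u) := by
  have hc : Commute (LinearMap.mulLeft k a) (adRight k a) :=
    (LinearMap.commute_mulLeft_right a a).sub_right (Commute.refl _)
  have h1 : LinearMap.mulLeft k a + adRight k a = LinearMap.mulRight k a := add_sub_cancel _ _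
  rw [texp, Finset.mul_sum]
  refine Finset.sum_congr rfl fun m _ => ?_
  have h2 := LinearMap.congr_fun (inv_factorial_smul_add_pow (k := k) hc m) u
  rw [h1, LinearMap.pow_mulRight, LinearMap.sum_apply] at h2
  rw [mul_smul_comm]
  refine h2.trans (Finset.sum_congr rfl fun p _ => ?_)
  rw [LinearMap.pow_mulLeft]
  change (p.1 ! : k)⁻¹ • (a ^ p.1 * ((p.2 ! : k)⁻¹ • (adRight k a ^ p.2) u)) = _
  rw [smul_mul_assoc]

variable (F : AlgFiltration k B)

lemma smul_pow_mem {a : B} (ha : a ∈ F.fil 1) (m : ℕ) : (m ! : k)⁻¹ • a ^ m ∈ F.fil m :=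
  Submodule.smul_mem _ _ (F.pow_mem ha m)

lemma texp_sub_texp_mem {a : B} (ha : a ∈ F.fil 1) {m n : ℕ} (h : m ≤ n) :
    texp k n a - texp k m a ∈ F.fil m :=
  F.sum_range_sub_mem (smul_pow_mem F ha) h

lemma texp_sub_one_mem {a : B} (ha : a ∈ F.fil 1) {N : ℕ} (hN : 0 < N) :
    texp k N a - 1 ∈ F.fil 1 := by
  rw [← texp_one (k := k) a]
  exact texp_sub_texp_mem F ha hN

lemma texp_add_sub_mem [CharZero k] {a b : B} (ha : a ∈ F.fil 1) (hb : b ∈ F.fil 1)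
    (h : Commute a b) (N : ℕ) : texp k N (a + b) - texp k N a * texp k N b ∈ F.fil N := by
  have := F.sum_antidiagonal_sub_mem (smul_pow_mem F ha) (smul_pow_mem F hb) N
  simp only [← inv_factorial_smul_add_pow h] at this
  exact this

lemma adRight_pow_mem {a u : B} (ha : a ∈ F.fil 1) {i : ℕ} (hu : u ∈ F.fil i) (j : ℕ) :
    (adRight k a ^ j) u ∈ F.fil (i + j) := by
  induction j with
  | zero => exact hu
  | succ j ih =>
    rw [pow_succ', Module.End.mul_apply, adRight_apply]
    have h1 := F.mul_mem ih ha
    have h2 := F.mul_mem ha ih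
    rw [add_comm 1] at h2
    exact sub_mem h1 h2

/-- The adjoint action of an exponential. -/
lemma mul_texp_sub_mem [CharZero k] {a : B} (ha : a ∈ F.fil 1) (u : B) (N : ℕ) :
    u * texp k N a - texp k N a * ∑ j ∈ Finset.range N, (j ! : k)⁻¹ • (adRight k a ^ j) u
      ∈ F.fil N := by
  rw [mul_texp]
  refine F.sum_antidiagonal_sub_mem (smul_pow_mem F ha)
    (b := fun j => (j ! : k)⁻¹ • (adRight k a ^ j) u) (fun j => Submodule.smul_mem _ _ ?_) N
  have := adRight_pow_mem F ha (F.mem_zero u) j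
  rwa [zero_add] at this

/-- In the telescoping expansion, every term contains a - b and m further factors of order 1. -/
lemma pow_sub_pow_mem {a b : B} (ha : a ∈ F.fil 1) (hb : b ∈ F.fil 1) {j : ℕ}
    (h : a - b ∈ F.fil j) (m : ℕ) : a ^ (m + 1) - b ^ (m + 1) ∈ F.fil (j + m) := by
  induction m with
  | zero => simpa using h
  | succ m ih =>
    have h0 := F.mul_mem (F.pow_mem hb (m + 1)) h
    rw [add_comm _ j] at h0
    have h1 := add_mem (F.mul_mem ih ha) h0
    rwa [sub_mul, mul_sub, ← pow_succ, ← pow_succ, sub_add_sub_cancel] at h1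

/-- The exponential is 1 + a up to quadratic terms, whose differences gain at least one step; N ≥ 2
keeps the linear term in the truncation. -/
lemma texp_sub_texp_sub_mem {a b : B} (ha : a ∈ F.fil 1) (hb : b ∈ F.fil 1) {j : ℕ}
    (h : a - b ∈ F.fil j) {N : ℕ} (hN : 2 ≤ N) :
    texp k N a - texp k N b - (a - b) ∈ F.fil (j + 1) := by
  obtain ⟨M, rfl⟩ := Nat.exists_eq_add_of_le hN
  have h1 : ∀ c : B, texp k (2 + M) c =
      1 + c + ∑ m ∈ Finset.range M, ((2 + m) ! : k)⁻¹ • c ^ (2 + m) := fun c => by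
    rw [texp, Finset.sum_range_add, ← texp_two (k := k) c, texp]
  rw [h1, h1]
  have h2 : ∑ m ∈ Finset.range M, ((2 + m) ! : k)⁻¹ • (a ^ (2 + m) - b ^ (2 + m)) ∈
      F.fil (j + 1) := sum_mem fun m _ => Submodule.smul_mem _ _ (F.anti (by omega)
        ((show 2 + m = m + 1 + 1 by omega) ▸ pow_sub_pow_mem F ha hb h (m + 1)))
  simp only [smul_sub, Finset.sum_sub_distrib] at h2
  convert h2 using 1
  abel

lemma texp_sub_mem_of_sub_mem {a b : B} (ha : a ∈ F.fil 1) (hb : b ∈ F.fil 1) {j : ℕ}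
    (h : a - b ∈ F.fil j) (N : ℕ) : texp k N a - texp k N b ∈ F.fil j := by
  rw [texp, texp, ← Finset.sum_sub_distrib]
  refine sum_mem fun m _ => ?_
  rw [← smul_sub]
  refine Submodule.smul_mem _ _ ?_
  rcases m with _ | m
  · simp
  · exact F.anti (by omega) (pow_sub_pow_mem F ha hb h m)

/-- The truncated exponential is injective modulo the filtration. -/
lemma sub_mem_of_texp_sub_mem {a b : B} (ha : a ∈ F.fil 1) (hb : b ∈ F.fil 1) {N : ℕ}
    (h : texp k N a - texp k N b ∈ F.fil N) : a - b ∈ F.fil N := by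
  suffices h' : ∀ j ≤ N, a - b ∈ F.fil j from h' N le_rfl
  intro j hj
  induction j with
  | zero => exact F.mem_zero _
  | succ j ih =>
    rcases j with _ | j
    · exact sub_mem ha hb
    · have h1 := texp_sub_texp_sub_mem F ha hb (ih (by omega)) (N := N) (by omega)
      have h2 := sub_mem (F.anti hj h) h1
      rwa [sub_sub_cancel] at h2

/-- The truncated exponential is surjective modulo the filtration. -/
lemma exists_texp_sub_mem {w : B} (hw : w - 1 ∈ F.fil 1) (N : ℕ) :
    ∃ a ∈ F.fil 1, texp k N a - w ∈ F.fil N := by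
  induction N with
  | zero => exact ⟨0, zero_mem _, F.mem_zero _⟩
  | succ N ih =>
    rcases N with _ | N
    · refine ⟨0, zero_mem _, ?_⟩
      rw [texp_one, ← neg_sub]
      exact neg_mem hw
    · obtain ⟨a, ha, h⟩ := ih
      have h1 : w - texp k (N + 2) a ∈ F.fil (N + 1) := by
        have := add_mem (texp_sub_texp_mem F ha (show N + 1 ≤ N + 2 by omega)) h
        rw [sub_add_sub_cancel] at this
        rw [← neg_sub]
        exact neg_mem this
      -- Adding the error itself corrects the exponential to one further order.
      have h2 : a + (w - texp k (N + 2) a) ∈ F.fil 1 := add_mem ha (F.anti (by omega) h1)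
      refine ⟨_, h2, ?_⟩
      have h3 := texp_sub_texp_sub_mem F h2 ha (j := N + 1) (by rwa [add_sub_cancel_left])
        (show 2 ≤ N + 2 by omega)
      convert h3 using 1
      abel

end TruncatedExp

/-! ## The Baker–Campbell–Hausdorff theorem -/

section BakerCampbellHausdorff

open Finset.HasAntidiagonal (antidiagonal mem_antidiagonal)
open PowerSeries (coeff)
open scoped Nat

variable {k : Type*} [Field k] {R : Type*} [Ring R] [Algebra k R]

/-- The filtration of the algebra of power series by the order. -/
def orderFil (k R : Type*) [Field k] [Ring R] [Algebra k R] : AlgFiltration k (PowerSeries R) where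
  fil n :=
    { carrier := {f | ∀ j < n, coeff j f = 0}
      zero_mem' := fun j _ => map_zero _
      add_mem' := fun hf hg j hj => by rw [map_add, hf j hj, hg j hj, add_zero]
      smul_mem' := fun c f hf j hj => by rw [PowerSeries.coeff_smul, hf j hj, smul_zero] }
  fil_zero := eq_top_iff.2 fun _ _ j hj => absurd hj (Nat.not_lt_zero j)
  anti h _ hf j hj := hf j (hj.trans_le h)
  mul_mem {i j f g} hf hg n hn := by
    rw [PowerSeries.coeff_mul]
    refine Finset.sum_eq_zero fun p hp => ?_
    have hp' := mem_antidiagonal.1 hp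
    rcases lt_or_ge p.1 i with h | h
    · rw [hf _ h, zero_mul]
    · rw [hg _ (by omega), mul_zero]

lemma mem_orderFil_succ {n : ℕ} {f : PowerSeries R} (hf : f ∈ (orderFil k R).fil n)
    (h : coeff n f = 0) : f ∈ (orderFil k R).fil (n + 1) := fun j hj => by
  rcases Nat.lt_succ_iff_lt_or_eq.1 hj with h' | rfl
  · exact hf j h'
  · exact h

/-- The Euler derivation `f ↦ X f'` of the algebra of power series. -/
def euler (k R : Type*) [Field k] [Ring R] [Algebra k R] : PowerSeries R →ₗ[k] PowerSeries R where
  toFun f := PowerSeries.mk fun n => (n : k) • coeff n f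
  map_add' f g := PowerSeries.ext fun n => by
    simp only [map_add, PowerSeries.coeff_mk, smul_add]
  map_smul' c f := PowerSeries.ext fun n => by
    simp only [PowerSeries.coeff_smul, PowerSeries.coeff_mk, RingHom.id_apply]
    rw [smul_comm]

@[simp] lemma coeff_euler (n : ℕ) (f : PowerSeries R) :
    coeff n (euler k R f) = (n : k) • coeff n f :=
  PowerSeries.coeff_mk n fun n => (n : k) • coeff n f

lemma euler_mul (f g : PowerSeries R) :
    euler k R (f * g) = euler k R f * g + f * euler k R g := by
  refine PowerSeries.ext fun n => ?_
  rw [coeff_euler, map_add, PowerSeries.coeff_mul, PowerSeries.coeff_mul, PowerSeries.coeff_mul,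
    Finset.smul_sum, ← Finset.sum_add_distrib]
  refine Finset.sum_congr rfl fun p hp => ?_
  rw [coeff_euler, coeff_euler, smul_mul_assoc, mul_smul_comm, ← add_smul, ← mem_antidiagonal.1 hp,
    Nat.cast_add]

lemma euler_one : euler k R 1 = 0 := by
  refine PowerSeries.ext fun n => ?_
  rw [coeff_euler, PowerSeries.coeff_one, map_zero]
  rcases Nat.eq_zero_or_pos n with rfl | hn
  · rw [Nat.cast_zero, zero_smul]
  · rw [if_neg hn.ne', smul_zero]

lemma euler_mem {n : ℕ} {f : PowerSeries R} (hf : f ∈ (orderFil k R).fil n) :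
    euler k R f ∈ (orderFil k R).fil n := fun j hj => by
  rw [coeff_euler, hf j hj, smul_zero]

/-- The terms of the series of the logarithmic derivative of an exponential. -/
def eulerTerm (k : Type*) [Field k] {R : Type*} [Ring R] [Algebra k R] (P : PowerSeries R) :
    ℕ → PowerSeries R
  | 0 => 0
  | j + 1 => (adRight k P ^ j) (euler k R P)

/-- The truncated series of the logarithmic derivative of an exponential. -/
def eulerLog (k : Type*) [Field k] {R : Type*} [Ring R] [Algebra k R] (N : ℕ) (P : PowerSeries R) :
    PowerSeries R :=
  ∑ j ∈ Finset.range N, (j ! : k)⁻¹ • eulerTerm k P j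

lemma eulerTerm_mem {P : PowerSeries R} (hP : P ∈ (orderFil k R).fil 1) (j : ℕ) :
    eulerTerm k P j ∈ (orderFil k R).fil j := by
  rcases j with _ | j
  · exact zero_mem _
  · have := adRight_pow_mem _ hP (euler_mem hP) j
    rwa [add_comm] at this

/-- By the Leibniz rule, commuting the derivation with left multiplication by P gives left
multiplication by its value at P; further commutators remain left multiplications. -/
lemma adRight_mulLeft_pow_euler (P : PowerSeries R) (j : ℕ) :
    (adRight k (LinearMap.mulLeft k P) ^ (j + 1)) (euler k R) =
      LinearMap.mulLeft k ((adRight k P ^ j) (euler k R P)) := by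
  induction j with
  | zero =>
    rw [zero_add, pow_one, pow_zero, adRight_apply]
    refine LinearMap.ext fun f => ?_
    change euler k R (P * f) - P * euler k R f = euler k R P * f
    rw [euler_mul, add_sub_cancel_right]
  | succ j ih =>
    rw [pow_succ', Module.End.mul_apply, ih, pow_succ' _ j, Module.End.mul_apply, adRight_apply,
      adRight_apply]
    refine LinearMap.ext fun f => ?_
    change _ * (P * f) - P * (_ * f) = (_ - _) * f
    rw [sub_mul, mul_assoc, mul_assoc]

/-- This is `mul_texp` in the endomorphism algebra, with the derivation as u and left multiplication
by P as a, evaluated at 1. The term of index 0 vanishes because the derivation kills 1. -/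
lemma euler_texp [CharZero k] (P : PowerSeries R) (N : ℕ) : euler k R (texp k N P) =
    ∑ m ∈ Finset.range N, ∑ p ∈ antidiagonal m,
      ((p.1 ! : k)⁻¹ • P ^ p.1) * ((p.2 ! : k)⁻¹ • eulerTerm k P p.2) := by
  have h1 : texp k N (LinearMap.mulLeft k P) = LinearMap.mulLeft k (texp k N P) :=
    (map_texp (Algebra.lmul k (PowerSeries R)) N P).symm
  have h2 := LinearMap.congr_fun (mul_texp (k := k) (euler k R) (LinearMap.mulLeft k P) N) 1
  rw [h1] at h2
  have h3 : (euler k R * LinearMap.mulLeft k (texp k N P)) 1 = euler k R (texp k N P) := by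
    change euler k R (texp k N P * 1) = _
    rw [mul_one]
  rw [← h3, h2, LinearMap.sum_apply]
  refine Finset.sum_congr rfl fun m _ => ?_
  rw [LinearMap.sum_apply]
  refine Finset.sum_congr rfl fun p _ => ?_
  rw [LinearMap.pow_mulLeft]
  change (p.1 ! : k)⁻¹ • (P ^ p.1 * ((p.2 ! : k)⁻¹ •
    ((adRight k (LinearMap.mulLeft k P) ^ p.2) (euler k R)) 1)) = _
  rw [smul_mul_assoc]
  congr 4
  rcases p.2 with _ | j
  · exact euler_one
  · rw [adRight_mulLeft_pow_euler, LinearMap.mulLeft_apply, mul_one]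
    rfl

lemma euler_texp_sub_mem [CharZero k] {P : PowerSeries R} (hP : P ∈ (orderFil k R).fil 1) (N : ℕ) :
    euler k R (texp k N P) - texp k N P * eulerLog k N P ∈ (orderFil k R).fil N := by
  rw [euler_texp]
  exact (orderFil k R).sum_antidiagonal_sub_mem (smul_pow_mem _ hP)
    (b := fun j => (j ! : k)⁻¹ • eulerTerm k P j)
    (fun j => Submodule.smul_mem _ _ (eulerTerm_mem hP j)) N

lemma adRight_pow_sub_mem {P P' u u' : PowerSeries R} {M : ℕ} (hP : P ∈ (orderFil k R).fil 1)
    (hP' : P' ∈ (orderFil k R).fil 1) (hu' : u' ∈ (orderFil k R).fil 1)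
    (h : P - P' ∈ (orderFil k R).fil M) (hu : u - u' ∈ (orderFil k R).fil M) (j : ℕ) :
    (adRight k P ^ j) u - (adRight k P' ^ j) u' ∈ (orderFil k R).fil (M + j) := by
  induction j with
  | zero => exact hu
  | succ j ih =>
    rw [pow_succ', pow_succ', Module.End.mul_apply, Module.End.mul_apply, adRight_apply,
      adRight_apply]
    set v := (adRight k P ^ j) u
    set v' := (adRight k P' ^ j) u' with hv'
    have h0 : v' ∈ (orderFil k R).fil (1 + j) := adRight_pow_mem _ hP' hu' j
    have h1 := (orderFil k R).mul_mem ih hP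
    have h2 := (orderFil k R).mul_mem hP ih
    have h3 := (orderFil k R).mul_mem h0 h
    have h4 := (orderFil k R).mul_mem h h0
    rw [add_assoc] at h1
    rw [show 1 + (M + j) = M + (j + 1) by omega] at h2
    rw [show 1 + j + M = M + (j + 1) by omega] at h3
    rw [show M + (1 + j) = M + (j + 1) by omega] at h4
    have h5 := sub_mem (add_mem h1 h3) (add_mem h2 h4)
    convert h5 using 1
    noncomm_ring

/-- The term of index 1 is the derivation itself, which is linear; later terms contain commutators
with P, which raise the order of the variation. N ≥ 2 keeps the term of index 1. -/
lemma eulerLog_add_sub_mem {P δ : PowerSeries R} {M N : ℕ} (hP : P ∈ (orderFil k R).fil 1)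
    (hM : 1 ≤ M) (hδ : δ ∈ (orderFil k R).fil M) (hN : 2 ≤ N) :
    eulerLog k N (P + δ) - eulerLog k N P - euler k R δ ∈ (orderFil k R).fil (M + 1) := by
  obtain ⟨K, rfl⟩ := Nat.exists_eq_add_of_le hN
  have h1 : ∀ Q : PowerSeries R, eulerLog k (2 + K) Q = euler k R Q +
      ∑ m ∈ Finset.range K, ((2 + m) ! : k)⁻¹ • eulerTerm k Q (2 + m) := fun Q => by
    rw [eulerLog, Finset.sum_range_add]
    simp [Finset.sum_range_succ, eulerTerm]
  have hδ1 := (orderFil k R).anti hM hδ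
  have h2 : ∀ m, eulerTerm k (P + δ) (2 + m) - eulerTerm k P (2 + m) ∈
      (orderFil k R).fil (M + 1) := fun m => by
    rw [show 2 + m = m + 1 + 1 by omega]
    refine (orderFil k R).anti (by omega) (adRight_pow_sub_mem (M := M) (add_mem hP hδ1) hP
      (euler_mem hP) (by rwa [add_sub_cancel_left]) ?_ (m + 1))
    rw [← map_sub, add_sub_cancel_left]
    exact euler_mem hδ
  have h3 : ∑ m ∈ Finset.range K, ((2 + m) ! : k)⁻¹ •
      (eulerTerm k (P + δ) (2 + m) - eulerTerm k P (2 + m)) ∈ (orderFil k R).fil (M + 1) :=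
    sum_mem fun m _ => Submodule.smul_mem _ _ (h2 m)
  simp only [smul_sub, Finset.sum_sub_distrib] at h3
  rw [h1, h1, map_add]
  convert h3 using 1
  abel

/-- Power series whose coefficients lie in a given family of subspaces. -/
def seriesIn (L : ℕ → Submodule k R) : Submodule k (PowerSeries R) where
  carrier := {f | ∀ n, coeff n f ∈ L n}
  zero_mem' n := by rw [map_zero]; exact zero_mem _
  add_mem' hf hg n := by rw [map_add]; exact add_mem (hf n) (hg n)
  smul_mem' c f hf n := by rw [PowerSeries.coeff_smul]; exact Submodule.smul_mem _ _ (hf n)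

lemma adRight_mem_seriesIn {L : ℕ → Submodule k R}
    (hL : ∀ i j, ∀ a ∈ L i, ∀ b ∈ L j, a * b - b * a ∈ L (i + j)) {P u : PowerSeries R} (hP : P ∈ seriesIn L) (hu : u ∈ seriesIn L) :
    adRight k P u ∈ seriesIn L := fun n => by
  rw [adRight_apply, map_sub, PowerSeries.coeff_mul, PowerSeries.coeff_mul,
    ← Finset.Nat.sum_antidiagonal_swap (n := n) (f := fun p => coeff p.1 P * coeff p.2 u),
    ← Finset.sum_sub_distrib]
  refine sum_mem fun p hp => ?_
  rw [← mem_antidiagonal.1 hp]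
  exact hL _ _ _ (hu _) _ (hP _)

lemma adRight_pow_mem_seriesIn {L : ℕ → Submodule k R}
    (hL : ∀ i j, ∀ a ∈ L i, ∀ b ∈ L j, a * b - b * a ∈ L (i + j)) {P u : PowerSeries R} (hP : P ∈ seriesIn L) (hu : u ∈ seriesIn L)
    (j : ℕ) : (adRight k P ^ j) u ∈ seriesIn L := by
  induction j with
  | zero => exact hu
  | succ j ih =>
    rw [pow_succ', Module.End.mul_apply]
    exact adRight_mem_seriesIn hL hP ih

lemma eulerLog_mem_seriesIn {L : ℕ → Submodule k R}
    (hL : ∀ i j, ∀ a ∈ L i, ∀ b ∈ L j, a * b - b * a ∈ L (i + j)) {P : PowerSeries R} (hP : P ∈ seriesIn L) (N : ℕ) :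
    eulerLog k N P ∈ seriesIn L := by
  refine sum_mem fun j _ => Submodule.smul_mem _ _ ?_
  rcases j with _ | j
  · exact zero_mem _
  · refine adRight_pow_mem_seriesIn hL hP (fun n => ?_) j
    rw [coeff_euler]
    exact Submodule.smul_mem _ _ (hP n)

lemma eulerLog_mem {P : PowerSeries R} (hP : P ∈ (orderFil k R).fil 1) (N : ℕ) :
    eulerLog k N P ∈ (orderFil k R).fil 1 := by
  refine sum_mem fun j _ => Submodule.smul_mem _ _ ?_
  rcases j with _ | j
  · exact zero_mem _
  · exact (orderFil k R).anti (by omega) (eulerTerm_mem hP (j + 1))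

/-- Exponentials with prescribed logarithmic derivative. -/
lemma exists_eulerLog_sub_mem [CharZero k] {L : ℕ → Submodule k R}
    (hL : ∀ i j, ∀ a ∈ L i, ∀ b ∈ L j, a * b - b * a ∈ L (i + j)) {q : PowerSeries R} (hq : q ∈ seriesIn L)
    (hq1 : q ∈ (orderFil k R).fil 1) {N : ℕ} (hN : 2 ≤ N) (M : ℕ) :
    ∃ P ∈ seriesIn L, P ∈ (orderFil k R).fil 1 ∧ eulerLog k N P - q ∈ (orderFil k R).fil M := by
  induction M with
  | zero => exact ⟨0, zero_mem _, zero_mem _, (orderFil k R).mem_zero _⟩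
  | succ M ih =>
    obtain ⟨P, hP, hP1, h⟩ := ih
    -- In degree 0 the derivation cannot correct anything, but both series have positive order.
    rcases Nat.eq_zero_or_pos M with rfl | hM
    · exact ⟨P, hP, hP1, sub_mem (eulerLog_mem hP1 N) hq1⟩
    -- The derivation multiplies degree M by M, so the error is divided by M.
    let c : R := (M : k)⁻¹ • coeff M (q - eulerLog k N P)
    have hc : c ∈ L M := Submodule.smul_mem _ _ (sub_mem hq (eulerLog_mem_seriesIn hL hP N) M)
    have hδ : PowerSeries.monomial M c ∈ (orderFil k R).fil M := fun j hj => by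
      rw [PowerSeries.coeff_monomial, if_neg hj.ne]
    refine ⟨P + PowerSeries.monomial M c, add_mem hP fun n => ?_,
      add_mem hP1 ((orderFil k R).anti hM hδ), ?_⟩
    · rw [PowerSeries.coeff_monomial]
      split_ifs with h'
      · rw [h']; exact hc
      · exact zero_mem _
    · have h1 := eulerLog_add_sub_mem hP1 hM hδ hN
      have h2 : eulerLog k N P - q + euler k R (PowerSeries.monomial M c) ∈
          (orderFil k R).fil (M + 1) := by
        refine mem_orderFil_succ (add_mem h (euler_mem hδ)) ?_
        rw [map_add, coeff_euler, PowerSeries.coeff_monomial, if_pos rfl,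
          smul_inv_smul₀ (by exact_mod_cast hM.ne'), ← map_add, sub_add_sub_cancel, sub_self,
          map_zero]
      have h3 := add_mem h1 h2
      convert h3 using 1
      abel

/-- Uniqueness of the solutions of a linear differential equation. -/
lemma sub_mem_of_euler_sub_mem [CharZero k] {V W q : PowerSeries R} {N : ℕ}
    (h : V - W ∈ (orderFil k R).fil 1) (hq : q ∈ (orderFil k R).fil 1)
    (hV : euler k R V - V * q ∈ (orderFil k R).fil N)
    (hW : euler k R W - W * q ∈ (orderFil k R).fil N) : V - W ∈ (orderFil k R).fil N := by
  suffices h' : ∀ j ≤ N, V - W ∈ (orderFil k R).fil j from h' N le_rfl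
  intro j hj
  induction j with
  | zero => exact (orderFil k R).mem_zero _
  | succ j ih =>
    rcases Nat.eq_zero_or_pos j with rfl | hj0
    · exact h
    have h1 := ih (by omega)
    refine mem_orderFil_succ h1 ?_
    have h2 := sub_mem hV hW j (by omega)
    -- As q has positive order, (V - W) q does not contribute in degree j; what remains is j times
    -- the coefficient of V - W.
    have h3 := (orderFil k R).mul_mem h1 hq j (by omega)
    rw [sub_sub_sub_comm, ← sub_mul, ← map_sub, map_sub (coeff j), h3, sub_zero, coeff_euler] at h2
    exact (smul_eq_zero.1 h2).resolve_left (by exact_mod_cast hj0.ne')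

/-- The series x X is fixed by the derivation and commutes with itself, so no commutator terms
survive. -/
lemma eulerLog_monomial (x : R) {N : ℕ} (hN : 2 ≤ N) :
    eulerLog k N (PowerSeries.monomial 1 x) = PowerSeries.monomial 1 x := by
  have h1 : euler k R (PowerSeries.monomial 1 x) = PowerSeries.monomial 1 x := by
    refine PowerSeries.ext fun n => ?_
    rw [coeff_euler, PowerSeries.coeff_monomial]
    split_ifs with h
    · rw [h, Nat.cast_one, one_smul]
    · rw [smul_zero]
  rw [eulerLog, Finset.sum_eq_single 1]
  · change ((1 ! : ℕ) : k)⁻¹ • euler k R (PowerSeries.monomial 1 x) = _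
    rw [h1, Nat.factorial_one, Nat.cast_one, inv_one, one_smul]
  · intro j _ hj
    rcases j with _ | _ | j
    · exact smul_zero _
    · exact absurd rfl hj
    · change _ • (adRight k _ ^ (j + 1)) (euler k R _) = _
      rw [h1, pow_succ, Module.End.mul_apply, adRight_apply, sub_self, map_zero, smul_zero]
  · intro h
    exact absurd (Finset.mem_range.2 (by omega)) h

/-- The sum of the coefficients of degree less than `N`. -/
def truncEval (k : Type*) [Field k] {R : Type*} [Ring R] [Algebra k R] (N : ℕ) :
    PowerSeries R →ₗ[k] R where
  toFun f := ∑ n ∈ Finset.range N, coeff n f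
  map_add' f g := by simp only [map_add, Finset.sum_add_distrib]
  map_smul' c f := by simp only [PowerSeries.coeff_smul, Finset.smul_sum, RingHom.id_apply]

lemma truncEval_apply (N : ℕ) (f : PowerSeries R) :
    truncEval k N f = ∑ n ∈ Finset.range N, coeff n f :=
  rfl

lemma truncEval_eq_zero {N : ℕ} {f : PowerSeries R} (hf : f ∈ (orderFil k R).fil N) :
    truncEval k N f = 0 :=
  Finset.sum_eq_zero fun n hn => hf n (Finset.mem_range.1 hn)

variable (F : AlgFiltration k R)

/-- Power series whose coefficients lie in the steps of a filtration. -/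
def AlgFiltration.series : Subalgebra k (PowerSeries R) where
  carrier := {f | ∀ n, coeff n f ∈ F.fil n}
  add_mem' hf hg n := by rw [map_add]; exact add_mem (hf n) (hg n)
  mul_mem' hf hg n := by
    rw [PowerSeries.coeff_mul]
    refine sum_mem fun p hp => ?_
    rw [← mem_antidiagonal.1 hp]
    exact F.mul_mem (hf _) (hg _)
  algebraMap_mem' c n := by
    rw [Algebra.algebraMap_eq_smul_one, PowerSeries.coeff_smul, PowerSeries.coeff_one]
    refine Submodule.smul_mem _ _ ?_
    split_ifs with h
    · rw [h]; exact F.mem_zero _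
    · exact zero_mem _

/-- Setting X = 1 is multiplicative modulo the filtration, because the n-th coefficients have order
n. -/
lemma truncEval_mul_sub_mem {f g : PowerSeries R} (hf : f ∈ F.series) (hg : g ∈ F.series) (N : ℕ) :
    truncEval k N (f * g) - truncEval k N f * truncEval k N g ∈ F.fil N := by
  simp only [truncEval_apply, PowerSeries.coeff_mul]
  exact F.sum_antidiagonal_sub_mem hf hg N

lemma truncEval_pow_sub_mem {f : PowerSeries R} (hf : f ∈ F.series) {N : ℕ} (hN : 0 < N) (m : ℕ) :
    truncEval k N (f ^ m) - truncEval k N f ^ m ∈ F.fil N := by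
  induction m with
  | zero =>
    have h1 : truncEval k N (1 : PowerSeries R) = 1 := by
      simp [truncEval_apply, PowerSeries.coeff_one, hN.ne']
    rw [pow_zero, pow_zero, h1, sub_self]
    exact zero_mem _
  | succ m ih =>
    rw [pow_succ, pow_succ]
    have h1 := add_mem (truncEval_mul_sub_mem F (pow_mem hf m) hf N)
      (F.mul_mem_left ih (truncEval k N f))
    rwa [sub_mul, sub_add_sub_cancel] at h1

lemma truncEval_texp_sub_mem {f : PowerSeries R} (hf : f ∈ F.series) {N : ℕ} (hN : 0 < N) :
    truncEval k N (texp k N f) - texp k N (truncEval k N f) ∈ F.fil N := by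
  rw [texp, texp, map_sum, ← Finset.sum_sub_distrib]
  refine sum_mem fun m _ => ?_
  rw [map_smul, ← smul_sub]
  exact Submodule.smul_mem _ _ (truncEval_pow_sub_mem F hf hN m)

/-- The product of two exponentials of elements of a Lie algebra of commutators is the exponential
of an element of this Lie algebra. -/
theorem exists_texp_sub_mul_texp_mem [CharZero k] {L : ℕ → Submodule k R}
    (hF : ∀ n, L n ≤ F.fil n) (hanti : ∀ {m n}, m ≤ n → L n ≤ L m)
    (hL : ∀ i j, ∀ a ∈ L i, ∀ b ∈ L j, a * b - b * a ∈ L (i + j)) {x y : R} (hx : x ∈ L 1)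
    (hy : y ∈ L 1) (N : ℕ) :
    ∃ z ∈ L 1, texp k N z - texp k N x * texp k N y ∈ F.fil N := by
  rcases N with _ | _ | N
  · exact ⟨0, zero_mem _, F.mem_zero _⟩
  · refine ⟨0, zero_mem _, ?_⟩
    rw [zero_add, texp_one, texp_one, texp_one, one_mul, sub_self]
    exact zero_mem _
  have hN : 2 ≤ N + 1 + 1 := by omega
  generalize N + 1 + 1 = N at hN
  have hmon : ∀ a ∈ L 1, PowerSeries.monomial 1 a ∈ seriesIn L ∧
      PowerSeries.monomial 1 a ∈ (orderFil k R).fil 1 := fun a ha => by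
    refine ⟨fun n => ?_, fun j hj => ?_⟩
    · rw [PowerSeries.coeff_monomial]
      split_ifs with h
      · rw [h]; exact ha
      · exact zero_mem _
    · rw [PowerSeries.coeff_monomial, if_neg hj.ne]
  have hev : ∀ a : R, truncEval k N (PowerSeries.monomial 1 a) = a := fun a => by
    simp only [truncEval_apply, PowerSeries.coeff_monomial]
    rw [Finset.sum_ite_eq', if_pos (Finset.mem_range.2 (by omega))]
  have hser : seriesIn L ≤ F.series.toSubmodule := fun f hf n => hF n (hf n)
  obtain ⟨hp, hp1⟩ := hmon x hx
  obtain ⟨hq, hq1⟩ := hmon y hy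
  have hex := hev x
  have hey := hev y
  have hlp := eulerLog_monomial (k := k) x hN
  have hlq := eulerLog_monomial (k := k) y hN
  generalize PowerSeries.monomial 1 x = p at hp hp1 hex hlp
  generalize PowerSeries.monomial 1 y = q at hq hq1 hey hlq
  -- Here p = x X and q = y X, and c is e^(-q) p e^q to order N. So e^p e^q has logarithmic
  -- derivative c + q, again with coefficients in the L n.
  let c : PowerSeries R := ∑ j ∈ Finset.range N, (j ! : k)⁻¹ • (adRight k q ^ j) p
  have hc : c ∈ seriesIn L := sum_mem fun j _ =>
    Submodule.smul_mem _ _ (adRight_pow_mem_seriesIn hL hq hp j)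
  have hc1 : c ∈ (orderFil k R).fil 1 := sum_mem fun j _ =>
    Submodule.smul_mem _ _ ((orderFil k R).anti (by omega) (adRight_pow_mem _ hq1 hp1 j))
  obtain ⟨P, hP, hP1, h⟩ := exists_eulerLog_sub_mem hL (add_mem hc hq) (add_mem hc1 hq1) hN N
  have hV : euler k R (texp k N P) - texp k N P * (c + q) ∈ (orderFil k R).fil N := by
    have := add_mem (euler_texp_sub_mem hP1 N) ((orderFil k R).mul_mem_right (texp k N P) h)
    rwa [mul_sub, sub_add_sub_cancel] at this
  have hW : euler k R (texp k N p * texp k N q) - texp k N p * texp k N q * (c + q) ∈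
      (orderFil k R).fil N := by
    have h1 := (orderFil k R).mul_mem_left (euler_texp_sub_mem hp1 N) (texp k N q)
    have h2 := (orderFil k R).mul_mem_right (texp k N p) (euler_texp_sub_mem hq1 N)
    have h3 := (orderFil k R).mul_mem_right (texp k N p) (mul_texp_sub_mem _ hq1 p N)
    rw [hlp] at h1
    rw [hlq] at h2
    have h4 := add_mem (add_mem h1 h2) h3
    rw [euler_mul]
    convert h4 using 1
    change _ = _ + texp k N p * (p * texp k N q - texp k N q * c)
    noncomm_ring
  have h1 : texp k N P - texp k N p * texp k N q ∈ (orderFil k R).fil 1 := by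
    have h2 := (orderFil k R).mul_sub_mul_mem (texp_sub_one_mem _ hp1 (show 0 < N by omega))
      (texp_sub_one_mem _ hq1 (show 0 < N by omega))
    have h3 := sub_mem (texp_sub_one_mem _ hP1 (show 0 < N by omega)) h2
    rwa [mul_one, sub_sub_sub_cancel_right] at h3
  -- Both e^P and e^p e^q have constant term 1 and satisfy V' X = V (c + q) to order N, so they
  -- agree to this order. It remains to set X = 1.
  have h2 := truncEval_eq_zero (sub_mem_of_euler_sub_mem h1 (add_mem hc1 hq1) hV hW)
  rw [map_sub, sub_eq_zero] at h2
  have hN0 : 0 < N := by omega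
  have e1 := truncEval_texp_sub_mem F (hser hP) hN0
  have e2 := truncEval_mul_sub_mem F (texp_mem_subalgebra _ N (hser hp))
    (texp_mem_subalgebra _ N (hser hq)) N
  have e3 := F.mul_sub_mul_mem (truncEval_texp_sub_mem F (hser hp) hN0)
    (truncEval_texp_sub_mem F (hser hq) hN0)
  rw [hex, hey] at e3
  refine ⟨truncEval k N P, ?_, ?_⟩
  · rw [truncEval_apply]
    refine sum_mem fun n _ => ?_
    -- The constant term of P is 0, and each other coefficient lies in some L n with n ≥ 1.
    rcases Nat.eq_zero_or_pos n with rfl | hn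
    · rw [hP1 0 one_pos]; exact zero_mem _
    · exact hanti hn (hP n)
  · have e4 := sub_mem (add_mem e2 e3) e1
    rw [h2, sub_add_sub_cancel, sub_sub_sub_cancel_left] at e4
    exact e4

end BakerCampbellHausdorff

/-! ## Logarithms of group elements -/

section GroupLog

variable {k : Type*} [Field k] {G : Type*} [Group G]

/-- The augmentation filtration of the group algebra. -/
def augFil (k G : Type*) [Field k] [Group G] : AlgFiltration k (GroupAlg k G) where
  fil := augPow k G
  fil_zero := eq_top_iff.2 fun a _ => mem_augIdeal_pow_zero a
  anti h _ ha := augIdeal_pow_le h ha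
  mul_mem ha hb := mul_mem_augIdeal_pow rfl ha hb

lemma mem_augFil {n : ℕ} {a : GroupAlg k G} : a ∈ (augFil k G).fil n ↔ a ∈ augIdeal k G ^ n :=
  Iff.rfl

/-- The tensor product filtration of `kG ⊗ kG`. -/
def tensorSquareFil (k G : Type*) [Field k] [Group G] :
    AlgFiltration k (GroupAlg k G ⊗[k] GroupAlg k G) where
  fil := tensorFil k G
  fil_zero := eq_top_iff.2 fun t _ => by
    induction t using TensorProduct.induction_on with
    | zero => exact zero_mem _
    | tmul a b =>
      exact tmul_mem_tensorFil (p := 0) (q := 0) rfl (mem_augIdeal_pow_zero a)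
        (mem_augIdeal_pow_zero b)
    | add x y hx hy => exact add_mem (hx trivial) (hy trivial)
  anti {m n} h := by
    refine Submodule.span_le.2 ?_
    rintro _ ⟨p, q, a, b, hpq, ha, hb, rfl⟩
    rcases le_or_gt m p with hp | hp
    · exact tmul_mem_tensorFil (p := m) (q := 0) rfl (augIdeal_pow_le hp ha)
        (mem_augIdeal_pow_zero b)
    · exact tmul_mem_tensorFil (p := p) (q := m - p) (by omega) ha
        (augIdeal_pow_le (by omega) hb)
  mul_mem hs ht := mul_mem_tensorFil hs ht

lemma proj_eq_truncMk {m n : ℕ} (h : m ≤ n) {x : CompletedAlg k G} {f : GroupAlg k G}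
    (hf : proj n x = truncMk k G n f) : proj m x = truncMk k G m f := by
  rw [← truncMap_proj h, hf]
  exact AlgHom.congr_fun (truncMap_comp h) f

lemma proj_eq_zero_iff {m n : ℕ} (h : m ≤ n) {x : CompletedAlg k G} {f : GroupAlg k G}
    (hf : proj n x = truncMk k G n f) : proj m x = 0 ↔ f ∈ augIdeal k G ^ m := by
  rw [proj_eq_truncMk h hf, truncMk_eq_zero]

/-- The filtration of the completed group algebra. -/
def completedFil (k G : Type*) [Field k] [Group G] : AlgFiltration k (CompletedAlg k G) where
  fil n := LinearMap.ker (proj n).toLinearMap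
  fil_zero := eq_top_iff.2 fun x _ => by
    obtain ⟨f, hf⟩ := truncMk_surjective 0 (proj 0 x)
    exact (proj_eq_zero_iff le_rfl hf.symm).2 (mem_augIdeal_pow_zero f)
  anti {m n} h x hx := by
    have hx' : proj n x = 0 := hx
    change proj m x = 0
    rw [← truncMap_proj h, hx', map_zero]
  mul_mem {i j x y} hx hy := by
    obtain ⟨a, ha⟩ := truncMk_surjective (i + j) (proj (i + j) x)
    obtain ⟨b, hb⟩ := truncMk_surjective (i + j) (proj (i + j) y)
    have ha' := (proj_eq_zero_iff (Nat.le_add_right i j) ha.symm).1 hx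
    have hb' := (proj_eq_zero_iff (Nat.le_add_left j i) hb.symm).1 hy
    change proj (i + j) (x * y) = 0
    rw [map_mul, ← ha, ← hb, ← map_mul, truncMk_eq_zero]
    exact mul_mem_augIdeal_pow rfl ha' hb'

lemma mem_completedFil {n : ℕ} {x : CompletedAlg k G} :
    x ∈ (completedFil k G).fil n ↔ proj n x = 0 :=
  Iff.rfl

lemma proj_eq_iff {n : ℕ} {x y : CompletedAlg k G} :
    proj n x = proj n y ↔ x - y ∈ (completedFil k G).fil n := by
  rw [mem_completedFil, map_sub, sub_eq_zero]

/-- Modulo order N, exp(Δ(a)) ≡ g ⊗ g ≡ exp(a ⊗ 1) exp(1 ⊗ a) ≡ exp(a ⊗ 1 + 1 ⊗ a), and the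
truncated exponential is injective modulo the filtration. -/
lemma comul_sub_mem_of_texp_sub_mem [CharZero k] {a : GroupAlg k G} {g : G} {N : ℕ}
    (ha : a ∈ augIdeal k G ^ 1) (h : texp k N a - MonoidAlgebra.of k G g ∈ augIdeal k G ^ N) :
    Bialgebra.comulAlgHom k (GroupAlg k G) a - (a ⊗ₜ 1 + 1 ⊗ₜ a) ∈ tensorFil k G N := by
  let l : GroupAlg k G →ₐ[k] GroupAlg k G ⊗[k] GroupAlg k G := Algebra.TensorProduct.includeLeft
  let r : GroupAlg k G →ₐ[k] GroupAlg k G ⊗[k] GroupAlg k G := Algebra.TensorProduct.includeRight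
  have hl : ∀ {n : ℕ} {b : GroupAlg k G}, b ∈ augIdeal k G ^ n → l b ∈ tensorFil k G n :=
    fun hb => tmul_mem_tensorFil (add_zero _) hb (mem_augIdeal_pow_zero 1)
  have hr : ∀ {n : ℕ} {b : GroupAlg k G}, b ∈ augIdeal k G ^ n → r b ∈ tensorFil k G n :=
    fun hb => tmul_mem_tensorFil (zero_add _) (mem_augIdeal_pow_zero 1) hb
  have hlr : ∀ b c, l b * r c = b ⊗ₜ c := fun b c => by
    change (b ⊗ₜ[k] 1) * (1 ⊗ₜ[k] c) = _
    rw [Algebra.TensorProduct.tmul_mul_tmul, one_mul, mul_one]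
  have hc : Commute (l a) (r a) := by
    change (a ⊗ₜ[k] 1) * (1 ⊗ₜ[k] a) = (1 ⊗ₜ[k] a) * (a ⊗ₜ[k] 1)
    rw [Algebra.TensorProduct.tmul_mul_tmul, Algebra.TensorProduct.tmul_mul_tmul, one_mul, mul_one]
  have h1 := comul_mem_tensorFil h
  have hg : Bialgebra.comulAlgHom k (GroupAlg k G) (MonoidAlgebra.of k G g) =
      l (MonoidAlgebra.of k G g) * r (MonoidAlgebra.of k G g) := by
    rw [hlr]; simp
  have h2 := (tensorSquareFil k G).mul_sub_mul_mem (n := N)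
    (a := l (texp k N a)) (a' := l (MonoidAlgebra.of k G g)) (b := r (texp k N a))
    (b' := r (MonoidAlgebra.of k G g)) (by rw [← map_sub]; exact hl h)
    (by rw [← map_sub]; exact hr h)
  have h3 := texp_add_sub_mem (tensorSquareFil k G) (hl ha) (hr ha) hc N
  rw [map_sub, map_texp, hg] at h1
  rw [map_texp, map_texp] at h2
  refine sub_mem_of_texp_sub_mem (tensorSquareFil k G) (comul_mem_tensorFil ha)
    (add_mem (hl ha) (hr ha)) ?_
  have h4 := sub_mem h1 (add_mem h3 h2)
  rw [sub_add_sub_cancel, sub_sub_sub_cancel_right] at h4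
  exact h4

/-- Approximate logarithms of g at the various levels are compatible because the truncated
exponential is injective modulo the filtration; their limit is primitive by
`comul_sub_mem_of_texp_sub_mem` at level 2n. -/
lemma exists_log [CharZero k] (g : G) : ∃ x : CompletedAlg k G, IsPrimitive x ∧
    ∀ N, proj N (texp k N x) = truncMk k G N (MonoidAlgebra.of k G g) := by
  have h0 : MonoidAlgebra.of k G g - 1 ∈ (augFil k G).fil 1 := by
    rw [mem_augFil, Submodule.pow_one]; exact of_sub_one_mem g
  choose a ha h using exists_texp_sub_mem (augFil k G) h0
  have hcompat : ∀ {m n : ℕ}, m ≤ n → a n - a m ∈ augIdeal k G ^ m := fun {m n} hmn => by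
    refine sub_mem_of_texp_sub_mem (augFil k G) (ha n) (ha m) ?_
    have h1 := sub_mem ((augFil k G).anti hmn (h n)) (add_mem (h m)
      (texp_sub_texp_mem (augFil k G) (ha n) hmn))
    convert h1 using 1
    abel
  let x : CompletedAlg k G := ⟨fun n => truncMk k G n (a n), fun m n hmn => by
    change truncMk k G m (a n) = truncMk k G m (a m)
    rw [← sub_eq_zero, ← map_sub, truncMk_eq_zero]
    exact hcompat hmn⟩
  have hx : ∀ n, proj n x = truncMk k G n (a n) := fun n => rfl
  refine ⟨x, (isPrimitive_iff x).2 fun n => ?_, fun N => ?_⟩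
  · rw [comulTrunc_eq_iff (hx _)]
    exact GroupExpansion.truncTensor_eq_zero (N := 2 * n) (by omega)
      (comul_sub_mem_of_texp_sub_mem (ha _) (h _))
  · rw [map_texp, hx, ← map_texp, ← sub_eq_zero, ← map_sub, truncMk_eq_zero]
    exact h N

/-- The logarithm of a group element in the Malcev Lie algebra. -/
def groupLog [CharZero k] (g : G) : malcev k G :=
  ⟨(exists_log g).choose, (exists_log g).choose_spec.1⟩

lemma proj_texp_groupLog [CharZero k] (g : G) (N : ℕ) :
    proj N (texp k N (groupLog (k := k) g : CompletedAlg k G)) =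
      truncMk k G N (MonoidAlgebra.of k G g) :=
  (exists_log g).choose_spec.2 N

lemma mem_malcevFil_one (x : malcev k G) : x ∈ malcevFil k G 1 :=
  proj_one_eq_zero_of_isPrimitive x.2

lemma sub_groupLog_mem [CharZero k] {g : G} {x : malcev k G} {N : ℕ}
    (h : proj N (texp k N (x : CompletedAlg k G)) = truncMk k G N (MonoidAlgebra.of k G g)) :
    x - groupLog g ∈ malcevFil k G N := by
  rw [← proj_texp_groupLog, proj_eq_iff] at h
  exact sub_mem_of_texp_sub_mem (completedFil k G) (mem_malcevFil_one x)
    (mem_malcevFil_one (groupLog g)) h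

lemma groupLog_one [CharZero k] : groupLog (k := k) (1 : G) = 0 := by
  have h : ∀ N, (0 : malcev k G) - groupLog 1 ∈ malcevFil k G N := fun N => by
    rcases N with _ | N
    · exact (completedFil k G).mem_zero _
    refine sub_groupLog_mem ?_
    change proj (N + 1) (texp k (N + 1) (0 : CompletedAlg k G)) = _
    rw [texp_zero_right (Nat.succ_pos N), map_one, map_one, map_one]
  refine (sub_eq_zero.1 (Subtype.ext (completedAlg_ext fun n => ?_))).symm
  exact (mem_completedFil.1 (h n)).trans (map_zero _).symm

lemma proj_two_groupLog [CharZero k] (g : G) :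
    proj 2 (groupLog (k := k) g : CompletedAlg k G) =
      truncMk k G 2 (MonoidAlgebra.of k G g - 1) := by
  have := proj_texp_groupLog (k := k) g 2
  rw [texp_two, map_add, map_one] at this
  rw [map_sub, map_one, ← this, add_sub_cancel_left]

end GroupLog

/-! ## The expansion given by a filtered-formality isomorphism -/

section FormalExpansion

open GrHat (component)

variable {k : Type*} [Field k] {G : Type*} [Group G]

/-- The degree filtration of the degree completion of `gr(kG)`. -/
def degreeFil (k G : Type*) [Field k] [Group G] : AlgFiltration k (GrHat k G) where
  fil := grHatFil k G
  fil_zero := grHatFil_zero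
  anti := grHatFil_anti
  mul_mem := mul_mem_grHatFil

/-- The product of two filtrations. -/
def AlgFiltration.prod {B C : Type*} [Ring B] [Algebra k B] [Ring C] [Algebra k C]
    (F : AlgFiltration k B) (H : AlgFiltration k C) : AlgFiltration k (B × C) where
  fil n := (F.fil n).prod (H.fil n)
  fil_zero := by rw [F.fil_zero, H.fil_zero, Submodule.prod_top]
  anti h := Submodule.prod_mono (F.anti h) (H.anti h)
  mul_mem ha hb := ⟨F.mul_mem ha.1 hb.1, H.mul_mem ha.2 hb.2⟩

/-- The exponential in the degree completion. -/
def grHatExp (y : GrHat k G) : GrHat k G :=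
  grHatOfComponents fun n => component n (texp k (n + 1) y)

lemma component_grHatExp {y : GrHat k G} (hy : y ∈ grHatFil k G 1) {n N : ℕ} (h : n < N) :
    component n (grHatExp y) = component n (texp k N y) := by
  rw [grHatExp, component_grHatOfComponents]
  have h1 := texp_sub_texp_mem (degreeFil k G) hy h n (Nat.lt_succ_self n)
  rw [map_sub, sub_eq_zero] at h1
  exact h1.symm

lemma grHatExp_sub_mem {y : GrHat k G} (hy : y ∈ grHatFil k G 1) (N : ℕ) :
    grHatExp y - texp k N y ∈ grHatFil k G N := fun n hn => by
  rw [map_sub, component_grHatExp hy hn, sub_self]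

variable [CharZero k] {α : malcev k G ≃ₗ⁅k⁆ GrLieHat G k}

/-- The image of a primitive element under a filtered-formality isomorphism, in the degree
completion of `gr(kG)`. -/
def formalMap (α : malcev k G ≃ₗ⁅k⁆ GrLieHat G k) : malcev k G →ₗ[k] GrHat k G :=
  compareHat ∘ₗ (α : malcev k G →ₗ[k] GrLieHat G k)

lemma formalMap_apply (x : malcev k G) : formalMap α x = compareHat (α x) := rfl

lemma formalMap_mem_one (x : malcev k G) : formalMap α x ∈ grHatFil k G 1 :=
  compareHat_mem_grHatFil_one _

lemma IsFilteredFormalityIso.formalMap_mem (hα : IsFilteredFormalityIso α) {n : ℕ} {x : malcev k G}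
    (hx : x ∈ malcevFil k G n) : formalMap α x ∈ grHatFil k G n :=
  compareHat_mem_grHatFil.2 ((hα.mem_fil_iff n x).1 hx)

lemma formalMap_lie (x y : malcev k G) : formalMap α ⁅x, y⁆ =
    formalMap α x * formalMap α y - formalMap α y * formalMap α x := by
  rw [formalMap_apply, LieEquiv.map_lie, compareHat_lie]
  rfl

/-- The graph of the map given by a filtered-formality isomorphism, filtered. -/
def formalGraph (α : malcev k G ≃ₗ⁅k⁆ GrLieHat G k) (n : ℕ) :
    Submodule k (CompletedAlg k G × GrHat k G) :=
  (malcevFil k G n).map ((malcev k G).toSubmodule.subtype.prod (formalMap α))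

lemma mem_formalGraph {n : ℕ} {z : CompletedAlg k G × GrHat k G} : z ∈ formalGraph α n ↔
    ∃ x : malcev k G, x ∈ malcevFil k G n ∧ ((x : CompletedAlg k G), formalMap α x) = z :=
  Iff.rfl

/-- The map α preserves brackets and `compareHat` turns brackets into commutators, so the graph is a
Lie algebra in the product algebra. -/
lemma formalGraph_commutator (i j : ℕ) : ∀ a ∈ formalGraph α i, ∀ b ∈ formalGraph α j,
    a * b - b * a ∈ formalGraph α (i + j) := by
  intro a ha b hb
  obtain ⟨x, hx, rfl⟩ := mem_formalGraph.1 ha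
  obtain ⟨y, hy, rfl⟩ := mem_formalGraph.1 hb
  refine mem_formalGraph.2 ⟨⁅x, y⁆, ?_, ?_⟩
  · have h1 := (completedFil k G).mul_mem hx hy
    have h2 := (completedFil k G).mul_mem hy hx
    rw [add_comm j] at h2
    exact sub_mem h1 h2
  · rw [formalMap_lie]
    rfl

/-- Baker–Campbell–Hausdorff, applied to the graph of α, gives one x for both factors of the product
algebra. In the completed group algebra exp(x) ≡ g h, so x ≡ log(g h); in the second factor the same
relation is the multiplicativity sought. -/
lemma IsFilteredFormalityIso.grHatExp_mul (hα : IsFilteredFormalityIso α) (g h : G) :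
    grHatExp (formalMap α (groupLog (g * h))) =
      grHatExp (formalMap α (groupLog g)) * grHatExp (formalMap α (groupLog h)) := by
  refine eq_of_sub_mem_grHatFil fun N => ?_
  have hmem : ∀ g : G, ((groupLog (k := k) g : CompletedAlg k G), formalMap α (groupLog g)) ∈
      formalGraph α 1 := fun g => mem_formalGraph.2 ⟨_, mem_malcevFil_one _, rfl⟩
  obtain ⟨z, hz, h1⟩ := exists_texp_sub_mul_texp_mem ((completedFil k G).prod (degreeFil k G))
    (L := formalGraph α)
    (by rintro n _ ⟨x, hx, rfl⟩; exact ⟨hx, hα.formalMap_mem hx⟩)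
    (fun h => Submodule.map_mono fun _ hx => (completedFil k G).anti h hx)
    formalGraph_commutator (hmem g) (hmem h) N
  obtain ⟨x, -, rfl⟩ := mem_formalGraph.1 hz
  have hfst : ∀ z : CompletedAlg k G × GrHat k G, (texp k N z).1 = texp k N z.1 := fun z =>
    map_texp (AlgHom.fst k _ _) N z
  have hsnd : ∀ z : CompletedAlg k G × GrHat k G, (texp k N z).2 = texp k N z.2 := fun z =>
    map_texp (AlgHom.snd k _ _) N z
  have h2 : texp k N (x : CompletedAlg k G) - texp k N (groupLog (k := k) g : CompletedAlg k G) *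
      texp k N (groupLog (k := k) h : CompletedAlg k G) ∈ (completedFil k G).fil N := by
    have := h1.1
    rwa [Prod.fst_sub, Prod.fst_mul, hfst, hfst, hfst] at this
  have h3 : texp k N (formalMap α x) - texp k N (formalMap α (groupLog g)) *
      texp k N (formalMap α (groupLog h)) ∈ grHatFil k G N := by
    have := h1.2
    rwa [Prod.snd_sub, Prod.snd_mul, hsnd, hsnd, hsnd] at this
  have h4 : x - groupLog (g * h) ∈ malcevFil k G N := sub_groupLog_mem (by
    rw [proj_eq_iff.2 h2, map_mul, proj_texp_groupLog, proj_texp_groupLog, ← map_mul, ← map_mul])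
  have h5 := hα.formalMap_mem h4
  rw [map_sub] at h5
  have h6 := texp_sub_mem_of_sub_mem (k := k) (degreeFil k G) (formalMap_mem_one x)
    (formalMap_mem_one (groupLog (g * h))) h5 N
  have h7 := grHatExp_sub_mem (formalMap_mem_one (α := α) (groupLog (g * h))) N
  have h8 := mul_sub_mul_mem_grHatFil
    (grHatExp_sub_mem (formalMap_mem_one (α := α) (groupLog g)) N)
    (grHatExp_sub_mem (formalMap_mem_one (α := α) (groupLog h)) N)
  have h9 := sub_mem (add_mem (sub_mem h7 h6) h3) h8
  convert h9 using 1
  abel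

/-- The expansion given by a filtered-formality isomorphism. -/
def IsFilteredFormalityIso.expansion (hα : IsFilteredFormalityIso α) : G →* GrHat k G where
  toFun g := grHatExp (formalMap α (groupLog g))
  map_one' := by
    rw [groupLog_one, map_zero]
    refine GrHat.ext fun n => ?_
    rw [component_grHatExp (zero_mem _) (Nat.lt_succ_self n), texp_zero_right (Nat.succ_pos n)]
  map_mul' g h := hα.grHatExp_mul g h

lemma IsFilteredFormalityIso.expansion_sub_one_mem (hα : IsFilteredFormalityIso α) (g : G) :
    hα.expansion g - 1 ∈ grHatFil k G 1 := by
  have h := grHatExp_sub_mem (formalMap_mem_one (α := α) (groupLog g)) 1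
  rwa [texp_one] at h

/-- In degree 1 the exponential is 1 plus its argument, log g ≡ g - 1 modulo I^2, and α induces the
identity on graded pieces. -/
lemma IsFilteredFormalityIso.component_expansion_sub_one (hα : IsFilteredFormalityIso α) (g : G)
    (f : augPow k G 1) (hf : (f : GroupAlg k G) = MonoidAlgebra.of k G g - 1) :
    component 1 (hα.expansion g - 1) = grMk 1 f := by
  have h := grHatExp_sub_mem (formalMap_mem_one (α := α) (groupLog g)) 2 1 one_lt_two
  rw [texp_two, ← sub_sub, map_sub, sub_eq_zero] at h
  refine Eq.trans h ?_
  rw [formalMap_apply, component_compareHat]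
  refine hα.gr_eq_id 1 _ _ ?_
  rw [hf]
  exact proj_two_groupLog g

/-- The linear extension of the expansion preserves the filtrations and induces the identity on
associated graded algebras. -/
lemma IsFilteredFormalityIso.expLift_expansion (hα : IsFilteredFormalityIso α) (n : ℕ)
    (f : GroupAlg k G) (hf : f ∈ augIdeal k G ^ n) :
    expLift hα.expansion f ∈ grHatFil k G n ∧
      component n (expLift hα.expansion f) = grMk n ⟨f, hf⟩ := by
  induction n generalizing f with
  | zero =>
    refine ⟨by rw [grHatFil_zero]; trivial, ?_⟩
    have h1 : component 0 ∘ₗ (expLift hα.expansion).toLinearMap =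
        grMk 0 ∘ₗ LinearMap.id.codRestrict (augPow k G 0) mem_augIdeal_pow_zero :=
      linearMap_ext_of fun g => by
        have h2 := hα.expansion_sub_one_mem g 0 one_pos
        rw [map_sub, sub_eq_zero] at h2
        change component 0 (expLift hα.expansion (MonoidAlgebra.of k G g)) =
          grMk 0 ⟨MonoidAlgebra.of k G g, _⟩
        rw [expLift_of, h2, component_one_zero]
        refine (grMk_eq ?_).symm
        rw [zero_add, Submodule.pow_one]
        exact of_sub_one_mem g
    exact LinearMap.congr_fun h1 f
  | succ n ih =>
    -- The conditions are linear in f, so they need only be checked on products a (g - 1), where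
    -- leading components multiply.
    let P : Submodule k (GroupAlg k G) :=
      { carrier := {f | expLift hα.expansion f ∈ grHatFil k G (n + 1) ∧
          ∃ hf : f ∈ augIdeal k G ^ (n + 1),
            component (n + 1) (expLift hα.expansion f) = grMk (n + 1) ⟨f, hf⟩}
        zero_mem' := ⟨by rw [map_zero]; exact zero_mem _, zero_mem _, by
          rw [map_zero, map_zero]; exact (map_zero (grMk (n + 1))).symm⟩
        add_mem' := by
          rintro a b ⟨ha, ha1, ha2⟩ ⟨hb, hb1, hb2⟩
          refine ⟨by rw [map_add]; exact add_mem ha hb, add_mem ha1 hb1, ?_⟩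
          rw [map_add, map_add, ha2, hb2]
          exact (map_add (grMk (n + 1)) _ _).symm
        smul_mem' := by
          rintro c a ⟨ha, ha1, ha2⟩
          refine ⟨by rw [map_smul]; exact Submodule.smul_mem _ _ ha,
            (augPow k G (n + 1)).smul_mem c ha1, ?_⟩
          rw [map_smul, map_smul, ha2]
          exact (map_smul (grMk (n + 1)) c _).symm }
    have h1 : f ∈ P := mem_of_mem_augIdeal_pow_succ (fun a ha g => by
      obtain ⟨h1, h2⟩ := ih a ha
      have h3 : MonoidAlgebra.of k G g - 1 ∈ augIdeal k G ^ 1 := by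
        rw [Submodule.pow_one]; exact of_sub_one_mem g
      have h4 : expLift hα.expansion (a * (MonoidAlgebra.of k G g - 1)) =
          expLift hα.expansion a * (hα.expansion g - 1) := by
        rw [map_mul, map_sub, map_one, expLift_of]
      refine ⟨?_, mul_mem_augIdeal_pow rfl ha h3, ?_⟩
      · rw [h4]; exact mul_mem_grHatFil h1 (hα.expansion_sub_one_mem g)
      · rw [h4, component_mul_of_mem rfl h1 (hα.expansion_sub_one_mem g), h2,
          hα.component_expansion_sub_one g ⟨_, h3⟩ rfl, grMul_mk]) hf
    exact ⟨h1.1, h1.2.2⟩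

lemma IsFilteredFormalityIso.isExpansion (hα : IsFilteredFormalityIso α) :
    IsExpansion hα.expansion where
  mem_fil n f := (hα.expLift_expansion n f f.2).1
  gr_eq_id n f := (hα.expLift_expansion n f f.2).2

end FormalExpansion

/-! ## Exponentials of primitive elements are group-like -/

section GroupLike

open Finset.HasAntidiagonal (antidiagonal mem_antidiagonal)
open PowerSeries (coeff)
open GrHat (component)

variable {k : Type*} [Field k]

section Shifted

variable {B : Type*} [Ring B] [Algebra k B] (F : AlgFiltration k B)

/-- Power series whose `n`-th coefficient lies in step `n + 1` of a filtration. -/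
def AlgFiltration.shiftedSeries : Submodule k (PowerSeries B) :=
  seriesIn fun n => F.fil (n + 1)

lemma AlgFiltration.mul_mem_shiftedSeries_left {f g : PowerSeries B} (hf : f ∈ F.shiftedSeries)
    (hg : g ∈ F.series) : f * g ∈ F.shiftedSeries := fun n => by
  rw [PowerSeries.coeff_mul]
  refine sum_mem fun p hp => ?_
  have h := F.mul_mem (hf p.1) (hg p.2)
  rwa [add_right_comm, mem_antidiagonal.1 hp] at h

lemma AlgFiltration.mul_mem_shiftedSeries_right {f g : PowerSeries B} (hf : f ∈ F.series)
    (hg : g ∈ F.shiftedSeries) : f * g ∈ F.shiftedSeries := fun n => by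
  rw [PowerSeries.coeff_mul]
  refine sum_mem fun p hp => ?_
  have h := F.mul_mem (hf p.1) (hg p.2)
  rwa [← add_assoc, mem_antidiagonal.1 hp] at h

/-- Shifted series absorb products with `F.series` on both sides, so powers preserve the congruence.
-/
lemma AlgFiltration.texp_sub_mem_shiftedSeries {f g : PowerSeries B} (hf : f ∈ F.series)
    (hg : g ∈ F.series) (h : f - g ∈ F.shiftedSeries) (N : ℕ) :
    texp k N f - texp k N g ∈ F.shiftedSeries := by
  have hpow : ∀ m, f ^ m - g ^ m ∈ F.shiftedSeries := fun m => by
    induction m with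
    | zero => simp
    | succ m ih =>
      have h1 := add_mem (F.mul_mem_shiftedSeries_left ih hf)
        (F.mul_mem_shiftedSeries_right (F.series.pow_mem hg m) h)
      rwa [sub_mul, mul_sub, ← pow_succ, ← pow_succ, sub_add_sub_cancel] at h1
  rw [texp, texp, ← Finset.sum_sub_distrib]
  refine sum_mem fun m _ => ?_
  rw [← smul_sub]
  exact Submodule.smul_mem _ _ (hpow m)

end Shifted

/-! ### Computing exponentials on lifts to kG -/

variable {G : Type*} [Group G]

/-- For a ∈ Γ_n, the lift a - 1 fails to be primitive by (a-1) ⊗ (a-1), of order 2n ≥ n + 1; the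
general case is linear. -/
lemma exists_lift_compare {n : ℕ} (hn : n ≠ 0) (X : GrLie G k n) :
    ∃ p : augPow k G n, grMk n p = compare n X ∧
      Bialgebra.comulAlgHom k (GroupAlg k G) p - ((p : GroupAlg k G) ⊗ₜ 1 + 1 ⊗ₜ (p : GroupAlg k G)) ∈
        tensorFil k G (n + 1) := by
  induction X using TensorProduct.induction_on with
  | zero => exact ⟨0, by rw [map_zero, map_zero], by simp⟩
  | add X Y hX hY =>
    obtain ⟨p, hp, hp'⟩ := hX
    obtain ⟨q, hq, hq'⟩ := hY
    refine ⟨p + q, by rw [map_add, map_add, hp, hq], ?_⟩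
    have h1 := add_mem hp' hq'
    convert h1 using 1
    rw [Submodule.coe_add, map_add, TensorProduct.add_tmul, TensorProduct.tmul_add]
    abel
  | tmul t x =>
    obtain ⟨a, ha⟩ := lcsMk_surjective n x.toMul
    obtain rfl : x = Additive.ofMul (lcsMk n a) := congrArg Additive.ofMul ha.symm
    refine ⟨t • ⟨MonoidAlgebra.of k G a.1 - 1, sub_one_mem_augPow n a⟩, ?_, ?_⟩
    · rw [compare_tmul, map_smul, subOneClass]
    · have h1 : Bialgebra.comulAlgHom k (GroupAlg k G) (MonoidAlgebra.of k G a.1) =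
        MonoidAlgebra.of k G a.1 ⊗ₜ[k] MonoidAlgebra.of k G a.1 := by simp
      have h2 : (MonoidAlgebra.of k G a.1 - 1) ⊗ₜ[k] (MonoidAlgebra.of k G a.1 - 1) ∈
          tensorFil k G (n + n) :=
        tmul_mem_tensorFil rfl (sub_one_mem_augPow n a) (sub_one_mem_augPow n a)
      have h3 := Submodule.smul_mem _ t
        (show _ ∈ tensorFil k G (n + 1) from
          (tensorSquareFil k G).anti (show n + 1 ≤ n + n by omega) h2)
      let Φ : GroupAlg k G →ₗ[k] GroupAlg k G ⊗[k] GroupAlg k G :=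
        (Bialgebra.comulAlgHom k (GroupAlg k G)).toLinearMap -
          ((TensorProduct.mk k _ _).flip 1 + TensorProduct.mk k _ _ 1)
      have h4 : Φ (MonoidAlgebra.of k G a.1 - 1) =
          (MonoidAlgebra.of k G a.1 - 1) ⊗ₜ (MonoidAlgebra.of k G a.1 - 1) := by
        change Bialgebra.comulAlgHom k (GroupAlg k G) (MonoidAlgebra.of k G a.1 - 1) -
          ((MonoidAlgebra.of k G a.1 - 1) ⊗ₜ 1 + 1 ⊗ₜ (MonoidAlgebra.of k G a.1 - 1)) = _
        rw [map_sub, map_one, h1, Algebra.TensorProduct.one_def]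
        simp only [TensorProduct.sub_tmul, TensorProduct.tmul_sub]
        abel
      rw [← h4, ← map_smul] at h3
      exact h3

/-- The pairs of a power series over `kG` and the element of the degree completion that it
represents. -/
def representing (k G : Type*) [Field k] [Group G] :
    Subalgebra k (PowerSeries (GroupAlg k G) × GrHat k G) where
  carrier := {z | ∃ ha, GrHat.ofSeries z.1 ha = z.2}
  mul_mem' := by
    rintro ⟨a, y⟩ ⟨b, z⟩ ⟨ha, hy⟩ ⟨hb, hz⟩
    dsimp only at ha hy hb hz
    subst hy hz
    exact ⟨_, (GrHat.ofSeries_mul ha hb).symm⟩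
  add_mem' := by
    rintro ⟨a, y⟩ ⟨b, z⟩ ⟨ha, hy⟩ ⟨hb, hz⟩
    dsimp only at ha hy hb hz
    subst hy hz
    refine ⟨fun n => ?_, GrHat.ext fun n => ?_⟩
    · change coeff n (a + b) ∈ _
      rw [map_add]; exact add_mem (ha n) (hb n)
    · change _ = grMk n ⟨coeff n a, ha n⟩ + grMk n ⟨coeff n b, hb n⟩
      rw [← map_add]
      exact congrArg (grMk n) (Subtype.ext (map_add (coeff n) a b))
  algebraMap_mem' c := by
    rw [Algebra.algebraMap_eq_smul_one]
    refine ⟨fun n => ?_, GrHat.ext fun n => ?_⟩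
    · change coeff n (c • (1 : PowerSeries (GroupAlg k G))) ∈ _
      rw [PowerSeries.coeff_smul]
      exact (augPow k G n).smul_mem c (GrHat.coeff_one_mem n)
    · change _ = component n (c • (1 : GrHat k G))
      rw [map_smul, ← GrHat.ofSeries_one (k := k) (G := G)]
      change _ = c • grMk n ⟨coeff n (1 : PowerSeries (GroupAlg k G)), GrHat.coeff_one_mem n⟩
      rw [← map_smul]
      exact congrArg (grMk n) (Subtype.ext (PowerSeries.coeff_smul n 1 c))

/-- Pairs of a series and the element it represents form a subalgebra, so the exponential of a pair
is again such a pair. -/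
lemma exists_texp_representing {a : PowerSeries (GroupAlg k G)}
    (ha : ∀ n, coeff n a ∈ augIdeal k G ^ n) (N : ℕ) :
    ∃ h : ∀ n, coeff n (texp k N a) ∈ augIdeal k G ^ n,
      texp k N (GrHat.ofSeries a ha) = GrHat.ofSeries (texp k N a) h := by
  have h1 : texp k N (a, GrHat.ofSeries a ha) ∈ representing k G :=
    texp_mem_subalgebra _ N ⟨ha, rfl⟩
  have hfst : (texp k N (a, GrHat.ofSeries a ha)).1 = texp k N a :=
    map_texp (AlgHom.fst k (PowerSeries (GroupAlg k G)) (GrHat k G)) N _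
  have hsnd : (texp k N (a, GrHat.ofSeries a ha)).2 = texp k N (GrHat.ofSeries a ha) :=
    map_texp (AlgHom.snd k (PowerSeries (GroupAlg k G)) (GrHat k G)) N _
  obtain ⟨h, h2⟩ := h1
  rw [hsnd] at h2
  exact ⟨hfst ▸ h, h2.symm.trans (GrHat.ofSeries_congr hfst _ _)⟩

lemma truncTensor_sum_antidiagonal {c : ℕ → GroupAlg k G} (hc : ∀ n, c n ∈ augIdeal k G ^ n)
    {i j n : ℕ} (h : i + j = n) :
    truncTensor k G (i + 1) (j + 1) (∑ p ∈ antidiagonal n, c p.1 ⊗ₜ c p.2) =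
      truncMk k G (i + 1) (c i) ⊗ₜ truncMk k G (j + 1) (c j) := by
  rw [map_sum, Finset.sum_eq_single (i, j)]
  · rw [truncTensor, Algebra.TensorProduct.map_tmul]
  · rintro ⟨u, v⟩ hp hne
    have hp' := mem_antidiagonal.1 hp
    dsimp only at hp' ⊢
    rw [truncTensor, Algebra.TensorProduct.map_tmul]
    rcases lt_trichotomy u i with hu | hu | hu
    · rw [truncMk_eq_zero.2 (augIdeal_pow_le (show j + 1 ≤ v by omega) (hc v)),
        TensorProduct.tmul_zero]
    · exact absurd (Prod.ext hu (show v = j by omega)) hne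
    · rw [truncMk_eq_zero.2 (augIdeal_pow_le (show i + 1 ≤ u by omega) (hc u)),
        TensorProduct.zero_tmul]
  · intro h'
    exact absurd (mem_antidiagonal.2 h) h'

/-- The comultiplication of the exponential of a power series with primitive leading terms. -/
lemma truncTensor_comul_texp [CharZero k] {a : PowerSeries (GroupAlg k G)}
    (ha : ∀ n, coeff n a ∈ augIdeal k G ^ n) (ha0 : coeff 0 a = 0)
    (hprim : ∀ n, Bialgebra.comulAlgHom k (GroupAlg k G) (coeff n a) -
      (coeff n a ⊗ₜ 1 + 1 ⊗ₜ coeff n a) ∈ tensorFil k G (n + 1)) {i j n : ℕ} (h : i + j = n) :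
    truncTensor k G (i + 1) (j + 1)
        (Bialgebra.comulAlgHom k (GroupAlg k G) (coeff n (texp k (n + 1) a))) =
      truncMk k G (i + 1) (coeff i (texp k (n + 1) a)) ⊗ₜ
        truncMk k G (j + 1) (coeff j (texp k (n + 1) a)) := by
  let l : GroupAlg k G →ₐ[k] GroupAlg k G ⊗[k] GroupAlg k G := Algebra.TensorProduct.includeLeft
  let r : GroupAlg k G →ₐ[k] GroupAlg k G ⊗[k] GroupAlg k G := Algebra.TensorProduct.includeRight
  have hlr : ∀ b c, l b * r c = b ⊗ₜ c := fun b c => by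
    change (b ⊗ₜ[k] 1) * (1 ⊗ₜ[k] c) = _
    rw [Algebra.TensorProduct.tmul_mul_tmul, one_mul, mul_one]
  have hrl : ∀ b c, r c * l b = b ⊗ₜ c := fun b c => by
    change (1 ⊗ₜ[k] c) * (b ⊗ₜ[k] 1) = _
    rw [Algebra.TensorProduct.tmul_mul_tmul, one_mul, mul_one]
  have hcoeff : ∀ (φ : GroupAlg k G →ₐ[k] GroupAlg k G ⊗[k] GroupAlg k G)
      (f : PowerSeries (GroupAlg k G)) (m : ℕ),
      coeff m (PowerSeries.mapAlgHom φ f) = φ (coeff m f) := fun φ f m =>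
    PowerSeries.coeff_map _ m f
  let Δ := Bialgebra.comulAlgHom k (GroupAlg k G)
  set N := n + 1
  have hΔ : PowerSeries.mapAlgHom Δ a ∈ (tensorSquareFil k G).series := fun m => by
    rw [hcoeff]; exact comul_mem_tensorFil (ha m)
  have hl : PowerSeries.mapAlgHom l a ∈ (tensorSquareFil k G).series := fun m => by
    rw [hcoeff]; exact tmul_mem_tensorFil (add_zero _) (ha m) (mem_augIdeal_pow_zero 1)
  have hr : PowerSeries.mapAlgHom r a ∈ (tensorSquareFil k G).series := fun m => by
    rw [hcoeff]; exact tmul_mem_tensorFil (zero_add _) (mem_augIdeal_pow_zero 1) (ha m)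
  have h1 : texp k N (PowerSeries.mapAlgHom Δ a) -
      texp k N (PowerSeries.mapAlgHom l a + PowerSeries.mapAlgHom r a) ∈
        (tensorSquareFil k G).shiftedSeries :=
    (tensorSquareFil k G).texp_sub_mem_shiftedSeries hΔ (add_mem hl hr) (fun m => by
      rw [map_sub, map_add, hcoeff, hcoeff, hcoeff]
      exact hprim m) N
  have hord : ∀ φ : GroupAlg k G →ₐ[k] GroupAlg k G ⊗[k] GroupAlg k G,
      PowerSeries.mapAlgHom φ a ∈ (orderFil k (GroupAlg k G ⊗[k] GroupAlg k G)).fil 1 :=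
    fun φ m hm => by
      obtain rfl : m = 0 := by omega
      rw [hcoeff, ha0, map_zero]
  have hcomm : Commute (PowerSeries.mapAlgHom l a) (PowerSeries.mapAlgHom r a) := by
    refine PowerSeries.ext fun m => ?_
    rw [PowerSeries.coeff_mul, PowerSeries.coeff_mul, ← Finset.Nat.sum_antidiagonal_swap]
    refine Finset.sum_congr rfl fun p _ => ?_
    rw [Prod.fst_swap, Prod.snd_swap, hcoeff, hcoeff, hlr, hrl]
  -- As a has no constant term, e^(l+r) = e^l e^r holds modulo X^(n+1), in particular in degree n.
  have h2 := texp_add_sub_mem _ (hord l) (hord r) hcomm N n (Nat.lt_succ_self n)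
  have h3 := h1 n
  rw [map_sub, sub_eq_zero] at h2
  rw [map_sub, h2, ← map_texp, ← map_texp, ← map_texp, hcoeff, PowerSeries.coeff_mul] at h3
  simp only [hcoeff, hlr] at h3
  -- The failure of primitivity has order n + 1 = i + j + 1 in the tensor filtration and vanishes in
  -- bidegree (i, j).
  have h4 := GroupExpansion.truncTensor_eq_zero (show i + 1 + (j + 1) ≤ n + 1 + 1 by omega) h3
  rw [map_sub, sub_eq_zero] at h4
  refine h4.trans (truncTensor_sum_antidiagonal (c := fun m => coeff m (texp k N a)) ?_ h)
  exact texp_mem_subalgebra (augFil k G).series N ha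

lemma grHatComul_grHatExp [CharZero k] (z : GrLieHat G k) :
    grHatComul (grHatExp (compareHat z)) =
      grHatTmul (grHatExp (compareHat z)) (grHatExp (compareHat z)) := by
  choose p hp hp' using fun n => exists_lift_compare (Nat.succ_ne_zero n)
    (GrLieHat.component (n + 1) z)
  -- The lifts `p` start in degree 1; the lift in degree 0 is 0 because gr_0(G; k) = 0.
  let c : ℕ → GroupAlg k G := fun n => Nat.rec 0 (fun n _ => (p n : GroupAlg k G)) n
  let a : PowerSeries (GroupAlg k G) := PowerSeries.mk c
  have hca : ∀ n, coeff n a = c n := fun n => PowerSeries.coeff_mk n c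
  have ha : ∀ n, coeff n a ∈ augIdeal k G ^ n := fun n => by
    rw [hca]
    rcases n with _ | n
    · exact mem_augIdeal_pow_zero _
    · exact (p n).2
  have hy : GrHat.ofSeries a ha = compareHat z := by
    refine GrHat.ext fun n => ?_
    rw [component_compareHat]
    change grMk n ⟨coeff n a, ha n⟩ = _
    rcases n with _ | n
    · rw [Subsingleton.elim (GrLieHat.component 0 z) 0, map_zero]
      refine (grMk_eq_zero _).2 ?_
      change coeff 0 a ∈ _
      rw [hca]
      exact zero_mem _
    · rw [← hp n]
      exact congrArg (grMk (n + 1)) (Subtype.ext (hca (n + 1)))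
  have hprim : ∀ n, Bialgebra.comulAlgHom k (GroupAlg k G) (coeff n a) -
      (coeff n a ⊗ₜ 1 + 1 ⊗ₜ coeff n a) ∈ tensorFil k G (n + 1) := fun n => by
    rw [hca]
    rcases n with _ | n
    · have h0 : c 0 = 0 := rfl
      rw [h0]; simp
    · exact hp' n
  funext i j
  obtain ⟨h, hexp⟩ := exists_texp_representing ha (i + j + 1)
  have hcomp : ∀ m (hm : m < i + j + 1), component m (grHatExp (compareHat z)) =
      grMk m ⟨coeff m (texp k (i + j + 1) a), h m⟩ := fun m hm => by
    rw [component_grHatExp (compareHat_mem_grHatFil_one z) hm, ← hy, hexp]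
    rfl
  change grComul rfl (component (i + j) (grHatExp (compareHat z))) =
    component i (grHatExp (compareHat z)) ⊗ₜ component j (grHatExp (compareHat z))
  rw [hcomp _ (Nat.lt_succ_self _), hcomp i (by omega), hcomp j (by omega)]
  refine grTensorIncl_injective i j ?_
  rw [grTensorIncl_grComul]
  exact truncTensor_comul_texp ha (hca 0) hprim rfl

lemma IsFilteredFormalityIso.isTaylorExpansion [CharZero k] {α : malcev k G ≃ₗ⁅k⁆ GrLieHat G k}
    (hα : IsFilteredFormalityIso α) : IsTaylorExpansion hα.expansion where
  toIsExpansion := hα.isExpansion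
  groupLike _ := grHatComul_grHatExp _

lemma IsFilteredFormal.hasFaithfulTaylorExpansion [CharZero k] (h : IsFilteredFormal k G)
    (hG : IsResiduallyTorsionFreeNilpotent G) : HasFaithfulTaylorExpansion k G := by
  obtain ⟨α, hα⟩ := h
  exact ⟨hα.expansion, hα.isTaylorExpansion,
    hα.isExpansion.injective fun _ hg => eq_one_of_mem_dimSubgroup hG hg⟩

end GroupLike

end

end GroupExpansion

theorem proposition1p3 {k : Type*} [Field k] [CharZero k] {G : Type*} [Group G] [Group.FG G] :
    GroupExpansion.HasFaithfulTaylorExpansion k G ↔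
      GroupExpansion.IsResiduallyTorsionFreeNilpotent G ∧
        GroupExpansion.IsFilteredFormal k G := by
  exact ⟨fun h => h.residual_and_formal, fun h => h.2.hasFaithfulTaylorExpansion h.1⟩
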